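/- Let $n\ge 1$, $m\ge 0$ be integers. For $w\in\mathbb C^k$ and $v\in\mathbb C^{k+1}$ put $$A(w)=\prod_{i<j}(w_i-w_j),\qquad A^*(w,v)=\prod_{i\le l}(w_i-v_l)\prod_{i>l}(v_l-w_i),$$ and for $x,\nu\in\mathbb C^n$ put $B(x)=\prod_{i<j}\sinh(x_i-x_j)$, $C_m(\nu)=\prod_{k=1}^m\prod_{i<j}(\nu_i-\nu_j-k)$, $(\nu,x)=\sum_i\nu_ix_i$, and $\binom{a}{m}=\frac{a(a-1)\cdots(a-m+1)}{m!}$. The trigonometric Baker–Akhiezer (BA) function $\Phi=\Phi^{(n)}_m$ is the function of the form $$\Phi=\frac{P(x,\nu)}{B(x)^m\,C_m(\nu)}\,e^{2(\nu,x)},$$ where $P$ is a trigonometric polynomial in $x$ (a finite sum of terms $p_a(\nu)e^{(a,x)}$, $a\in\mathbb Z^n$) and a polynomial in $\nu$ whose leading (highest-degree) term is $B(x)^mA(\nu)^m$, such that $P/(B^mC_m)\to 1$ as $x\to+\infty$ in the Weyl chamber $x_1>\dots>x_n$ (i.e. when $x$ is real and all $x_i-x_j\to+\infty$, $i<j$),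 and $$\Big(-\Delta+\sum_{i<j}\frac{2m(m+1)}{\sinh^2(x_i-x_j)}\Big)\Phi=-4(\nu,\nu)\,\Phi .$$ Here $x$ ranges over the points for which the numbers $u_i=e^{2x_i}$ are pairwise distinct, and $\nu$ over the points with $C_m(\nu)\neq0$. Powers of $u_i$ are taken with the branch $\log u_i=2x_i$. **Corollary.** Such a function exists, and for all such $x,\nu$ every such function is given by the iterated residue formula $$\Phi^{(n)}_m(u,\nu)=C(n,m,\nu)\,\prod_{i=1}^n u_i^{\nu_n}\;A(u)^{1+m}\int_\Sigma\omega^*_m,\qquad C(n,m,\nu)^{-1}=(2\pi i)^{\frac{n(n-1)}2}\prod_{i<j}\binom{\nu_i-\nu_j-1}{m}.$$ The integration variables are the $n(n-1)/2$ variables $t_{i,j}$, $1\le i\le j\le n-1$. With $t_j=(t_{1,j},\dots,t_{j,j})$ for $j<n$ and $t_n=u$, the integrand is $$\omega^*_m=\prod_{j=1}^{n-1}A^*(t_j,t_{j+1})^{-m-1}\,\prod_{j=1}^{n-1}A(t_j)^{2+2m}\,\prod_{1\le i\le j\le n-1}t_{i,j}^{\,\nu_j-\nu_{j+1}+m}\,dt_{i,j}.$$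 The cycle $\Sigma$ is the product of the positively oriented circles $|t_{i,j}-u_i|=\varepsilon(n-j)$, where $\varepsilon>0$ is any number so small that the closed discs $|t-u_i|\le(n-1)\varepsilon$ are pairwise disjoint and do not contain the origin. On the $i$-th disc the powers of $t_{i,j}$ use the continuous branch of the logarithm equal to $2x_i$ at $u_i$. -/

import Mathlib

/-- `A(w) = ∏_{i<j} (w_i - w_j)`. -/
def vandA {k : ℕ} (w : Fin k → ℂ) : ℂ :=
  ∏ i, ∏ j ∈ Finset.Ioi i, (w i - w j)

/-- `A^*(w,v) = ∏_{i≤l} (w_i - v_l) ∏_{i>l} (v_l - w_i)` for `k` variables `w` and `k+1`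
variables `v`. -/
def vandAStar {k : ℕ} (w : Fin k → ℂ) (v : Fin (k + 1) → ℂ) : ℂ :=
  ∏ i : Fin k, ∏ l : Fin (k + 1), if i.1 ≤ l.1 then w i - v l else v l - w i

/-- `B(x) = ∏_{i<j} sinh (x_i - x_j)`. -/
noncomputable def sinhB {n : ℕ} (x : Fin n → ℂ) : ℂ :=
  ∏ i, ∏ j ∈ Finset.Ioi i, Complex.sinh (x i - x j)

/-- `C_m(ν) = ∏_{k=1}^m ∏_{i<j} (ν_i - ν_j - k)`. -/
def normC {n : ℕ} (m : ℕ) (ν : Fin n → ℂ) : ℂ :=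
  ∏ k ∈ Finset.Icc 1 m, ∏ i, ∏ j ∈ Finset.Ioi i, (ν i - ν j - (k : ℂ))

/-- The binomial coefficient `a (a-1) ⋯ (a-m+1) / m!`. -/
noncomputable def gbinom (a : ℂ) (m : ℕ) : ℂ :=
  (∏ k ∈ Finset.range m, (a - (k : ℂ))) / (m.factorial : ℂ)

/-- The Sutherland operator `-Δ + ∑_{i<j} 2m(m+1)/sinh²(x_i - x_j)` applied to `f` at `x`. -/
noncomputable def sutherland {n : ℕ} (m : ℕ) (f : (Fin n → ℂ) → ℂ) (x : Fin n → ℂ) : ℂ :=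
  -(∑ i, iteratedDeriv 2 (fun s : ℂ => f (Function.update x i s)) (x i))
    + (∑ i, ∑ j ∈ Finset.Ioi i,
        2 * (m : ℂ) * ((m : ℂ) + 1) / Complex.sinh (x i - x j) ^ 2) * f x

/-- Functions that are trigonometric polynomials in `x` and polynomials in `ν`: finite sums
`∑_a p_a(ν) exp(a_1 x_1 + ⋯ + a_n x_n)` with `a ∈ ℤⁿ`, stored as `a ↦ p_a`. -/
abbrev TrigPoly (n : ℕ) : Type := (Fin n → ℤ) →₀ MvPolynomial (Fin n) ℂ

/-- The polynomial in `ν` obtained by fixing `x`. -/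
noncomputable def TrigPoly.atX {n : ℕ} (P : TrigPoly n) (x : Fin n → ℂ) :
    MvPolynomial (Fin n) ℂ :=
  P.sum fun a p => MvPolynomial.C (Complex.exp (∑ i, (a i : ℂ) * x i)) * p

/-- The value `P(x, ν)`. -/
noncomputable def TrigPoly.value {n : ℕ} (P : TrigPoly n) (x ν : Fin n → ℂ) : ℂ :=
  MvPolynomial.eval ν (P.atX x)

/-- `P(x, ν)`, as a polynomial in `ν`, has leading (highest degree) term `B(x)^m A(ν)^m`. -/
def TrigPoly.HasLeadingTerm {n : ℕ} (m : ℕ) (P : TrigPoly n) : Prop :=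
  ∀ x : Fin n → ℂ,
    (P.atX x).totalDegree ≤ m * (n * (n - 1) / 2) ∧
    MvPolynomial.homogeneousComponent (m * (n * (n - 1) / 2)) (P.atX x) =
      MvPolynomial.C (sinhB x ^ m) *
        (∏ i, ∏ j ∈ Finset.Ioi i, (MvPolynomial.X i - MvPolynomial.X j)) ^ m

/-- The filter on `ℝⁿ` describing `x → +∞` in the Weyl chamber `x_1 > x_2 > ⋯ > x_n`:
all differences `x_i - x_j`, `i < j`, tend to `+∞`. -/
def chamberAtTop (n : ℕ) : Filter (Fin n → ℝ) :=
  ⨅ i : Fin n, ⨅ j ∈ Finset.Ioi i, Filter.comap (fun x => x i - x j) Filter.atTop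

/-- `x` lies off the singular locus, i.e. the numbers `exp (2 x_i)` are pairwise distinct. -/
def OffWalls {n : ℕ} (x : Fin n → ℂ) : Prop :=
  ∀ i j : Fin n, i ≠ j → Complex.exp (2 * x i) ≠ Complex.exp (2 * x j)

/-- `Φ(x, ν)` is a trigonometric Baker-Akhiezer function of type `A_{n-1}` with multiplicity `m`:
it has the form `P(x,ν) / (B(x)^m C_m(ν)) * exp 2(ν,x)` with `P` a trigonometric polynomial in `x`
and a polynomial in `ν` with leading term `B(x)^m A(ν)^m`, it is normalised at infinity in the
Weyl chamber, and it is an eigenfunction of the Sutherland operator with eigenvalue `-4(ν,ν)`. -/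
def IsTrigBA (n m : ℕ) (Φ : (Fin n → ℂ) → (Fin n → ℂ) → ℂ) : Prop :=
  (∃ P : TrigPoly n,
    P.HasLeadingTerm m ∧
    (∀ x ν : Fin n → ℂ, OffWalls x → normC m ν ≠ 0 →
      Φ x ν = P.value x ν / (sinhB x ^ m * normC m ν) * Complex.exp (2 * ∑ i, ν i * x i)) ∧
    (∀ ν : Fin n → ℂ, normC m ν ≠ 0 →
      Filter.Tendsto
        (fun x : Fin n → ℝ =>
          P.value (fun i => (x i : ℂ)) ν / (sinhB (fun i => (x i : ℂ)) ^ m * normC m ν))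
        (chamberAtTop n) (nhds 1))) ∧
  (∀ x ν : Fin n → ℂ, OffWalls x → normC m ν ≠ 0 →
    sutherland m (fun y => Φ y ν) x = -4 * (∑ i, ν i ^ 2) * Φ x ν)

/-- Index set of the `n(n-1)/2` integration variables: with zero-based indices, `⟨j, i⟩` stands
for `t_{i+1, j+1}`, where `1 ≤ i+1 ≤ j+1 ≤ n-1`. -/
abbrev TriIdx (n : ℕ) : Type := Σ j : Fin (n - 1), Fin (j.1 + 1)

/-- The index of the point `u_{i+1}` around which the variable `t_{i+1, j+1}` runs. -/
def TriIdx.pt {n : ℕ} (p : TriIdx n) : Fin n := ⟨p.2.1, by omega⟩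

/-- The row `(t_{1,j+1}, …, t_{j+1,j+1})`; the last row is `t_{i,n} = u_i`. -/
def triRow {n : ℕ} (u : Fin n → ℂ) (t : TriIdx n → ℂ) (j : Fin n) : Fin (j.1 + 1) → ℂ :=
  fun i => if h : j.1 < n - 1 then t ⟨⟨j.1, h⟩, i⟩ else u ⟨i.1, by omega⟩

/-- The power `t^a` for `t` near `u = exp (2 y)`, with the branch of the logarithm for which
`log u = 2 y`. On the disc `|t - u| < |u|` the principal logarithm of `t / u` is holomorphic. -/
noncomputable def branchPow (y t a : ℂ) : ℂ :=
  Complex.exp (a * (2 * y + Complex.log (t / Complex.exp (2 * y))))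

/-- The integrand `ω^*_m` (without the differentials), where `u_i = exp (2 x_i)`. -/
noncomputable def omegaStar {n : ℕ} (m : ℕ) (x ν : Fin n → ℂ) (t : TriIdx n → ℂ) : ℂ :=
  (∏ j : Fin (n - 1),
    (vandAStar (triRow (fun i => Complex.exp (2 * x i)) t ⟨j.1, by omega⟩)
      (triRow (fun i => Complex.exp (2 * x i)) t ⟨j.1 + 1, by omega⟩) ^ (m + 1))⁻¹) *
  (∏ j : Fin (n - 1),
    vandA (triRow (fun i => Complex.exp (2 * x i)) t ⟨j.1, by omega⟩) ^ (2 + 2 * m)) *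
  ∏ p : TriIdx n,
    branchPow (x p.pt) (t p) (ν ⟨p.1.1, by omega⟩ - ν ⟨p.1.1 + 1, by omega⟩ + (m : ℂ))

/-- The integral of `f(t) ∏ dt_p` over the product of the positively oriented circles
`|t_p - c_p| = R_p`, indexed by a finite type. -/
noncomputable def circlesIntegral {ι : Type} [Fintype ι] (c : ι → ℂ) (R : ι → ℝ)
    (f : (ι → ℂ) → ℂ) : ℂ :=
  ∫ θ in Set.Icc (0 : ι → ℝ) (fun _ => 2 * Real.pi),
    (∏ p, (R p : ℂ) * Complex.exp ((θ p : ℂ) * Complex.I) * Complex.I) *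
      f (fun p => c p + (R p : ℂ) * Complex.exp ((θ p : ℂ) * Complex.I))

/-- `∫_Σ ω^*_m` over the product of the circles `|t_{i,j} - u_i| = ε (n - j)`
(with the one-based `j` of `t_{i,j}`), where `u_i = exp (2 x_i)`. -/
noncomputable def trigResidueIntegral {n : ℕ} (m : ℕ) (x ν : Fin n → ℂ) (ε : ℝ) : ℂ :=
  circlesIntegral (fun p : TriIdx n => Complex.exp (2 * x p.pt))
    (fun p => ε * ((n : ℝ) - ((p.1.1 : ℝ) + 1))) (omegaStar m x ν)

/-- The constant `C(n,m,ν)`. -/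
noncomputable def trigConst {n : ℕ} (m : ℕ) (ν : Fin n → ℂ) : ℂ :=
  ((2 * (Real.pi : ℂ) * Complex.I) ^ (n * (n - 1) / 2) *
    ∏ i, ∏ j ∈ Finset.Ioi i, gbinom (ν i - ν j - 1) m)⁻¹

/-! Write `u_i = exp (2 x_i)`. The proof evaluates the integral in closed form, checks that the
result is a BA function, and shows that there is only one.

Evaluation. Keep the last row of the array as a free point `v` near `u` and integrate row by row.
One row contributes the kernel `(A(t) A(v) / A^*(t,v))^(m+1)` times powers of `t_i`. Inside the
circles its only singularities are poles of order `m+1` at `t_i = v_i`, so each integration is an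
`m`-th derivative at `v_i`. After conjugation by the powers and by the regular part of the kernel,
each derivative becomes `t_i ∂/∂t_i` plus a linear form in `ν` plus a polynomial in the ratios `z_a
/ (z_a - z_b)`. These ratios ("symbols") span an algebra stable under `z_a ∂/∂z_a`, so the integral
is an explicit product of powers times a polynomial `baPoly` in `ν` and the symbols
(`circlesIntegral_triIntegrand`).

Verification. The recursion gives the leading term in `ν` (`leadCoeff_baPoly`). In the Weyl chamber
every symbol tends to 0 or 1, where the derivations vanish, so the limit is a plain product, namely
`normC` (`symEvalLim_baPoly`). The kernel intertwines the Sutherland operators of `n` and `n + 1`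
particles: `kernel_identity` together with integration by parts gives the eigenvalue equation by
induction (`sum_symEval_powOp_powOp_baPoly`). That equation also bounds the poles: a pole of order
`N` on a wall must satisfy `N (N + 1) = m (m + 1)`, so no order above `m` occurs
(`exists_baPoly_numerator`), and multiplication by `B^m` yields a trigonometric polynomial.

Uniqueness. On a ray `τ ν`, with `ν` real and in the chamber, the difference of two numerators is a
polynomial in `τ`. The top power of `τ` in the eigenvalue equation says that the top coefficient,
divided by `B^m`, is constant in the direction `ν`. The normalisation forces this constant to be 0,
so all coefficients vanish in turn (`eq_zero_of_sutherland`), and analytic continuation does the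
rest. -/

/-! ### The differential algebra of the symbols `z_a / (z_a - z_b)`. -/

section SymbolCalculus

open MvPolynomial

variable {Z L ι : Type} [DecidableEq L]

/-- The value `z_a / (z_a - z_b)` of the symbol `(a, b)`, set to `0` if the labels agree. -/
noncomputable def symVal (lab : Z → L) (z : Z → ℂ) (p : Z × Z) : ℂ :=
  if lab p.1 = lab p.2 then 0 else z p.1 / (z p.1 - z p.2)

/-- Polynomials in the spectral parameters with coefficients polynomial in the symbols. -/
abbrev SymPoly (ι Z : Type) : Type := MvPolynomial ι (MvPolynomial (Z × Z) ℂ)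

/-- Evaluation of the symbols at `z` and of the spectral parameters at `ν`. -/
noncomputable def symEval (lab : Z → L) (z : Z → ℂ) (ν : ι → ℂ) : SymPoly ι Z →+* ℂ :=
  eval₂Hom (eval (symVal lab z)) ν

/-- Points with different labels are different. -/
def SepBy (lab : Z → L) (z : Z → ℂ) : Prop := ∀ a b, lab a ≠ lab b → z a ≠ z b

variable [DecidableEq Z]

/-- The derivation `z_a ∂/∂z_a` on polynomials in the symbols. -/
noncomputable def symDer (lab : Z → L) (a : Z) :
    Derivation ℂ (MvPolynomial (Z × Z) ℂ) (MvPolynomial (Z × Z) ℂ) :=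
  mkDerivation ℂ fun p =>
    if lab p.1 = lab p.2 then 0
    else if p.1 = a then X p - X p ^ 2
    else if p.2 = a then X p ^ 2 - X p else 0

/-- The derivation `z_a ∂/∂z_a`, acting on coefficients. -/
noncomputable def coeffDer (lab : Z → L) (a : Z) (W : SymPoly ι Z) : SymPoly ι Z :=
  ∑ s ∈ W.support, monomial s (symDer lab a (W.coeff s))

lemma coeff_coeffDer (lab : Z → L) (a : Z) (W : SymPoly ι Z) (s : ι →₀ ℕ) :
    (coeffDer lab a W).coeff s = symDer lab a (W.coeff s) := by
  classical
  simp only [coeffDer, coeff_sum, coeff_monomial]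
  rw [Finset.sum_ite_eq']
  split_ifs with h
  · rfl
  · rw [notMem_support_iff.mp h, map_zero]

/-- For `q = z_a / (z_a - z_b)` one has `z_a ∂q/∂z_a = q - q²` and `z_b ∂q/∂z_b = q² - q`. This is
what keeps polynomials in the symbols stable under the Euler derivations. -/
lemma hasDerivAt_symVal (lab : Z → L) (z : Z → ℂ) (hz : SepBy lab z) (a : Z) (ha : z a ≠ 0)
    (p : Z × Z) :
    HasDerivAt (fun s => symVal lab (Function.update z a s) p)
      ((z a)⁻¹ * eval (symVal lab z) (symDer lab a (X p))) (z a) := by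
  rw [symDer, mkDerivation_X]
  unfold symVal
  by_cases h : lab p.1 = lab p.2
  · simpa [h] using hasDerivAt_const (z a) (0 : ℂ)
  simp only [h, if_false]
  have hne := hz _ _ h
  have hne' : z p.1 - z p.2 ≠ 0 := sub_ne_zero.mpr hne
  by_cases h1 : p.1 = a
  · have h2 : p.2 ≠ a := by rintro rfl; exact h (congrArg lab h1)
    subst h1
    simp only [Function.update_self, Function.update_of_ne h2, if_true, map_sub, map_pow, eval_X,
      h, if_false]
    have := (hasDerivAt_id (z p.1)).div ((hasDerivAt_id (z p.1)).sub_const (z p.2)) hne'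
    refine HasDerivAt.congr_deriv this ?_
    simp only [id]
    field_simp
  · by_cases h2 : p.2 = a
    · subst h2
      simp only [Function.update_self, Function.update_of_ne h1, if_true, h1, if_false, map_sub,
        map_pow, eval_X, h]
      have := (hasDerivAt_const (z p.2) (z p.1)).div ((hasDerivAt_id (z p.2)).const_sub (z p.1)) hne'
      refine HasDerivAt.congr_deriv this ?_
      simp only [id]
      field_simp
      ring
    · simpa [h1, h2] using hasDerivAt_const (z a) _

lemma hasDerivAt_eval_symVal (lab : Z → L) (z : Z → ℂ) (hz : SepBy lab z) (a : Z) (ha : z a ≠ 0)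
    (q : MvPolynomial (Z × Z) ℂ) :
    HasDerivAt (fun s => eval (symVal lab (Function.update z a s)) q)
      ((z a)⁻¹ * eval (symVal lab z) (symDer lab a q)) (z a) := by
  induction q using MvPolynomial.induction_on with
  | C r => simpa [← algebraMap_eq] using hasDerivAt_const (z a) r
  | add p q hp hq =>
    simp only [map_add, mul_add]
    exact hp.add hq
  | mul_X p i hp =>
    have := hp.mul (hasDerivAt_symVal lab z hz a ha i)
    simp only [Function.update_eq_self] at this
    simp only [map_mul, eval_X, Derivation.leibniz, map_add, smul_eq_mul]
    refine HasDerivAt.congr_deriv this ?_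
    ring

lemma hasDerivAt_symEval (lab : Z → L) (z : Z → ℂ) (hz : SepBy lab z) (a : Z) (ha : z a ≠ 0)
    (ν : ι → ℂ) (W : SymPoly ι Z) :
    HasDerivAt (fun s => symEval lab (Function.update z a s) ν W)
      ((z a)⁻¹ * symEval lab z ν (coeffDer lab a W)) (z a) := by
  simp only [symEval, coe_eval₂Hom, coeffDer, eval₂_sum, eval₂_monomial, Finset.mul_sum]
  simp only [eval₂_eq]
  refine HasDerivAt.fun_sum fun s _ => ?_
  rw [← mul_assoc]
  exact (hasDerivAt_eval_symVal lab z hz a ha (W.coeff s)).mul_const _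

/-- The coefficients of `W` of degree at least `d` are the constants given by `H`. -/
def LeadCoeff (d : ℕ) (W : SymPoly ι Z) (H : MvPolynomial ι ℂ) : Prop :=
  H.IsHomogeneous d ∧ ∀ s : ι →₀ ℕ, d ≤ s.degree → W.coeff s = C (H.coeff s)

/-- In degree `d` and above the coefficients are constants, which the derivation kills, and `q` does
not raise the degree in `ν`. Only the linear form acts on the top part. -/
lemma LeadCoeff.linear_mul {d : ℕ} {W : SymPoly ι Z} {H : MvPolynomial ι ℂ} (h : LeadCoeff d W H)
    (lab : Z → L) (a : Z) (i j : ι) (q : MvPolynomial (Z × Z) ℂ) :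
    LeadCoeff (d + 1) (coeffDer lab a W + (X i - X j + C q) * W) ((X i - X j) * H) := by
  classical
  obtain ⟨hH, hc⟩ := h
  refine ⟨?_, fun s hs => ?_⟩
  · rw [add_comm]
    exact ((isHomogeneous_X ℂ i).sub (isHomogeneous_X ℂ j)).mul hH
  have key : ∀ k : ι, (X k * W).coeff s = C ((X k * H).coeff s) := by
    intro k
    rw [coeff_X_mul', coeff_X_mul']
    split_ifs with hk
    · apply hc
      have : (s - Finsupp.single k 1) + Finsupp.single k 1 = s := by
        apply tsub_add_cancel_of_le
        rw [Finsupp.single_le_iff]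
        exact Nat.one_le_iff_ne_zero.mpr (Finsupp.mem_support_iff.mp hk)
      have h2 := congrArg Finsupp.degree this
      rw [map_add, Finsupp.degree_single] at h2
      omega
    · simp
  have h0 : H.coeff s = 0 := hH.coeff_eq_zero (by omega)
  have hW := hc s (by omega)
  rw [coeff_add, coeff_coeffDer, hW, add_mul, sub_mul, coeff_add, coeff_sub, coeff_C_mul, hW, h0,
    key, key, sub_mul, coeff_sub]
  simp

omit [DecidableEq Z] in
lemma LeadCoeff.map_coeff {Z' : Type} {d : ℕ} {W : SymPoly ι Z} {H : MvPolynomial ι ℂ}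
    (h : LeadCoeff d W H) (φ : MvPolynomial (Z × Z) ℂ →ₐ[ℂ] MvPolynomial (Z' × Z') ℂ) :
    LeadCoeff (Z := Z') d (MvPolynomial.map φ.toRingHom W) H := by
  refine ⟨h.1, fun s hs => ?_⟩
  rw [coeff_map, h.2 s hs]
  exact φ.commutes (H.coeff s)

omit [DecidableEq Z] in
lemma LeadCoeff.rename_inj {κ : Type} {d : ℕ} {W : SymPoly ι Z} {H : MvPolynomial ι ℂ}
    (h : LeadCoeff d W H) (f : ι → κ) (hf : Function.Injective f) :
    LeadCoeff (Z := Z) d (MvPolynomial.rename f W) (MvPolynomial.rename f H) := by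
  refine ⟨h.1.rename_isHomogeneous, fun s hs => ?_⟩
  by_cases hs' : ∃ u : ι →₀ ℕ, u.mapDomain f = s
  · obtain ⟨u, rfl⟩ := hs'
    rw [coeff_rename_mapDomain f hf, coeff_rename_mapDomain f hf]
    apply h.2
    simpa using hs
  · push Not at hs'
    rw [coeff_rename_eq_zero _ _ _ fun u hu => absurd hu (hs' u),
      coeff_rename_eq_zero _ _ _ fun u hu => absurd hu (hs' u)]
    simp

/-- The limits of the symbols in the Weyl chamber. -/
def symLim [LT L] [DecidableRel (α := L) (· < ·)] (lab : Z → L) (p : Z × Z) : ℂ :=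
  if lab p.1 < lab p.2 then 1 else 0

/-- On each generator the derivation is 0 or `±(q - q²)`, and the limiting values 0 and 1 are
idempotent. -/
lemma eval_symLim_symDer [LT L] [DecidableRel (α := L) (· < ·)] (lab : Z → L) (a : Z)
    (q : MvPolynomial (Z × Z) ℂ) : eval (symLim lab) (symDer lab a q) = 0 := by
  induction q using MvPolynomial.induction_on with
  | C r => simp [← algebraMap_eq]
  | add p q hp hq => simp [hp, hq]
  | mul_X p i hp =>
    have : eval (symLim lab) (symDer lab a (X i)) = 0 := by
      rw [symDer, mkDerivation_X]
      have h : symLim lab i ^ 2 = symLim lab i := by unfold symLim; split_ifs <;> norm_num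
      split_ifs <;> simp [h]
    simp [Derivation.leibniz, hp, this]

end SymbolCalculus


/-! ### Products over pairs `i < j`. -/

section PairProducts

lemma prod_pairs_eq_ite {M : Type*} [CommMonoid M] {n : ℕ} (f : Fin n → Fin n → M) :
    ∏ i, ∏ j ∈ Finset.Ioi i, f i j = ∏ i, ∏ j, if i < j then f i j else 1 := by
  refine Finset.prod_congr rfl fun i _ => ?_
  rw [← Finset.prod_filter]
  congr 1
  ext j
  simp

lemma prod_pairs_castSucc {M : Type*} [CommMonoid M] {n : ℕ} (f : Fin (n + 1) → Fin (n + 1) → M) :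
    ∏ i, ∏ j ∈ Finset.Ioi i, f i j =
      (∏ i : Fin n, ∏ j ∈ Finset.Ioi i, f i.castSucc j.castSucc) *
        ∏ i : Fin n, f i.castSucc (Fin.last n) := by
  rw [prod_pairs_eq_ite, prod_pairs_eq_ite, Fin.prod_univ_castSucc, ← Finset.prod_mul_distrib]
  have h1 : ∏ j, (if Fin.last n < j then f (Fin.last n) j else 1) = 1 :=
    Finset.prod_eq_one fun j _ => if_neg (not_lt.mpr (Fin.le_last j))
  rw [h1, mul_one]
  refine Finset.prod_congr rfl fun i _ => ?_
  rw [Fin.prod_univ_castSucc, if_pos (Fin.castSucc_lt_last i)]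
  simp only [Fin.castSucc_lt_castSucc_iff]

end PairProducts

/-! ### The recursion for the numerator: leading term and limit in the chamber. -/

section Recursion

open MvPolynomial

/-- The labels of the integration variables `t_i` and of the points `u_l`. -/
def stepLab (n : ℕ) : Fin n ⊕ Fin (n + 1) → Fin (n + 1) := Sum.elim Fin.castSucc id

/-- The logarithmic derivative `t_i ∂/∂t_i` of the regular part of the kernel. -/
noncomputable def logCoef {n : ℕ} (i : Fin n) :
    MvPolynomial ((Fin n ⊕ Fin (n + 1)) × (Fin n ⊕ Fin (n + 1))) ℂ :=
  ∑ j : Fin n, X (Sum.inl i, Sum.inl j) - ∑ l : Fin (n + 1), X (Sum.inl i, Sum.inr l)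

/-- The operator `t_i ∂/∂t_i` conjugated by the kernel and by powers of `t_i`, up to a shift. -/
noncomputable def rowOp {n : ℕ} (m : ℕ) (e : ℂ) (i : Fin n)
    (W : SymPoly (Fin (n + 1)) (Fin n ⊕ Fin (n + 1))) :
    SymPoly (Fin (n + 1)) (Fin n ⊕ Fin (n + 1)) :=
  coeffDer (stepLab n) (Sum.inl i) W +
    (X i.castSucc - X (Fin.last n) + C (C ((m : ℂ) + 1) * logCoef i + C e)) * W

/-- The first `k` factors of the falling factorial of length `m` in the variable `t_i`. -/
noncomputable def rowOps {n : ℕ} (m : ℕ) (i : Fin n) :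
    ℕ → SymPoly (Fin (n + 1)) (Fin n ⊕ Fin (n + 1)) → SymPoly (Fin (n + 1)) (Fin n ⊕ Fin (n + 1))
  | 0, W => W
  | k + 1, W => rowOp m ((m : ℂ) - k) i (rowOps m i k W)

/-- The residue operators for the first `k` variables. -/
noncomputable def opsUpTo {n : ℕ} (m : ℕ) :
    ℕ → SymPoly (Fin (n + 1)) (Fin n ⊕ Fin (n + 1)) → SymPoly (Fin (n + 1)) (Fin n ⊕ Fin (n + 1))
  | 0, W => W
  | k + 1, W => if h : k < n then rowOps m ⟨k, h⟩ m (opsUpTo m k W) else opsUpTo m k W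

/-- Regard a polynomial in the symbols of `t_1, …, t_n` as one in the symbols of `t` and `u`. -/
noncomputable def liftStep {n : ℕ} (W : SymPoly (Fin n) (Fin n)) :
    SymPoly (Fin (n + 1)) (Fin n ⊕ Fin (n + 1)) :=
  rename Fin.castSucc (map (rename (Prod.map Sum.inl Sum.inl)).toRingHom W)

/-- Set `t_i = u_i`. -/
noncomputable def mergeStep {n : ℕ} (W : SymPoly (Fin (n + 1)) (Fin n ⊕ Fin (n + 1))) :
    SymPoly (Fin (n + 1)) (Fin (n + 1)) :=
  map (rename (Prod.map (stepLab n) (stepLab n))).toRingHom W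

/-- The Baker-Akhiezer function, multiplied by `C_m(ν) exp (-2 (ν, x))`, as a polynomial in `ν`
and in the symbols `u_i / (u_i - u_j)`. -/
noncomputable def baPoly (m : ℕ) : (n : ℕ) → SymPoly (Fin n) (Fin n)
  | 0 => 1
  | n + 1 => mergeStep (opsUpTo m n (liftStep (baPoly m n)))

variable {n m : ℕ}

lemma LeadCoeff.rowOps {d : ℕ} {W : SymPoly (Fin (n + 1)) (Fin n ⊕ Fin (n + 1))}
    {H : MvPolynomial (Fin (n + 1)) ℂ} (h : LeadCoeff d W H) (i : Fin n) (k : ℕ) :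
    LeadCoeff (d + k) (rowOps m i k W) ((X i.castSucc - X (Fin.last n)) ^ k * H) := by
  induction k with
  | zero => simpa [_root_.rowOps] using h
  | succ k ih =>
    rw [_root_.rowOps, rowOp, pow_succ', mul_assoc]
    exact ih.linear_mul _ _ _ _ _

lemma LeadCoeff.opsUpTo {d : ℕ} {W : SymPoly (Fin (n + 1)) (Fin n ⊕ Fin (n + 1))}
    {H : MvPolynomial (Fin (n + 1)) ℂ} (h : LeadCoeff d W H) (k : ℕ) (hk : k ≤ n) :
    LeadCoeff (d + k * m) (opsUpTo m k W)
      ((∏ i : Fin k, (X (i.castLE hk).castSucc - X (Fin.last n)) ^ m) * H) := by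
  induction k with
  | zero => simpa [_root_.opsUpTo] using h
  | succ k ih =>
    rw [_root_.opsUpTo, dif_pos (show k < n by omega), Fin.prod_univ_castSucc]
    have := (ih (by omega)).rowOps (m := m) ⟨k, by omega⟩ m
    convert this using 1
    · ring
    · rw [← mul_assoc, mul_comm (_ ^ m)]
      rfl

/-- Passing from `n` to `n + 1` applies `m` operators with top part `X_i - X_last` for every `i`,
which supplies exactly the new pairs of the Vandermonde product. -/
lemma leadCoeff_baPoly (m n : ℕ) :
    LeadCoeff (m * (n * (n - 1) / 2)) (baPoly m n)
      ((∏ i : Fin n, ∏ j ∈ Finset.Ioi i, (X i - X j)) ^ m) := by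
  induction n with
  | zero =>
    refine ⟨by simpa using isHomogeneous_one (Fin 0) ℂ, fun s _ => ?_⟩
    have hs : s = 0 := Subsingleton.elim _ _
    simp [baPoly, hs]
  | succ n ih =>
    have h1 := (LeadCoeff.map_coeff ih
      (rename (Prod.map (Sum.inl : Fin n → Fin n ⊕ Fin (n + 1)) Sum.inl))).rename_inj
      Fin.castSucc (Fin.castSucc_injective n)
    have h2 := ((h1.opsUpTo (m := m) n le_rfl)).map_coeff
      (rename (Prod.map (stepLab n) (stepLab n)))
    rw [baPoly]
    convert h2 using 1
    · rw [Nat.add_sub_cancel, mul_comm n m, ← mul_add, ← Nat.triangle_succ, Nat.add_sub_cancel]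
    · rfl
    · rw [prod_pairs_castSucc, mul_pow, mul_comm, map_pow, map_prod, Finset.prod_pow]
      simp [map_prod]

/-- The limit of a polynomial in the symbols in the Weyl chamber. -/
noncomputable def symEvalLim {Z L ι : Type} [LT L] [DecidableRel (α := L) (· < ·)] (lab : Z → L)
    (ν : ι → ℂ) : SymPoly ι Z →+* ℂ :=
  eval₂Hom (eval (symLim lab)) ν

lemma symEvalLim_coeffDer {Z L ι : Type} [DecidableEq Z] [DecidableEq L] [LT L]
    [DecidableRel (α := L) (· < ·)] (lab : Z → L) (a : Z) (ν : ι → ℂ) (W : SymPoly ι Z) :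
    symEvalLim lab ν (coeffDer lab a W) = 0 := by
  simp [symEvalLim, coeffDer, eval₂_monomial, eval_symLim_symDer]

/-- The symbols `(t_i, t_l)` and `(t_i, u_l)` have the same limit and cancel for `l` below the last
index; the pair with the last `u` has limit 1. -/
lemma eval_symLim_logCoef (i : Fin n) : eval (symLim (stepLab n)) (logCoef i) = -1 := by
  have h1 : ∀ l : Fin n, symLim (stepLab n) (Sum.inl i, Sum.inl l) =
      symLim (stepLab n) (Sum.inl i, Sum.inr l.castSucc) := fun l => rfl
  have h2 : symLim (stepLab n) (Sum.inl i, Sum.inr (Fin.last n)) = 1 :=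
    if_pos (Fin.castSucc_lt_last i)
  simp only [logCoef, map_sub, map_sum, map_add, eval_X, Fin.sum_univ_castSucc, h1, h2]
  ring

/-- The derivation drops out in the limit and the operators become scalars: the shift `m - k`
together with `-(m + 1)` from `logCoef` gives the factor `ν_i - ν_last - (k + 1)`. -/
lemma symEvalLim_rowOps (ν : Fin (n + 1) → ℂ) (i : Fin n) (k : ℕ)
    (W : SymPoly (Fin (n + 1)) (Fin n ⊕ Fin (n + 1))) :
    symEvalLim (stepLab n) ν (rowOps m i k W) =
      (∏ q ∈ Finset.range k, (ν i.castSucc - ν (Fin.last n) - (q + 1 : ℕ))) *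
        symEvalLim (stepLab n) ν W := by
  induction k with
  | zero => simp [rowOps]
  | succ k ih =>
    rw [rowOps, rowOp, map_add, symEvalLim_coeffDer, map_mul, ih, Finset.prod_range_succ]
    have : symEvalLim (stepLab n) ν (X i.castSucc - X (Fin.last n) +
        C (C ((m : ℂ) + 1) * logCoef i + C ((m : ℂ) - k))) =
        ν i.castSucc - ν (Fin.last n) - (k + 1 : ℕ) := by
      simp only [symEvalLim, map_add, map_sub, coe_eval₂Hom, eval₂_X, eval₂_C, map_mul, eval_C,
        eval_symLim_logCoef]
      push_cast
      ring
    rw [this]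
    ring

lemma symEvalLim_opsUpTo (ν : Fin (n + 1) → ℂ) (k : ℕ) (hk : k ≤ n)
    (W : SymPoly (Fin (n + 1)) (Fin n ⊕ Fin (n + 1))) :
    symEvalLim (stepLab n) ν (opsUpTo m k W) =
      (∏ i : Fin k, ∏ q ∈ Finset.range m,
        (ν (i.castLE hk).castSucc - ν (Fin.last n) - (q + 1 : ℕ))) *
        symEvalLim (stepLab n) ν W := by
  induction k with
  | zero => simp [opsUpTo]
  | succ k ih =>
    rw [opsUpTo, dif_pos (show k < n by omega), symEvalLim_rowOps, ih (by omega),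
      Fin.prod_univ_castSucc, ← mul_assoc, mul_comm (∏ q ∈ Finset.range m, _)]
    rfl

lemma symEvalLim_liftStep (ν : Fin (n + 1) → ℂ) (W : SymPoly (Fin n) (Fin n)) :
    symEvalLim (stepLab n) ν (liftStep W) = symEvalLim id (fun i : Fin n => ν i.castSucc) W := by
  simp only [symEvalLim, liftStep, coe_eval₂Hom, eval₂_rename, eval₂_map]
  congr 1
  ext p
  · simp
  · simp [symLim, stepLab]

lemma symEvalLim_mergeStep (ν : Fin (n + 1) → ℂ)
    (W : SymPoly (Fin (n + 1)) (Fin n ⊕ Fin (n + 1))) :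
    symEvalLim id ν (mergeStep W) = symEvalLim (stepLab n) ν W := by
  simp only [symEvalLim, mergeStep, coe_eval₂Hom, eval₂_map]
  congr 1
  ext p
  · simp
  · simp [symLim]

/-- This value is the normalising denominator, so that after division the function tends to 1 in the
chamber. -/
lemma symEvalLim_baPoly (m n : ℕ) (ν : Fin n → ℂ) :
    symEvalLim id ν (baPoly m n) = normC m ν := by
  have key : ∀ (n : ℕ) (ν : Fin n → ℂ), symEvalLim id ν (baPoly m n) =
      ∏ i, ∏ j ∈ Finset.Ioi i, ∏ q ∈ Finset.range m, (ν i - ν j - (q + 1 : ℕ)) := by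
    intro n
    induction n with
    | zero => intro ν; simp [baPoly]
    | succ n ih =>
      intro ν
      rw [baPoly, symEvalLim_mergeStep, symEvalLim_opsUpTo ν n le_rfl, symEvalLim_liftStep, ih,
        prod_pairs_castSucc, mul_comm]
      rfl
  rw [key, normC]
  simp_rw [Finset.prod_comm (s := Finset.Icc 1 m)]
  refine Finset.prod_congr rfl fun i _ => Finset.prod_congr rfl fun j _ => ?_
  refine Finset.prod_nbij (· + 1) ?_ ?_ ?_ fun q _ => rfl
  · intro q hq
    simp only [Finset.mem_range, Finset.mem_Icc] at hq ⊢
    omega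
  · exact fun a _ b _ h => by simpa using h
  · intro q hq
    simp only [Finset.coe_Icc, Set.mem_Icc] at hq
    exact ⟨q - 1, by simp only [Finset.coe_range, Set.mem_Iio]; omega, by simp only; omega⟩

lemma symEval_liftStep (t : Fin n → ℂ) (u ν : Fin (n + 1) → ℂ) (W : SymPoly (Fin n) (Fin n)) :
    symEval (stepLab n) (Sum.elim t u) ν (liftStep W) =
      symEval id t (fun i : Fin n => ν i.castSucc) W := by
  simp only [symEval, liftStep, coe_eval₂Hom, eval₂_rename, eval₂_map]
  congr 1
  ext p
  · simp
  · simp [symVal, stepLab]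

/-- Equal labels give the value 0 on both sides, so the substitution `t_i = u_i` never meets a
vanishing denominator. -/
lemma symEval_mergeStep (u ν : Fin (n + 1) → ℂ)
    (W : SymPoly (Fin (n + 1)) (Fin n ⊕ Fin (n + 1))) :
    symEval id u ν (mergeStep W) =
      symEval (stepLab n) (Sum.elim (fun i => u i.castSucc) u) ν W := by
  simp only [symEval, mergeStep, coe_eval₂Hom, eval₂_map]
  have h : ∀ a, u (stepLab n a) = (Sum.elim (fun i => u i.castSucc) u : _ → ℂ) a := by
    rintro (a | a) <;> rfl
  congr 1
  ext p
  · simp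
  · simp [symVal, h]

end Recursion


/-! ### Higher-order residues in one variable and on tori. -/

section Contours

open Metric MeasureTheory

/-- Cauchy's formula for the `m`-th derivative, with the successive derivatives supplied as a chain
`h`. In the application the chain is the one produced by the operators `rowOp`. -/
lemma circleIntegral_pow_inv_mul_eq_deriv (m : ℕ) {c v : ℂ} {r : ℝ} (hv : v ∈ ball c r)
    (h : ℕ → ℂ → ℂ)
    (hd : ∀ j ≤ m, ∀ z ∈ closedBall c r, HasDerivAt (h j) (h (j + 1) z) z) :
    (∮ z in C(c, r), ((z - v) ^ (m + 1))⁻¹ * h 0 z) =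
      2 * Real.pi * Complex.I / (m.factorial : ℂ) * h m v := by
  have hr : 0 < r := pos_of_mem_ball hv
  have hne : ∀ z ∈ sphere c r, z - v ≠ 0 := by
    intro z hz hzv
    rw [sub_eq_zero.mp hzv] at hz
    rw [mem_sphere] at hz
    rw [mem_ball] at hv
    exact hv.ne hz
  induction m generalizing h with
  | zero =>
    have := DifferentiableOn.circleIntegral_sub_inv_smul (f := h 0)
      (fun z hz => (hd 0 le_rfl z hz).differentiableAt.differentiableWithinAt) hv
    simpa using this
  | succ m ih =>
    have ih' := ih (fun j => h (j + 1)) fun j hj => hd (j + 1) (by omega)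
    have hcont : ∀ j ≤ m + 1, ContinuousOn (h j) (sphere c r) := fun j hj z hz =>
      (hd j hj z (sphere_subset_closedBall hz)).continuousAt.continuousWithinAt
    have hpow : ∀ k : ℕ, ContinuousOn (fun z => ((z - v) ^ k)⁻¹) (sphere c r) := fun k =>
      ContinuousOn.inv₀ (by fun_prop) fun z hz => pow_ne_zero _ (hne z hz)
    have hi2 : CircleIntegrable (fun z => ((z - v) ^ (m + 1))⁻¹ * h 1 z) c r :=
      ((hpow _).mul (hcont 1 (by omega))).circleIntegrable hr.le
    have hi3 : CircleIntegrable
        (fun z => ((m : ℂ) + 1) * (((z - v) ^ (m + 1 + 1))⁻¹ * h 0 z)) c r :=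
      (continuousOn_const.mul ((hpow _).mul (hcont 0 (by omega)))).circleIntegrable hr.le
    -- The integrand is the derivative of `(z - v)^(-(m+1)) h₀`. Its vanishing integral trades one
    -- order of the pole for one derivative.
    have hzero : (∮ z in C(c, r), (((z - v) ^ (m + 1))⁻¹ * h 1 z -
        ((m : ℂ) + 1) * (((z - v) ^ (m + 1 + 1))⁻¹ * h 0 z))) = 0 := by
      refine circleIntegral.integral_eq_zero_of_hasDerivWithinAt hr.le
        (f := fun z => ((z - v) ^ (m + 1))⁻¹ * h 0 z) fun z hz => HasDerivAt.hasDerivWithinAt ?_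
      have h1 := ((((hasDerivAt_id z).sub_const v).pow (m + 1)).inv
        (pow_ne_zero _ (hne z hz))).mul (hd 0 (by omega) z (sphere_subset_closedBall hz))
      refine HasDerivAt.congr_deriv h1 ?_
      have := hne z hz
      simp only [Pi.pow_apply, Pi.inv_apply, id, Nat.add_sub_cancel, Nat.cast_add, Nat.cast_one]
      field_simp
      ring
    rw [circleIntegral.integral_sub hi2 hi3,
      circleIntegral.integral_const_mul, ih', sub_eq_zero] at hzero
    have hm : (m : ℂ) + 1 ≠ 0 := Nat.cast_add_one_ne_zero m
    have hf : (m.factorial : ℂ) ≠ 0 := Nat.cast_ne_zero.mpr m.factorial_ne_zero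
    rw [Nat.factorial_succ, Nat.cast_mul, Nat.cast_succ]
    field_simp
    rw [mul_comm] at hzero
    field_simp at hzero
    linear_combination -hzero

lemma torusIntegrable_of_continuousOn {n : ℕ} {f : (Fin n → ℂ) → ℂ} {c : Fin n → ℂ} {r : Fin n → ℝ}
    (hr : ∀ i, 0 ≤ r i) (hf : ContinuousOn f {t | ∀ i, t i ∈ sphere (c i) (r i)}) :
    TorusIntegrable f c r := by
  refine ContinuousOn.integrableOn_compact isCompact_Icc (Continuous.continuousOn ?_)
  refine hf.comp_continuous ?_ fun θ i => ?_
  · unfold torusMap; fun_prop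
  · exact circleMap_mem_sphere (c i) (hr i) (θ i)

/-- Replace the first `k` entries of `z` by those of `y`. -/
def mergeFirst {n : ℕ} (k : ℕ) (y : Fin k → ℂ) (z : Fin n → ℂ) : Fin n → ℂ :=
  fun i => if h : i.1 < k then y ⟨i.1, h⟩ else z i

lemma mergeFirst_snoc {n k : ℕ} (hk : k < n) (y : Fin k → ℂ) (s : ℂ) (z : Fin n → ℂ) :
    mergeFirst (k + 1) (Fin.snoc y s : Fin (k + 1) → ℂ) z =
      Function.update (mergeFirst k y z) ⟨k, hk⟩ s := by
  ext i
  rcases lt_trichotomy i.1 k with h | h | h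
  · have hne : i ≠ ⟨k, hk⟩ := fun e => h.ne (congrArg Fin.val e)
    simp only [mergeFirst, Function.update_of_ne hne, dif_pos h, dif_pos (show i.1 < k + 1 by omega)]
    exact Fin.snoc_castSucc (α := fun _ => ℂ) s y ⟨i.1, h⟩
  · have he : i = ⟨k, hk⟩ := Fin.ext h
    subst he
    simp only [mergeFirst, Function.update_self, dif_pos (show k < k + 1 by omega)]
    exact Fin.snoc_last (α := fun _ => ℂ) s y
  · have hne : i ≠ ⟨k, hk⟩ := fun e => h.ne' (congrArg Fin.val e)
    simp only [mergeFirst, Function.update_of_ne hne, dif_neg (show ¬ i.1 < k by omega),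
      dif_neg (show ¬ i.1 < k + 1 by omega)]

/-- `H k` is the regular part of the integrand after the first `k` variables have been replaced by
their poles; `hstep` is the residue in a single variable. -/
lemma torusIntegral_eq_iterated_residue {n : ℕ} {c v : Fin n → ℂ} {r : ℝ}
    (hv : ∀ i, v i ∈ ball (c i) r) (g : ℕ) (κ : ℂ) (H : ℕ → (Fin n → ℂ) → ℂ) (hr : 0 < r)
    (hc : ContinuousOn (H 0) {t | ∀ i, t i ∈ closedBall (c i) r})
    (hstep : ∀ k (hk : k < n) (t : Fin n → ℂ), (∀ i, t i ∈ closedBall (c i) r) →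
      (∮ s in C(c ⟨k, hk⟩, r), ((s - v ⟨k, hk⟩) ^ g)⁻¹ * H k (Function.update t ⟨k, hk⟩ s)) =
        κ * H (k + 1) (Function.update t ⟨k, hk⟩ (v ⟨k, hk⟩))) :
    (∯ t in T(c, fun _ => r), (∏ i, ((t i - v i) ^ g)⁻¹) * H 0 t) = κ ^ n * H n v := by
  -- Only the first `k` variables are integrated and the others are frozen at `z`. The induction
  -- removes the last integration first, which needs the hypothesis at a modified `z`.
  have key : ∀ k (hk : k ≤ n) (z : Fin n → ℂ), (∀ i, z i ∈ closedBall (c i) r) →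
      (∯ y in T((fun i : Fin k => c (i.castLE hk)), fun _ => r),
        (∏ i : Fin k, ((y i - v (i.castLE hk)) ^ g)⁻¹) * H 0 (mergeFirst k y z)) =
        κ ^ k * H k (mergeFirst k (fun i : Fin k => v (i.castLE hk)) z) := by
    intro k
    induction k with
    | zero =>
      intro hk z hz
      rw [torusIntegral_dim0]
      simp only [Finset.univ_eq_empty, Finset.prod_empty, one_mul, pow_zero]
      congr 1
    | succ k ih =>
      intro hk z hz
      rw [torusIntegral_succAbove _ (Fin.last k)]
      · have hk' : k < n := hk
        have hmem : ∀ y : Fin k → ℂ, (∀ i, y i ∈ closedBall (c (i.castLE hk'.le)) r) →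
            ∀ i, mergeFirst k y z i ∈ closedBall (c i) r := by
          intro y hy i
          unfold mergeFirst
          split_ifs with h
          · exact hy ⟨i.1, h⟩
          · exact hz i
        have hin : ∀ s ∈ sphere (c ⟨k, hk'⟩) r,
            (∯ y in T((fun i : Fin (k + 1) => c (i.castLE hk)) ∘ (Fin.last k).succAbove,
              (fun _ : Fin (k + 1) => r) ∘ (Fin.last k).succAbove),
              (∏ i : Fin (k + 1),
                (((Fin.last k).insertNth s y : Fin (k + 1) → ℂ) i - v (i.castLE hk)) ^ g)⁻¹ *
                H 0 (mergeFirst (k + 1) ((Fin.last k).insertNth s y : Fin (k + 1) → ℂ) z)) =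
            κ ^ k * (((s - v ⟨k, hk'⟩) ^ g)⁻¹ * H k (Function.update
              (mergeFirst k (fun i : Fin k => v (i.castLE hk'.le)) z) ⟨k, hk'⟩ s)) := by
          intro s hs
          have hz' : ∀ i, Function.update z ⟨k, hk'⟩ s i ∈ closedBall (c i) r := by
            intro i
            by_cases hi : i = ⟨k, hk'⟩
            · subst hi; simpa using sphere_subset_closedBall hs
            · simpa [hi] using hz i
          have hmu : ∀ y : Fin k → ℂ, Function.update (mergeFirst k y z) ⟨k, hk'⟩ s =
              mergeFirst k y (Function.update z ⟨k, hk'⟩ s) := by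
            intro y
            ext i
            by_cases hi : i = ⟨k, hk'⟩
            · subst hi; simp [mergeFirst]
            · simp [mergeFirst, hi]
          have := ih hk'.le _ hz'
          simp only [hmu]
          rw [mul_left_comm, ← this, ← torusIntegral_const_mul]
          congr 1
          · ext y
            rw [Fin.insertNth_last', mergeFirst_snoc hk', hmu, Fin.prod_univ_castSucc]
            simp only [Fin.snoc_castSucc, Fin.snoc_last, mul_inv, Finset.prod_inv_distrib]
            simp only [Fin.castLE_castSucc]
            rw [show Fin.castLE hk (Fin.last k) = ⟨k, hk'⟩ from rfl]
            ring
          · ext i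
            simp
        simp only [Finset.prod_inv_distrib] at hin ⊢
        change (∮ x in C(c ⟨k, hk'⟩, r), _) = _
        rw [circleIntegral.integral_congr hr.le hin, circleIntegral.integral_const_mul]
        rw [hstep k hk' _ (hmem _ fun i => ball_subset_closedBall (hv _)), ← mergeFirst_snoc,
          ← mul_assoc, ← pow_succ]
        congr 2
        congr 1
        ext i
        refine Fin.lastCases ?_ (fun i => ?_) i
        · simp only [Fin.snoc_last]
          rfl
        · simp
      · refine torusIntegrable_of_continuousOn (fun _ => hr.le) (ContinuousOn.mul ?_ ?_)
        · refine continuousOn_finsetProd _ fun i _ => ContinuousOn.inv₀ (by fun_prop) ?_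
          refine fun t ht => pow_ne_zero _ fun h0 => ?_
          have h1 := sub_eq_zero.mp h0
          have h2 := ht i
          rw [h1, mem_sphere] at h2
          exact (mem_ball.mp (hv _)).ne h2
        · refine hc.comp ?_ ?_
          · refine Continuous.continuousOn (continuous_pi fun i => ?_)
            unfold mergeFirst
            split_ifs <;> fun_prop
          · intro t ht i
            change mergeFirst (k + 1) t z i ∈ _
            unfold mergeFirst
            split_ifs with h
            · exact sphere_subset_closedBall (ht ⟨i.1, h⟩)
            · exact hz i
  have := key n le_rfl v fun i => ball_subset_closedBall (hv i)
  have hm : ∀ y : Fin n → ℂ, mergeFirst n y v = y := fun y => by ext i; simp [mergeFirst]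
  simpa [hm] using this

end Contours


/-! ### Logarithmic derivatives of products and quotients. -/

section LogDeriv

/-- `e` is the logarithmic derivative of `f` at `x`. -/
def HasLogDerivAt (f : ℂ → ℂ) (e x : ℂ) : Prop := HasDerivAt f (f x * e) x

variable {f g : ℂ → ℂ} {a b x : ℂ}

lemma HasLogDerivAt.mul (hf : HasLogDerivAt f a x) (hg : HasLogDerivAt g b x) :
    HasLogDerivAt (fun s => f s * g s) (a + b) x := by
  refine (HasDerivAt.mul hf hg).congr_deriv ?_
  ring

lemma HasLogDerivAt.inv (hf : HasLogDerivAt f a x) (h : f x ≠ 0) :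
    HasLogDerivAt (fun s => (f s)⁻¹) (-a) x := by
  refine (HasDerivAt.inv hf h).congr_deriv ?_
  field_simp

lemma HasLogDerivAt.div (hf : HasLogDerivAt f a x) (hg : HasLogDerivAt g b x) (h : g x ≠ 0) :
    HasLogDerivAt (fun s => f s / g s) (a - b) x := by
  simpa only [div_eq_mul_inv, sub_eq_add_neg] using hf.mul (hg.inv h)

lemma HasLogDerivAt.pow (hf : HasLogDerivAt f a x) (k : ℕ) :
    HasLogDerivAt (fun s => f s ^ k) (k * a) x := by
  refine (HasDerivAt.pow hf k).congr_deriv ?_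
  rcases k with _ | k
  · simp
  · rw [Nat.add_sub_cancel]
    ring

lemma hasLogDerivAt_const (c : ℂ) : HasLogDerivAt (fun _ => c) 0 x := by
  unfold HasLogDerivAt
  simpa using hasDerivAt_const x c

lemma HasLogDerivAt.prod {ι : Type} (s : Finset ι) {F : ι → ℂ → ℂ} {e : ι → ℂ}
    (h : ∀ i ∈ s, HasLogDerivAt (F i) (e i) x) :
    HasLogDerivAt (fun y => ∏ i ∈ s, F i y) (∑ i ∈ s, e i) x := by
  classical
  induction s using Finset.induction_on with
  | empty => simpa using hasLogDerivAt_const (x := x) 1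
  | insert i s hi ih =>
    simp only [Finset.prod_insert hi, Finset.sum_insert hi]
    exact (h i (Finset.mem_insert_self i s)).mul
      (ih fun j hj => h j (Finset.mem_insert_of_mem hj))

lemma HasLogDerivAt.congr_log (hf : HasLogDerivAt f a x) (h : a = b) : HasLogDerivAt f b x := h ▸ hf

lemma hasLogDerivAt_sub_const {c : ℂ} (h : x ≠ c) :
    HasLogDerivAt (fun s => s - c) (x - c)⁻¹ x := by
  refine ((hasDerivAt_id x).sub_const c).congr_deriv ?_
  rw [mul_inv_cancel₀ (sub_ne_zero.mpr h)]

lemma hasLogDerivAt_const_sub {c : ℂ} (h : x ≠ c) :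
    HasLogDerivAt (fun s => c - s) (x - c)⁻¹ x := by
  refine ((hasDerivAt_id x).const_sub c).congr_deriv ?_
  have := sub_ne_zero.mpr h
  field_simp
  ring

end LogDeriv

/-! ### The products `A` and `A^*`, and the regular part of the kernel. -/

section Vandermonde

variable {n : ℕ}

lemma vandA_eq_ite (w : Fin n → ℂ) : vandA w = ∏ i, ∏ j, if i < j then w i - w j else 1 :=
  prod_pairs_eq_ite fun i j => w i - w j

lemma vandA_ne_zero {w : Fin n → ℂ} (hw : Function.Injective w) : vandA w ≠ 0 := by
  unfold vandA
  refine Finset.prod_ne_zero_iff.mpr fun i _ => Finset.prod_ne_zero_iff.mpr fun j hj => ?_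
  exact sub_ne_zero.mpr fun h => (Finset.mem_Ioi.mp hj).ne (hw h)

lemma continuous_vandA : Continuous (vandA : (Fin n → ℂ) → ℂ) := by
  unfold vandA
  fun_prop

lemma vandA_castSucc (v : Fin (n + 1) → ℂ) :
    vandA v = vandA (fun i : Fin n => v i.castSucc) *
      ∏ i : Fin n, (v i.castSucc - v (Fin.last n)) :=
  prod_pairs_castSucc fun i j => v i - v j

lemma hasLogDerivAt_vandA {w : Fin n → ℂ} (hw : Function.Injective w) (i : Fin n) :
    HasLogDerivAt (fun s => vandA (Function.update w i s))
      (∑ j, if j = i then 0 else (w i - w j)⁻¹) (w i) := by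
  simp only [vandA_eq_ite]
  refine HasLogDerivAt.congr_log (HasLogDerivAt.prod _ fun a _ => HasLogDerivAt.prod _ fun b _ =>
    -- A factor `w_a - w_b` with `a < b` depends on `w_i` through its first or its second entry; the
    -- two summands record these cases.
    (?_ : HasLogDerivAt _ ((if a = i then (if i < b then (w i - w b)⁻¹ else 0) else 0) +
      (if b = i then (if a < i then (w i - w a)⁻¹ else 0) else 0)) _)) ?_
  · by_cases hab : a < b
    · simp only [hab, if_true]
      by_cases ha : a = i
      · subst ha
        simp only [Function.update_self, Function.update_of_ne hab.ne', if_true, hab, hab.ne',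
          if_false, add_zero]
        exact hasLogDerivAt_sub_const fun h => hab.ne (hw h)
      · by_cases hb : b = i
        · subst hb
          simp only [Function.update_self, Function.update_of_ne hab.ne, if_true, hab, hab.ne,
            if_false, zero_add]
          exact hasLogDerivAt_const_sub fun h => hab.ne' (hw h)
        · simp only [ha, hb, if_false, Function.update_of_ne ha, Function.update_of_ne hb, add_zero]
          exact hasLogDerivAt_const _
    · simp only [hab, if_false]
      refine (hasLogDerivAt_const 1).congr_log ?_
      by_cases ha : a = i
      · subst ha
        simp only [hab, if_false, ite_self, zero_add]
        split_ifs with h1 h2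
        · exact absurd h2 (lt_irrefl _)
        · rfl
        · rfl
      · by_cases hb : b = i
        · subst hb; simp [hab, ha]
        · simp [ha, hb]
  · simp only [Finset.sum_add_distrib]
    rw [Finset.sum_comm]
    simp only [Finset.sum_ite_eq', Finset.mem_univ, if_true]
    rw [← Finset.sum_add_distrib]
    refine Finset.sum_congr rfl fun j _ => ?_
    rcases lt_trichotomy j i with h | h | h
    · simp [h, h.ne, h.not_gt]
    · simp [h]
    · simp [h, h.ne', h.not_gt]

/-- The part of `A^*(t, v)` without the factors `t_i - v_i`. -/
noncomputable def vandAReg (t : Fin n → ℂ) (v : Fin (n + 1) → ℂ) : ℂ :=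
  ∏ i : Fin n, ∏ l : Fin (n + 1),
    if l = i.castSucc then 1 else if i.1 ≤ l.1 then t i - v l else v l - t i

lemma vandAStar_eq (t : Fin n → ℂ) (v : Fin (n + 1) → ℂ) :
    vandAStar t v = (∏ i, (t i - v i.castSucc)) * vandAReg t v := by
  rw [vandAStar, vandAReg, ← Finset.prod_mul_distrib]
  refine Finset.prod_congr rfl fun i _ => ?_
  rw [← Finset.mul_prod_erase _ _ (Finset.mem_univ i.castSucc),
    ← Finset.mul_prod_erase (a := i.castSucc) (f := fun l : Fin (n + 1) =>
      if l = i.castSucc then 1 else if i.1 ≤ l.1 then t i - v l else v l - t i) _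
      (Finset.mem_univ i.castSucc)]
  simp only [Fin.val_castSucc, le_refl, if_true, one_mul]
  congr 1
  refine Finset.prod_congr rfl fun l hl => ?_
  rw [if_neg (Finset.ne_of_mem_erase hl)]

/-- Every pair of the first `n` points occurs twice, once with each index on the `t` side, and each
pair with the last point once; the two sign conventions in `A^*` make the product exact. -/
lemma vandAReg_self (v : Fin (n + 1) → ℂ) :
    vandAReg (fun i => v i.castSucc) v = vandA (fun i : Fin n => v i.castSucc) * vandA v := by
  rw [vandA_castSucc v, ← mul_assoc, vandA_eq_ite (n := n)]
  nth_rw 2 [Finset.prod_comm]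
  rw [← Finset.prod_mul_distrib, ← Finset.prod_mul_distrib, vandAReg]
  refine Finset.prod_congr rfl fun i _ => ?_
  rw [Fin.prod_univ_castSucc, if_neg (Fin.castSucc_lt_last i).ne', Fin.val_last,
    if_pos i.2.le, ← Finset.prod_mul_distrib]
  congr 1
  refine Finset.prod_congr rfl fun j _ => ?_
  rcases lt_trichotomy i j with h | h | h
  · have h' : i.1 ≤ j.1 := h.le
    simp [h, h.not_gt, h.ne', h']
  · simp [h]
  · have h' : ¬ i.1 ≤ j.1 := not_le.mpr h
    simp [h, h.not_gt, h.ne, h']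

lemma vandAReg_ne_zero {t : Fin n → ℂ} {v : Fin (n + 1) → ℂ}
    (h : SepBy (stepLab n) (Sum.elim t v)) : vandAReg t v ≠ 0 := by
  refine Finset.prod_ne_zero_iff.mpr fun i _ => Finset.prod_ne_zero_iff.mpr fun l _ => ?_
  split_ifs with h1 h2
  · exact one_ne_zero
  · exact sub_ne_zero.mpr (h (Sum.inl i) (Sum.inr l) (Ne.symm h1))
  · exact sub_ne_zero.mpr (h (Sum.inr l) (Sum.inl i) h1)

lemma hasLogDerivAt_vandAReg {t : Fin n → ℂ} {v : Fin (n + 1) → ℂ}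
    (h : SepBy (stepLab n) (Sum.elim t v)) (i : Fin n) :
    HasLogDerivAt (fun s => vandAReg (Function.update t i s) v)
      (∑ l, if l = i.castSucc then 0 else (t i - v l)⁻¹) (t i) := by
  unfold vandAReg
  refine HasLogDerivAt.congr_log (HasLogDerivAt.prod _ fun a _ => HasLogDerivAt.prod _ fun b _ =>
    (?_ : HasLogDerivAt _ (if a = i then (if b = i.castSucc then 0 else (t i - v b)⁻¹) else 0) _))
    ?_
  · by_cases ha : a = i
    · subst ha
      simp only [Function.update_self, if_true]
      split_ifs with h1 h2
      · exact hasLogDerivAt_const 1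
      · exact hasLogDerivAt_sub_const (h (Sum.inl a) (Sum.inr b) (Ne.symm h1))
      · exact hasLogDerivAt_const_sub (h (Sum.inl a) (Sum.inr b) (Ne.symm h1))
    · simp only [Function.update_of_ne ha, ha, if_false]
      exact hasLogDerivAt_const _
  · rw [Finset.sum_comm]
    simp only [Finset.sum_ite_eq', Finset.mem_univ, if_true]

lemma vandAStar_ne_zero {t : Fin n → ℂ} {v : Fin (n + 1) → ℂ}
    (h : ∀ i l, t i ≠ v l) : vandAStar t v ≠ 0 := by
  refine Finset.prod_ne_zero_iff.mpr fun i _ => Finset.prod_ne_zero_iff.mpr fun l _ => ?_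
  split_ifs
  · exact sub_ne_zero.mpr (h i l)
  · exact sub_ne_zero.mpr (h i l).symm

lemma hasLogDerivAt_vandAStar_left {t : Fin n → ℂ} {v : Fin (n + 1) → ℂ}
    (h : ∀ i l, t i ≠ v l) (i : Fin n) :
    HasLogDerivAt (fun s => vandAStar (Function.update t i s) v)
      (∑ l, (t i - v l)⁻¹) (t i) := by
  unfold vandAStar
  refine HasLogDerivAt.congr_log (HasLogDerivAt.prod _ fun a _ => HasLogDerivAt.prod _ fun b _ =>
    (?_ : HasLogDerivAt _ (if a = i then (t i - v b)⁻¹ else 0) _)) ?_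
  · by_cases ha : a = i
    · subst ha
      simp only [Function.update_self, if_true]
      split_ifs
      · exact hasLogDerivAt_sub_const (h a b)
      · exact hasLogDerivAt_const_sub (h a b)
    · simp only [Function.update_of_ne ha, ha, if_false]
      exact hasLogDerivAt_const _
  · rw [Finset.sum_comm]
    simp only [Finset.sum_ite_eq', Finset.mem_univ, if_true]

lemma hasLogDerivAt_vandAStar_right {t : Fin n → ℂ} {v : Fin (n + 1) → ℂ}
    (h : ∀ i l, t i ≠ v l) (l : Fin (n + 1)) :
    HasLogDerivAt (fun s => vandAStar t (Function.update v l s))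
      (∑ i, (v l - t i)⁻¹) (v l) := by
  unfold vandAStar
  refine HasLogDerivAt.congr_log (HasLogDerivAt.prod _ fun a _ => HasLogDerivAt.prod _ fun b _ =>
    (?_ : HasLogDerivAt _ (if b = l then (v l - t a)⁻¹ else 0) _)) ?_
  · by_cases hb : b = l
    · subst hb
      simp only [Function.update_self, if_true]
      split_ifs
      · exact hasLogDerivAt_const_sub (h a b).symm
      · exact hasLogDerivAt_sub_const (h a b).symm
    · simp only [Function.update_of_ne hb, hb, if_false]
      exact hasLogDerivAt_const _
  · simp only [Finset.sum_ite_eq', Finset.mem_univ, if_true]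

lemma continuous_vandAStar : Continuous fun p : (Fin n → ℂ) × (Fin (n + 1) → ℂ) =>
    vandAStar p.1 p.2 := by
  unfold vandAStar
  refine continuous_finsetProd _ fun i _ => continuous_finsetProd _ fun l _ => ?_
  split_ifs <;> fun_prop

lemma continuous_vandAReg : Continuous fun p : (Fin n → ℂ) × (Fin (n + 1) → ℂ) =>
    vandAReg p.1 p.2 := by
  unfold vandAReg
  refine continuous_finsetProd _ fun i _ => continuous_finsetProd _ fun l _ => ?_
  split_ifs <;> fun_prop

/-- The part of `A(t) A(v) / A^*(t, v)` which is regular at `t_i = v_i`. -/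
noncomputable def kerReg (t : Fin n → ℂ) (v : Fin (n + 1) → ℂ) : ℂ :=
  vandA t * vandA v / vandAReg t v

/-- Consequently the kernel leaves no factor behind once all residues have been taken. -/
lemma kerReg_self {v : Fin (n + 1) → ℂ} (hv : Function.Injective v) :
    kerReg (fun i => v i.castSucc) v = 1 := by
  have h1 : vandA (fun i : Fin n => v i.castSucc) ≠ 0 :=
    vandA_ne_zero (hv.comp (Fin.castSucc_injective n))
  rw [kerReg, vandAReg_self, div_self (mul_ne_zero h1 (vandA_ne_zero hv))]

/-- The sums defining `logCoef` include the pairs `(t_i, t_i)` and `(t_i, v_i)`. They carry equal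
labels, so their symbol is 0, which matches the removal of the singular factors. -/
lemma hasLogDerivAt_kerReg {t : Fin n → ℂ} {v : Fin (n + 1) → ℂ}
    (h : SepBy (stepLab n) (Sum.elim t v)) (i : Fin n) (hi : t i ≠ 0) :
    HasLogDerivAt (fun s => kerReg (Function.update t i s) v)
      ((t i)⁻¹ * MvPolynomial.eval (symVal (stepLab n) (Sum.elim t v)) (logCoef i)) (t i) := by
  have hinj : Function.Injective t := by
    intro a b hab
    by_contra hne
    exact h (Sum.inl a) (Sum.inl b) (fun e => hne (Fin.castSucc_injective n e)) hab
  unfold kerReg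
  refine (((hasLogDerivAt_vandA hinj i).mul (hasLogDerivAt_const (vandA v))).div
    (hasLogDerivAt_vandAReg h i) (by simpa using vandAReg_ne_zero h)).congr_log ?_
  simp only [logCoef, map_sub, map_sum, MvPolynomial.eval_X, add_zero, mul_sub, Finset.mul_sum]
  congr 1
  · refine Finset.sum_congr rfl fun j _ => ?_
    by_cases hj : j = i
    · simp [hj, symVal]
    · rw [if_neg hj, symVal, if_neg (by simpa [stepLab] using Ne.symm hj)]
      simp only [Sum.elim_inl]
      field_simp
  · refine Finset.sum_congr rfl fun l _ => ?_
    by_cases hl : l = i.castSucc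
    · simp [hl, symVal, stepLab]
    · rw [if_neg hl, symVal, if_neg (by simpa [stepLab] using Ne.symm hl)]
      simp only [Sum.elim_inl, Sum.elim_inr]
      field_simp

end Vandermonde

/-! ### Powers with a prescribed branch of the logarithm. -/

section BranchPow

/-- A disc that misses the origin becomes, after division by its centre, a disc inside `|w - 1| <
1`, where the principal logarithm is holomorphic. -/
lemma div_mem_slitPlane {c t : ℂ} {r : ℝ} (ht : t ∈ Metric.closedBall c r) (hc : r < ‖c‖) :
    t / c ∈ Complex.slitPlane := by
  have hc0 : c ≠ 0 := by
    rintro rfl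
    have := dist_nonneg.trans ht
    rw [norm_zero] at hc
    linarith
  have h1 : ‖(t - c) / c‖ < 1 := by
    rw [norm_div, div_lt_one (norm_pos_iff.mpr hc0)]
    exact lt_of_le_of_lt (by simpa [dist_eq_norm] using ht) hc
  have := Complex.mem_slitPlane_of_norm_lt_one h1
  convert this using 1
  field_simp
  ring

lemma branchPow_add (y t a b : ℂ) : branchPow y t (a + b) = branchPow y t a * branchPow y t b := by
  rw [branchPow, branchPow, branchPow, add_mul, Complex.exp_add]

lemma branchPow_one {y t : ℂ} (ht : t ≠ 0) : branchPow y t 1 = t := by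
  rw [branchPow, one_mul, Complex.exp_add, Complex.exp_log (div_ne_zero ht (Complex.exp_ne_zero _)),
    mul_div_cancel₀ _ (Complex.exp_ne_zero _)]

lemma branchPow_sub_one {y t : ℂ} (ht : t ≠ 0) (a : ℂ) :
    branchPow y t (a - 1) = branchPow y t a * t⁻¹ := by
  rw [eq_mul_inv_iff_mul_eq₀ ht]
  nth_rw 2 [← branchPow_one (y := y) ht]
  rw [← branchPow_add, sub_add_cancel]

lemma hasLogDerivAt_branchPow {y t : ℂ} (ht : t / Complex.exp (2 * y) ∈ Complex.slitPlane) (a : ℂ) :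
    HasLogDerivAt (fun s => branchPow y s a) (t⁻¹ * a) t := by
  have ht0 : t ≠ 0 := by
    rintro rfl
    simp at ht
  unfold branchPow
  have h1 : HasDerivAt (fun s => a * (2 * y + Complex.log (s / Complex.exp (2 * y)))) (t⁻¹ * a) t := by
    have h2 := ((((hasDerivAt_id t).div_const (Complex.exp (2 * y))).clog ht).const_add
      (2 * y)).const_mul a
    refine h2.congr_deriv ?_
    have := Complex.exp_ne_zero (2 * y)
    simp only [id]
    field_simp
  exact h1.cexp

/-- The product of the powers `t_i ^ (e_i)`. -/
noncomputable def powProd {n : ℕ} (y t e : Fin n → ℂ) : ℂ := ∏ i, branchPow (y i) (t i) (e i)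

lemma powProd_add {n : ℕ} (y t a b : Fin n → ℂ) :
    powProd y t (a + b) = powProd y t a * powProd y t b := by
  simp [powProd, branchPow_add, Finset.prod_mul_distrib]

lemma powProd_sub_single {n : ℕ} {y t : Fin n → ℂ} (i : Fin n) (hi : t i ≠ 0) (e : Fin n → ℂ) :
    powProd y t (e - Pi.single i 1) = powProd y t e * (t i)⁻¹ := by
  rw [powProd, powProd, ← Finset.mul_prod_erase _ _ (Finset.mem_univ i),
    ← Finset.mul_prod_erase _ (fun j => branchPow (y j) (t j) (e j)) (Finset.mem_univ i)]
  rw [Pi.sub_apply, Pi.single_eq_same, branchPow_sub_one hi, mul_right_comm]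
  congr 2
  refine Finset.prod_congr rfl fun j hj => ?_
  rw [Pi.sub_apply, Pi.single_eq_of_ne (Finset.ne_of_mem_erase hj), sub_zero]

lemma hasLogDerivAt_powProd {n : ℕ} {y t : Fin n → ℂ} (i : Fin n)
    (hi : t i / Complex.exp (2 * y i) ∈ Complex.slitPlane) (e : Fin n → ℂ) :
    HasLogDerivAt (fun s => powProd y (Function.update t i s) e) ((t i)⁻¹ * e i) (t i) := by
  unfold powProd
  refine (HasLogDerivAt.prod _ (e := fun j => if j = i then (t i)⁻¹ * e i else 0)
    fun j _ => ?_).congr_log (by simp)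
  by_cases hj : j = i
  · subst hj
    simpa using hasLogDerivAt_branchPow hi (e j)
  · simpa [hj] using hasLogDerivAt_const _

lemma continuousOn_branchPow (y a : ℂ) {r : ℝ} (hr : r < ‖Complex.exp (2 * y)‖) :
    ContinuousOn (fun t => branchPow y t a) (Metric.closedBall (Complex.exp (2 * y)) r) :=
  fun _ ht => (HasDerivAt.continuousAt
    (hasLogDerivAt_branchPow (div_mem_slitPlane ht hr) a)).continuousWithinAt

lemma continuousOn_powProd {n : ℕ} (y e : Fin n → ℂ) {r : ℝ} (hr : ∀ i, r < ‖Complex.exp (2 * y i)‖) :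
    ContinuousOn (fun t => powProd y t e)
      {t | ∀ i, t i ∈ Metric.closedBall (Complex.exp (2 * y i)) r} := by
  unfold powProd
  refine continuousOn_finsetProd _ fun i _ => ?_
  exact (continuousOn_branchPow (y i) (e i) (hr i)).comp (continuous_apply i).continuousOn
    fun t ht => ht i

end BranchPow


/-! ### The integral over one row of variables. -/

section RowResidue

open Metric

variable {n : ℕ}

lemma sepBy_of_mem_closedBall {Z L : Type} {lab : Z → L} {z : Z → ℂ} {c : L → ℂ} {r : ℝ}
    (hc : ∀ i j, i ≠ j → 2 * r < ‖c i - c j‖) (hz : ∀ a, z a ∈ closedBall (c (lab a)) r) :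
    SepBy lab z := by
  intro a b hab h
  have h1 := hz a
  have h2 := hz b
  rw [h, mem_closedBall, dist_comm, dist_eq_norm] at h1
  rw [mem_closedBall, dist_eq_norm] at h2
  have h3 := norm_add_le (c (lab a) - z b) (z b - c (lab b))
  rw [sub_add_sub_cancel] at h3
  linarith [hc _ _ hab]

lemma ne_zero_of_mem_closedBall {c t : ℂ} {r : ℝ} (ht : t ∈ closedBall c r) (hc : r < ‖c‖) :
    t ≠ 0 := by
  rintro rfl
  rw [mem_closedBall, dist_comm, dist_zero_right] at ht
  linarith

lemma symEval_continuousOn {Z L ι : Type} [DecidableEq L] (lab : Z → L) (ν : ι → ℂ)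
    (W : SymPoly ι Z) : ContinuousOn (fun z => symEval lab z ν W) {z | SepBy lab z} := by
  have h1 : ∀ p, ContinuousOn (fun z => symVal lab z p) {z | SepBy lab z} := by
    intro p
    unfold symVal
    split_ifs with h
    · exact continuousOn_const
    · exact ContinuousOn.div (by fun_prop) (by fun_prop) fun z hz => sub_ne_zero.mpr (hz _ _ h)
  simp only [symEval, MvPolynomial.coe_eval₂Hom, MvPolynomial.eval₂_eq]
  refine continuousOn_finsetSum _ fun s _ => ContinuousOn.mul ?_ continuousOn_const
  exact (MvPolynomial.continuous_eval _).comp_continuousOn (continuousOn_pi.mpr h1)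

lemma kerReg_continuousOn (v : Fin (n + 1) → ℂ) :
    ContinuousOn (fun t : Fin n → ℂ => kerReg t v) {t | SepBy (stepLab n) (Sum.elim t v)} := by
  unfold kerReg
  refine ContinuousOn.div (continuous_vandA.mul continuous_const).continuousOn ?_
    fun t ht => vandAReg_ne_zero ht
  exact (continuous_vandAReg.comp (Continuous.prodMk continuous_id continuous_const)).continuousOn

/-- Differentiation in `t_i` lowers the exponent of `t_i` by 1 and replaces `W` by its image under
`rowOp`. Iteration stays inside the same class of functions. -/
lemma hasDerivAt_rowOp (m : ℕ) {y t e : Fin n → ℂ} {v ν : Fin (n + 1) → ℂ} {i : Fin n}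
    (h : SepBy (stepLab n) (Sum.elim t v)) (hi : t i ≠ 0)
    (hs : t i / Complex.exp (2 * y i) ∈ Complex.slitPlane) (a : ℂ)
    (he : e i = ν i.castSucc - ν (Fin.last n) + a)
    (W : SymPoly (Fin (n + 1)) (Fin n ⊕ Fin (n + 1))) :
    HasDerivAt (fun s => powProd y (Function.update t i s) e *
        kerReg (Function.update t i s) v ^ (m + 1) *
        symEval (stepLab n) (Sum.elim (Function.update t i s) v) ν W)
      (powProd y t (e - Pi.single i 1) * kerReg t v ^ (m + 1) *
        symEval (stepLab n) (Sum.elim t v) ν (rowOp m a i W)) (t i) := by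
  have h1 : HasDerivAt _ _ _ := (hasLogDerivAt_powProd i hs e).mul
    ((hasLogDerivAt_kerReg h i hi).pow (m + 1))
  have h2 := hasDerivAt_symEval (stepLab n) (Sum.elim t v) h (Sum.inl i) (by simpa using hi) ν W
  simp only [Sum.update_elim_inl, Sum.elim_inl] at h2
  refine (h1.mul h2).congr_deriv ?_
  simp only [Function.update_eq_self]
  rw [powProd_sub_single i hi, rowOp]
  have h3 : symEval (stepLab n) (Sum.elim t v) ν (MvPolynomial.X i.castSucc -
      MvPolynomial.X (Fin.last n) + MvPolynomial.C (MvPolynomial.C ((m : ℂ) + 1) * logCoef i +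
      MvPolynomial.C a)) = e i + (m + 1) *
        MvPolynomial.eval (symVal (stepLab n) (Sum.elim t v)) (logCoef i) := by
    simp only [symEval, map_add, map_sub, MvPolynomial.coe_eval₂Hom, MvPolynomial.eval₂_X,
      MvPolynomial.eval₂_C, map_mul, MvPolynomial.eval_C, he]
    ring
  rw [map_add, map_mul, h3]
  push_cast
  ring

/-- Each variable has a pole of order `m + 1`, and its residue consists of `m` applications of
`rowOp`. These lower the exponent from `ν_i - ν_last + m` to `ν_i - ν_last`. -/
lemma torusIntegral_kernel_mul (m : ℕ) {x v ν : Fin (n + 1) → ℂ} {r : ℝ}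
    (hr : 0 < r) (h0 : ∀ i, r < ‖Complex.exp (2 * x i)‖)
    (hc : ∀ i j, i ≠ j → 2 * r < ‖Complex.exp (2 * x i) - Complex.exp (2 * x j)‖)
    (hv : ∀ i, v i ∈ ball (Complex.exp (2 * x i)) r)
    (W : SymPoly (Fin (n + 1)) (Fin n ⊕ Fin (n + 1))) :
    (∯ t in T((fun i : Fin n => Complex.exp (2 * x i.castSucc)), fun _ => r),
      (∏ i : Fin n, ((t i - v i.castSucc) ^ (m + 1))⁻¹) *
        (powProd (fun i => x i.castSucc) t (fun i => ν i.castSucc - ν (Fin.last n) + m) *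
          kerReg t v ^ (m + 1) * symEval (stepLab n) (Sum.elim t v) ν W)) =
      (2 * Real.pi * Complex.I / (m.factorial : ℂ)) ^ n *
        (powProd (fun i => x i.castSucc) (fun i => v i.castSucc)
          (fun i => ν i.castSucc - ν (Fin.last n)) *
        symEval (stepLab n) (Sum.elim (fun i => v i.castSucc) v) ν (opsUpTo m n W)) := by
  have hsep : ∀ t : Fin n → ℂ, (∀ i : Fin n, t i ∈ closedBall (Complex.exp (2 * x i.castSucc)) r) →
      SepBy (stepLab n) (Sum.elim t v) := by
    intro t ht
    refine sepBy_of_mem_closedBall hc ?_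
    rintro (i | l)
    · exact ht i
    · exact ball_subset_closedBall (hv l)
  have hvinj : Function.Injective v := by
    intro a b hab
    by_contra hne
    exact sepBy_of_mem_closedBall (lab := id) hc (fun a => ball_subset_closedBall (hv a)) a b hne hab
  -- `expo k j` is the exponent vector when the first `k` variables are finished and `j` derivatives
  -- have been taken in variable `k`.
  let expo : ℕ → ℕ → Fin n → ℂ := fun k j i => ν i.castSucc - ν (Fin.last n) +
    (if i.1 < k then 0 else if i.1 = k then (m : ℂ) - j else m)
  have hexpo0 : expo 0 0 = fun i : Fin n => ν i.castSucc - ν (Fin.last n) + (m : ℂ) := by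
    ext i
    simp [expo]
  have hexpon : expo n 0 = fun i : Fin n => ν i.castSucc - ν (Fin.last n) := by
    ext i
    simp [expo]
  have hexpom : ∀ k, expo k m = expo (k + 1) 0 := by
    intro k
    ext i
    simp only [expo]
    congr 1
    rcases lt_trichotomy i.1 k with h | h | h
    · simp [h, Nat.lt_succ_of_lt h]
    · simp [h]
    · simp [h.not_gt, h.ne', show ¬ i.1 < k + 1 by omega]
  have hexpos : ∀ k (hk : k < n) j, expo k j - Pi.single ⟨k, hk⟩ 1 = expo k (j + 1) := by
    intro k hk j
    ext i
    simp only [expo, Pi.sub_apply]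
    by_cases hi : i = ⟨k, hk⟩
    · subst hi
      simp
      ring
    · have : i.1 ≠ k := fun h => hi (Fin.ext h)
      simp [hi, this]
  let H : ℕ → (Fin n → ℂ) → ℂ := fun k t => powProd (fun i => x i.castSucc) t (expo k 0) *
    kerReg t v ^ (m + 1) * symEval (stepLab n) (Sum.elim t v) ν (opsUpTo m k W)
  have := torusIntegral_eq_iterated_residue (c := fun i : Fin n => Complex.exp (2 * x i.castSucc))
    (v := fun i => v i.castSucc) (fun i => hv i.castSucc) (m + 1)
    (2 * Real.pi * Complex.I / (m.factorial : ℂ)) H hr ?_ ?_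
  · simp only [H, hexpo0, hexpon, kerReg_self hvinj, one_pow, mul_one] at this
    exact this
  · refine ContinuousOn.mul (ContinuousOn.mul (continuousOn_powProd _ _ fun i => h0 _) ?_) ?_
    · exact ((kerReg_continuousOn v).mono hsep).pow _
    · refine (symEval_continuousOn _ ν _).comp (Continuous.continuousOn ?_) hsep
      refine continuous_pi ?_
      rintro (i | l)
      · exact continuous_apply i
      · exact continuous_const
  · intro k hk t ht
    have hmem : ∀ s ∈ closedBall (Complex.exp (2 * x (⟨k, hk⟩ : Fin n).castSucc)) r, ∀ i,
        Function.update t ⟨k, hk⟩ s i ∈ closedBall (Complex.exp (2 * x i.castSucc)) r := by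
      intro s hs i
      by_cases hi : i = ⟨k, hk⟩
      · subst hi; simpa using hs
      · simpa [hi] using ht i
    have hC := circleIntegral_pow_inv_mul_eq_deriv m (hv (⟨k, hk⟩ : Fin n).castSucc)
      (fun j s => powProd (fun i => x i.castSucc) (Function.update t ⟨k, hk⟩ s) (expo k j) *
        kerReg (Function.update t ⟨k, hk⟩ s) v ^ (m + 1) *
        symEval (stepLab n) (Sum.elim (Function.update t ⟨k, hk⟩ s) v) ν
          (rowOps m ⟨k, hk⟩ j (opsUpTo m k W))) ?_
    · simp only [H]
      rw [opsUpTo, dif_pos hk, ← hexpom]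
      exact hC
    · intro j _ s hs
      have hm' := hmem s hs
      have := hasDerivAt_rowOp m (y := fun i : Fin n => x i.castSucc) (e := expo k j) (ν := ν)
        (i := ⟨k, hk⟩) (hsep _ hm') (ne_zero_of_mem_closedBall (hm' _) (h0 _))
        (div_mem_slitPlane (hm' _) (h0 _)) ((m : ℂ) - j) (by simp [expo])
        (rowOps m ⟨k, hk⟩ j (opsUpTo m k W))
      simp only [Function.update_idem, Function.update_self, hexpos] at this
      exact this

end RowResidue


/-! ### Splitting off the last row of the triangular array. -/

section IteratedIntegral

open Metric MeasureTheory

lemma torusIntegral_congr {n : ℕ} {f g : (Fin n → ℂ) → ℂ} {c : Fin n → ℂ} {r : Fin n → ℝ}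
    (hr : ∀ i, 0 ≤ r i) (h : ∀ t, (∀ i, t i ∈ sphere (c i) (r i)) → f t = g t) :
    (∯ t in T(c, r), f t) = ∯ t in T(c, r), g t := by
  refine setIntegral_congr_fun measurableSet_Icc fun θ _ => ?_
  have := h (torusMap c r θ) fun i => circleMap_mem_sphere (c i) (hr i) (θ i)
  simp only [this]

lemma circlesIntegral_fin {n : ℕ} (c : Fin n → ℂ) (r : Fin n → ℝ) (f : (Fin n → ℂ) → ℂ) :
    circlesIntegral c r f = ∯ t in T(c, r), f t := rfl

lemma circlesIntegral_mul_const {ι : Type} [Fintype ι] (c : ι → ℂ) (r : ι → ℝ) (f : (ι → ℂ) → ℂ)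
    (a : ℂ) : circlesIntegral c r (fun t => f t * a) = circlesIntegral c r f * a := by
  simp only [circlesIntegral, ← mul_assoc]
  exact integral_mul_const _ _

/-- Fubini for the angles. Continuity on the torus makes the integrand integrable on the compact
box. -/
lemma circlesIntegral_sum {ι κ τ : Type} [Fintype ι] [Fintype κ] [Fintype τ] (e : ι ⊕ κ ≃ τ)
    {c : τ → ℂ} {r : τ → ℝ} (hr : ∀ p, 0 ≤ r p) {f : (τ → ℂ) → ℂ}
    (hf : ContinuousOn f {z | ∀ p, z p ∈ sphere (c p) (r p)}) :
    circlesIntegral c r f =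
      circlesIntegral (fun k => c (e (Sum.inr k))) (fun k => r (e (Sum.inr k))) fun w =>
        circlesIntegral (fun i => c (e (Sum.inl i))) (fun i => r (e (Sum.inl i))) fun z =>
          f fun p => Sum.elim z w (e.symm p) := by
  let F : (τ → ℝ) → ℂ := fun θ =>
    (∏ p, (r p : ℂ) * Complex.exp ((θ p : ℂ) * Complex.I) * Complex.I) *
      f (fun p => c p + (r p : ℂ) * Complex.exp ((θ p : ℂ) * Complex.I))
  have hF : Continuous F := by
    refine Continuous.mul (by fun_prop) (hf.comp_continuous (by fun_prop) fun θ p => ?_)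
    exact circleMap_mem_sphere (c p) (hr p) (θ p)
  -- The factors are swapped so that the variables indexed by `κ` form the outer integral.
  let E : (κ → ℝ) × (ι → ℝ) ≃ᵐ (τ → ℝ) :=
    (MeasurableEquiv.prodComm.trans (MeasurableEquiv.sumPiEquivProdPi fun _ : ι ⊕ κ => ℝ).symm).trans
      (MeasurableEquiv.piCongrLeft (fun _ => ℝ) e)
  have hE : MeasurePreserving E :=
    (volume_measurePreserving_piCongrLeft (fun _ => ℝ) e).comp
      ((volume_measurePreserving_sumPiEquivProdPi_symm fun _ : ι ⊕ κ => ℝ).comp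
        Measure.measurePreserving_swap)
  have hEl : ∀ q i, E q (e (Sum.inl i)) = q.2 i := by
    intro q i
    exact MeasurableEquiv.piCongrLeft_apply_apply (β := fun _ => ℝ) e _ (Sum.inl i)
  have hEr : ∀ q k, E q (e (Sum.inr k)) = q.1 k := by
    intro q k
    exact MeasurableEquiv.piCongrLeft_apply_apply (β := fun _ => ℝ) e _ (Sum.inr k)
  have hbox : E ⁻¹' Set.Icc (0 : τ → ℝ) (fun _ => 2 * Real.pi) =
      Set.Icc (0 : κ → ℝ) (fun _ => 2 * Real.pi) ×ˢ
        Set.Icc (0 : ι → ℝ) (fun _ => 2 * Real.pi) := by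
    ext q
    simp only [Set.mem_preimage, Set.mem_Icc, Set.mem_prod, Pi.le_def, ← e.forall_congr_right,
      Sum.forall, hEl, hEr, Pi.zero_apply]
    tauto
  have hint : circlesIntegral c r f = ∫ θ in Set.Icc (0 : τ → ℝ) (fun _ => 2 * Real.pi), F θ := rfl
  rw [hint, ← hE.map_eq, setIntegral_map_equiv, hbox, Measure.volume_eq_prod, setIntegral_prod]
  · refine setIntegral_congr_fun measurableSet_Icc fun θ _ => ?_
    simp only [circlesIntegral]
    rw [← integral_const_mul]
    refine setIntegral_congr_fun measurableSet_Icc fun η _ => ?_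
    simp only [F]
    rw [← e.prod_comp, Fintype.prod_sum_type]
    simp only [hEl, hEr]
    rw [mul_comm (∏ i : ι, _), mul_assoc]
    congr 3
    ext p
    obtain ⟨q, rfl⟩ := e.surjective p
    rw [e.symm_apply_apply]
    rcases q with i | k
    · simp [hEl]
    · simp [hEr]
  · have h1 : Continuous fun q => E q := by
      refine continuous_pi fun p => ?_
      obtain ⟨q, rfl⟩ := e.surjective p
      rcases q with i | k
      · simp only [hEl]; fun_prop
      · simp only [hEr]; fun_prop
    exact (hF.comp h1).continuousOn.integrableOn_compact (isCompact_Icc.prod isCompact_Icc)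

/-- Split off the last row of integration variables. -/
def triSplit (n : ℕ) : TriIdx (n + 1) ⊕ Fin (n + 1) ≃ TriIdx (n + 2) where
  toFun := Sum.elim (fun p => ⟨Fin.castSucc p.1, p.2⟩) fun i => ⟨Fin.last n, i⟩
  invFun p := if h : p.1.1 < n then Sum.inl ⟨⟨p.1.1, h⟩, p.2⟩
    else Sum.inr ⟨p.2.1, by have h1 := p.1.2; have h2 := p.2.2; omega⟩
  left_inv := by
    rintro (⟨j, i⟩ | i)
    · have : j.1 < n := j.2
      simp [this]
      rfl
    · simp
  right_inv := by
    rintro ⟨⟨j, hj⟩, i⟩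
    by_cases h : j < n
    · simp [h]
    · obtain rfl : j = n := by omega
      simp
      rfl

/-- The integrand with independent last row `v` and base points `exp (2 x_i)` of the branches. -/
noncomputable def triIntegrand {n : ℕ} (m : ℕ) (x ν v : Fin (n + 1) → ℂ) (t : TriIdx (n + 1) → ℂ) :
    ℂ :=
  (∏ j : Fin n, (vandAStar (triRow v t j.castSucc) (triRow v t j.succ) ^ (m + 1))⁻¹) *
  (∏ j : Fin n, vandA (triRow v t j.castSucc) ^ (2 + 2 * m)) *
  ∏ p : TriIdx (n + 1),
    branchPow (x p.pt) (t p) (ν ⟨p.1.1, by omega⟩ - ν ⟨p.1.1 + 1, by omega⟩ + (m : ℂ))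

lemma omegaStar_eq_triIntegrand {n : ℕ} (m : ℕ) (x ν : Fin (n + 1) → ℂ) :
    omegaStar m x ν = triIntegrand m x ν fun i => Complex.exp (2 * x i) := rfl

variable {n : ℕ}

lemma triRow_castSucc (v : Fin (n + 2) → ℂ) (z : TriIdx (n + 1) → ℂ) (w : Fin (n + 1) → ℂ)
    (j : Fin (n + 1)) :
    triRow v (fun p => Sum.elim z w ((triSplit n).symm p)) j.castSucc = triRow w z j := by
  ext i
  have hj : j.castSucc.1 < n + 2 - 1 := j.2
  by_cases h : j.1 < n
  · have h' : j.1 < n + 1 - 1 := h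
    rw [triRow, triRow, dif_pos hj, dif_pos h']
    have : (⟨⟨j.castSucc.1, hj⟩, i⟩ : TriIdx (n + 2)) = triSplit n (Sum.inl ⟨⟨j.1, h'⟩, i⟩) := rfl
    rw [this, Equiv.symm_apply_apply]
    rfl
  · have h' : ¬ j.1 < n + 1 - 1 := h
    rw [triRow, triRow, dif_pos hj, dif_neg h']
    obtain ⟨j, hjn⟩ := j
    obtain rfl : j = n := by simp only at h; omega
    have : (⟨⟨j, hj⟩, i⟩ : TriIdx (j + 2)) = triSplit j (Sum.inr ⟨i.1, i.2⟩) := rfl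
    exact (congrArg (fun p => Sum.elim z w ((triSplit j).symm p)) this).trans
      (by rw [Equiv.symm_apply_apply]; rfl)

lemma triRow_last (v : Fin (n + 1) → ℂ) (t : TriIdx (n + 1) → ℂ) :
    triRow v t (Fin.last n) = v := by
  ext i
  have h : ¬ (Fin.last n).1 < n + 1 - 1 := lt_irrefl n
  rw [triRow, dif_neg h]
  rfl

/-- The remaining integrand has the same form, with the split-off row `w` as its new free last row;
this is what makes induction over rows possible. -/
lemma triIntegrand_succ (m : ℕ) (x ν v : Fin (n + 2) → ℂ) (z : TriIdx (n + 1) → ℂ)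
    (w : Fin (n + 1) → ℂ) :
    triIntegrand m x ν v (fun p => Sum.elim z w ((triSplit n).symm p)) =
      triIntegrand m (fun i => x i.castSucc) (fun i => ν i.castSucc) w z *
        ((vandAStar w v ^ (m + 1))⁻¹ * vandA w ^ (2 + 2 * m) *
          powProd (fun i => x i.castSucc) w
            fun _ => ν (Fin.last n).castSucc - ν (Fin.last (n + 1)) + (m : ℂ)) := by
  unfold triIntegrand
  have e1 : ∏ j : Fin (n + 1), (vandAStar
      (triRow v (fun p => Sum.elim z w ((triSplit n).symm p)) j.castSucc)
      (triRow v (fun p => Sum.elim z w ((triSplit n).symm p)) j.succ) ^ (m + 1))⁻¹ =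
      (∏ j : Fin n, (vandAStar (triRow w z j.castSucc) (triRow w z j.succ) ^ (m + 1))⁻¹) *
        (vandAStar w v ^ (m + 1))⁻¹ := by
    rw [Fin.prod_univ_castSucc]
    congr 1
    · refine Finset.prod_congr rfl fun j _ => ?_
      have h1 := triRow_castSucc v z w j.castSucc
      have h2 := triRow_castSucc v z w j.succ
      exact congrArg₂ (fun (a : Fin (j.1 + 1) → ℂ) b => (vandAStar a b ^ (m + 1))⁻¹) h1 h2
    · have h1 := (triRow_castSucc v z w (Fin.last n)).trans (triRow_last w z)
      have h2 := triRow_last v (fun p => Sum.elim z w ((triSplit n).symm p))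
      exact congrArg₂ (fun (a : Fin (n + 1) → ℂ) b => (vandAStar a b ^ (m + 1))⁻¹) h1 h2
  have e2 : ∏ j : Fin (n + 1), vandA
      (triRow v (fun p => Sum.elim z w ((triSplit n).symm p)) j.castSucc) ^ (2 + 2 * m) =
      (∏ j : Fin n, vandA (triRow w z j.castSucc) ^ (2 + 2 * m)) * vandA w ^ (2 + 2 * m) := by
    rw [Fin.prod_univ_castSucc]
    congr 1
    · refine Finset.prod_congr rfl fun j _ => ?_
      have h1 := triRow_castSucc v z w j.castSucc
      exact congrArg (fun (a : Fin (j.1 + 1) → ℂ) => vandA a ^ (2 + 2 * m)) h1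
    · have h1 := (triRow_castSucc v z w (Fin.last n)).trans (triRow_last w z)
      exact congrArg (fun (a : Fin (n + 1) → ℂ) => vandA a ^ (2 + 2 * m)) h1
  have e3 : ∏ p : TriIdx (n + 2), branchPow (x p.pt) (Sum.elim z w ((triSplit n).symm p))
        (ν ⟨p.1.1, by omega⟩ - ν ⟨p.1.1 + 1, by omega⟩ + (m : ℂ)) =
      (∏ p : TriIdx (n + 1), branchPow (x p.pt.castSucc) (z p)
        (ν (Fin.castSucc ⟨p.1.1, by omega⟩) - ν (Fin.castSucc ⟨p.1.1 + 1, by omega⟩) + (m : ℂ))) *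
      powProd (fun i => x i.castSucc) w
            fun _ => ν (Fin.last n).castSucc - ν (Fin.last (n + 1)) + (m : ℂ) := by
    rw [← (triSplit n).prod_comp, Fintype.prod_sum_type]
    simp only [Equiv.symm_apply_apply, Sum.elim_inl, Sum.elim_inr]
    rfl
  rw [e1, e2, e3]
  ring

end IteratedIntegral


/-! ### The full integral in closed form. -/

section TriangularIntegral

open Metric

variable {n : ℕ}

lemma triRow_mem (R : ℕ → ℝ) {c v : Fin (n + 1) → ℂ} {t : TriIdx (n + 1) → ℂ}
    (hv : ∀ i, v i ∈ closedBall (c i) (R n))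
    (ht : ∀ p, t p ∈ sphere (c (TriIdx.pt p)) (R p.1.1)) (j : Fin (n + 1)) (i : Fin (j.1 + 1)) :
    triRow v t j i ∈ closedBall (c ⟨i.1, by omega⟩) (R j.1) := by
  unfold triRow
  split_ifs with h
  · exact sphere_subset_closedBall (ht ⟨⟨j.1, h⟩, i⟩)
  · have hR : R j.1 = R n := by
      congr 1
      omega
    rw [hR]
    exact hv _

lemma triRow_mem_sphere (R : ℕ → ℝ) {c v : Fin (n + 1) → ℂ} {t : TriIdx (n + 1) → ℂ}
    (ht : ∀ p, t p ∈ sphere (c (TriIdx.pt p)) (R p.1.1)) (j : Fin n)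
    (i : Fin (j.castSucc.1 + 1)) :
    triRow v t j.castSucc i ∈ sphere (c ⟨i.1, by have := j.castSucc.2; omega⟩)
      (R j.1) := by
  have h : j.castSucc.1 < n + 1 - 1 := j.2
  rw [triRow, dif_pos h]
  exact ht ⟨⟨j.1, h⟩, i⟩

lemma continuous_triRow (v : Fin (n + 1) → ℂ) (j : Fin (n + 1)) :
    Continuous fun t : TriIdx (n + 1) → ℂ => triRow v t j := by
  refine continuous_pi fun i => ?_
  unfold triRow
  split_ifs <;> fun_prop

lemma le_zero_of_decreasing {R : ℕ → ℝ} (hR : ∀ j < n, R (j + 1) < R j) : ∀ j ≤ n, R j ≤ R 0 := by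
  intro j
  induction j with
  | zero => intro _; exact le_rfl
  | succ j ih => intro hj; exact (hR j hj).le.trans (ih (by omega))

lemma nonneg_of_decreasing {R : ℕ → ℝ} (hR : ∀ j < n, R (j + 1) < R j) (hn : 0 ≤ R n) :
    ∀ j ≤ n, 0 ≤ R j := by
  intro j hj
  induction hk : n - j generalizing j with
  | zero => obtain rfl : j = n := by omega
            exact hn
  | succ k ih => exact (ih (j + 1) (by omega) (by omega)).trans (hR j (by omega)).le

/-- Consecutive rows use concentric circles with strictly decreasing radii around the same centre,
and disjoint discs around different centres, so `A^*` does not vanish on the cycle. -/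
lemma ne_of_mem_rows {L : Type} {c : L → ℂ} {r s ρ : ℝ}
    (hc : ∀ i j, i ≠ j → 2 * ρ < ‖c i - c j‖) (hr : r ≤ ρ) (hs : s < r) {i l : L} {a b : ℂ}
    (ha : a ∈ sphere (c i) r) (hb : b ∈ closedBall (c l) s) : a ≠ b := by
  rintro rfl
  rw [mem_sphere] at ha
  rw [mem_closedBall] at hb
  by_cases h : i = l
  · subst h
    linarith
  · have h1 := hc i l h
    have h2 := dist_triangle (c i) a (c l)
    rw [dist_comm (c i) a, ha, dist_eq_norm] at h2
    linarith

lemma continuousOn_triIntegrand (m : ℕ) (x ν v : Fin (n + 1) → ℂ) (R : ℕ → ℝ)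
    (hR : ∀ j < n, R (j + 1) < R j) (h0 : ∀ i, R 0 < ‖Complex.exp (2 * x i)‖)
    (hc : ∀ i j, i ≠ j → 2 * R 0 < ‖Complex.exp (2 * x i) - Complex.exp (2 * x j)‖)
    (hv : ∀ i, v i ∈ closedBall (Complex.exp (2 * x i)) (R n)) :
    ContinuousOn (triIntegrand m x ν v)
      {t | ∀ p, t p ∈ sphere (Complex.exp (2 * x (TriIdx.pt p))) (R p.1.1)} := by
  have hRle := le_zero_of_decreasing hR
  unfold triIntegrand
  refine ContinuousOn.mul (ContinuousOn.mul ?_ ?_) ?_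
  · refine continuousOn_finsetProd _ fun j _ => ContinuousOn.inv₀ ?_ fun t ht => ?_
    · exact ((continuous_vandAStar.comp
        ((continuous_triRow v j.castSucc).prodMk (continuous_triRow v j.succ))).pow _).continuousOn
    · refine pow_ne_zero _ (vandAStar_ne_zero fun i l => ?_)
      exact ne_of_mem_rows hc (hRle j.1 j.2.le) (hR j.1 j.2)
        (triRow_mem_sphere R (c := fun i => Complex.exp (2 * x i)) ht j i)
        (triRow_mem R (c := fun i => Complex.exp (2 * x i)) hv ht j.succ l)
  · exact (continuous_finsetProd _ fun j _ =>
      (continuous_vandA.comp (continuous_triRow v j.castSucc)).pow _).continuousOn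
  · refine continuousOn_finsetProd _ fun p _ => ?_
    have hp : R p.1.1 ≤ R 0 := hRle _ (by have := p.1.2; omega)
    exact (continuousOn_branchPow (x p.pt) _ (h0 p.pt)).comp (continuous_apply p).continuousOn
      fun t ht => closedBall_subset_closedBall hp (sphere_subset_closedBall (ht p))

lemma powProd_add_const_mul {y t e f : Fin n → ℂ} :
    powProd y t e * powProd y t f = powProd y t (fun i => e i + f i) :=
  (powProd_add y t e f).symm

/-- The last row `v` ranges over small discs instead of being fixed at the points `exp (2 x_i)`: the
induction hypothesis is needed at every point of the next contour. -/
theorem circlesIntegral_triIntegrand (m n : ℕ) (x ν v : Fin (n + 1) → ℂ) (R : ℕ → ℝ)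
    (hR : ∀ j < n, R (j + 1) < R j) (hRn : 0 ≤ R n) (h0 : ∀ i, R 0 < ‖Complex.exp (2 * x i)‖)
    (hc : ∀ i j, i ≠ j → 2 * R 0 < ‖Complex.exp (2 * x i) - Complex.exp (2 * x j)‖)
    (hv : ∀ i, v i ∈ closedBall (Complex.exp (2 * x i)) (R n)) :
    circlesIntegral (fun p : TriIdx (n + 1) => Complex.exp (2 * x p.pt)) (fun p => R p.1.1)
        (triIntegrand m x ν v) =
      (2 * Real.pi * Complex.I / (m.factorial : ℂ)) ^ ((n + 1) * n / 2) *
        (powProd x v (fun i => ν i - ν (Fin.last n)) * (vandA v ^ (m + 1))⁻¹ *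
          symEval id v ν (baPoly m (n + 1))) := by
  induction n with
  | zero =>
    have hE : IsEmpty (TriIdx (0 + 1)) := ⟨fun p => p.1.elim0⟩
    have h1 : triIntegrand m x ν v = fun _ => 1 := by
      ext t
      simp [triIntegrand]
    have h2 : baPoly m 1 = 1 := by
      simp [baPoly, opsUpTo, liftStep, mergeStep]
    -- There are no variables: the box is a single point of volume 1, and the integral is the value
    -- of the integrand.
    have h3 : MeasureTheory.volume
        (Set.Icc (0 : TriIdx (0 + 1) → ℝ) (fun _ => 2 * Real.pi)) = 1 := by
      rw [Real.volume_Icc_pi]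
      simp
    rw [MeasureTheory.volume_pi] at h3
    rw [h1]
    simp [h3, circlesIntegral, h2, vandA, powProd, branchPow, Fin.last, MeasureTheory.measureReal_def,
      MeasureTheory.volume_pi]
  | succ n ih =>
    have hRle := le_zero_of_decreasing hR
    have hRnn := nonneg_of_decreasing hR hRn
    have hrn : 0 < R n := hRn.trans_lt (hR n (by omega))
    have hv' : ∀ i, v i ∈ ball (Complex.exp (2 * x i)) (R n) := fun i =>
      closedBall_subset_ball (hR n (by omega)) (hv i)
    have h0n : ∀ i, R n < ‖Complex.exp (2 * x i)‖ := fun i => (hRle n (by omega)).trans_lt (h0 i)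
    have hcn : ∀ i j, i ≠ j → 2 * R n < ‖Complex.exp (2 * x i) - Complex.exp (2 * x j)‖ :=
      fun i j hij => by linarith [hc i j hij, hRle n (by omega)]
    have hvA : vandA v ≠ 0 := by
      refine vandA_ne_zero fun a b hab => ?_
      by_contra hne
      exact sepBy_of_mem_closedBall (lab := id) hcn (fun a => ball_subset_closedBall (hv' a)) a b
        hne hab
    rw [circlesIntegral_sum (triSplit n) (fun p => hRnn _ (by have := p.1.2; omega))
      (continuousOn_triIntegrand m x ν v R hR h0 hc hv)]
    simp only [triIntegrand_succ, circlesIntegral_mul_const]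
    rw [circlesIntegral_fin]
    -- The inner integral is given by the induction hypothesis. Its factor `A(w)^(-(m+1))` uses up
    -- half of `A(w)^(2+2m)`, and the other half completes the kernel.
    have hcong := torusIntegral_congr (c := fun i : Fin (n + 1) => Complex.exp (2 * x i.castSucc))
      (r := fun _ => R n)
      (f := fun w => circlesIntegral
          (fun i => Complex.exp (2 * x (TriIdx.pt ((triSplit n) (Sum.inl i)))))
          (fun i => R ((triSplit n) (Sum.inl i)).1.1)
          (triIntegrand m (fun i => x i.castSucc) (fun i => ν i.castSucc) w) *
          ((vandAStar w v ^ (m + 1))⁻¹ * vandA w ^ (2 + 2 * m) *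
          powProd (fun i => x i.castSucc) w
            fun _ => ν (Fin.last n).castSucc - ν (Fin.last (n + 1)) + (m : ℂ)))
      (g := fun w => ((2 * Real.pi * Complex.I / (m.factorial : ℂ)) ^ ((n + 1) * n / 2) *
        (vandA v ^ (m + 1))⁻¹) * ((∏ i : Fin (n + 1), ((w i - v i.castSucc) ^ (m + 1))⁻¹) *
        (powProd (fun i => x i.castSucc) w
          (fun i => ν i.castSucc - ν (Fin.last (n + 1)) + m) * kerReg w v ^ (m + 1) *
          symEval (stepLab (n + 1)) (Sum.elim w v) ν (liftStep (baPoly m (n + 1))))))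
      (fun _ => hrn.le) ?_
    · refine hcong.trans ?_
      rw [torusIntegral_const_mul, torusIntegral_kernel_mul m hrn h0n hcn hv', baPoly.eq_2 m (n + 1),
        symEval_mergeStep]
      have hlast : powProd x v (fun i => ν i - ν (Fin.last (n + 1))) =
          powProd (fun i => x i.castSucc) (fun i => v i.castSucc)
            (fun i => ν i.castSucc - ν (Fin.last (n + 1))) := by
        rw [powProd, Fin.prod_univ_castSucc]
        simp [powProd, branchPow]
      have hexp : (n + 1 + 1) * (n + 1) / 2 = (n + 1) * n / 2 + (n + 1) := by
        have := Nat.triangle_succ (n + 1)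
        simpa using this
      rw [hlast, hexp, pow_add]
      ring
    · intro w hw
      have hw' : ∀ i, w i ∈ closedBall (Complex.exp (2 * x (Fin.castSucc i))) (R n) := fun i =>
        sphere_subset_closedBall (hw i)
      have hwA : vandA w ≠ 0 := by
        refine vandA_ne_zero fun a b hab => ?_
        by_contra hne
        exact sepBy_of_mem_closedBall (c := fun i => Complex.exp (2 * x i)) (lab := Fin.castSucc)
          hcn hw' a b (fun e => hne (Fin.castSucc_injective _ e)) hab
      have hsub := ih (fun i => x i.castSucc) (fun i => ν i.castSucc) w (fun j hj => hR j (by omega))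
        hrn.le (fun i => h0 _) (fun i j hij => hc _ _ fun e => hij (Fin.castSucc_injective _ e)) hw'
      have hsub' : circlesIntegral
          (fun i => Complex.exp (2 * x (TriIdx.pt ((triSplit n) (Sum.inl i)))))
          (fun i => R ((triSplit n) (Sum.inl i)).1.1)
          (triIntegrand m (fun i => x i.castSucc) (fun i => ν i.castSucc) w) = _ := hsub
      rw [hsub', symEval_liftStep, vandAStar_eq, kerReg]
      have hpow : powProd (fun i => x i.castSucc) w
          (fun i => ν i.castSucc - ν (Fin.last (n + 1)) + m) =
          powProd (fun i => x i.castSucc) w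
            (fun i => ν i.castSucc - ν (Fin.last n).castSucc) *
          powProd (fun i => x i.castSucc) w
            (fun _ => ν (Fin.last n).castSucc - ν (Fin.last (n + 1)) + (m : ℂ)) := by
        rw [powProd_add_const_mul]
        congr 1
        ext i
        ring
      generalize (2 * Real.pi * Complex.I / (m.factorial : ℂ)) ^ ((n + 1) * n / 2) = κ
      rw [hpow, Finset.prod_inv_distrib, Finset.prod_pow, div_pow, mul_pow, mul_pow, mul_inv,
        show 2 + 2 * m = (m + 1) + (m + 1) by ring, pow_add]
      have h1 := pow_ne_zero (m + 1) hwA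
      have h2 := pow_ne_zero (m + 1) hvA
      field_simp
      ring

end TriangularIntegral


/-! ### The algebraic identity behind the intertwining property of the kernel. -/

section KernelIdentity

variable {α : Type} [Fintype α] [DecidableEq α]

/-- The ratio `z_a / (z_a - z_b)`, set to zero for `a = b`. -/
noncomputable def ptRatio (z : α → ℂ) (a b : α) : ℂ := if a = b then 0 else z a / (z a - z b)

variable {z : α → ℂ} (hz : Function.Injective z)

include hz in
omit [Fintype α] in
lemma ptRatio_add_swap (a b : α) : ptRatio z a b + ptRatio z b a = if a = b then 0 else 1 := by
  unfold ptRatio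
  by_cases h : a = b
  · simp [h]
  · have h1 := sub_ne_zero.mpr (hz.ne h)
    have h2 := sub_ne_zero.mpr (hz.ne (Ne.symm h))
    rw [if_neg h, if_neg (Ne.symm h), if_neg h]
    field_simp
    ring

include hz in
omit [Fintype α] in
lemma ptRatio_sq (a b : α) :
    ptRatio z a b ^ 2 = ptRatio z a b - ptRatio z a b * ptRatio z b a := by
  have h := ptRatio_add_swap hz a b
  by_cases hab : a = b
  · simp [hab, ptRatio]
  · rw [if_neg hab] at h
    linear_combination ptRatio z a b * h

-- For distinct points this is the case of `∑ z_a² / ((z_a - z_b)(z_a - z_c)) = 1` with three terms,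
-- a Lagrange interpolation identity.
include hz in
omit [Fintype α] in
lemma ptRatio_cyclic (a b c : α) :
    (if b = c then 0 else ptRatio z a b * ptRatio z a c) +
      (if c = a then 0 else ptRatio z b c * ptRatio z b a) +
      (if a = b then 0 else ptRatio z c a * ptRatio z c b) =
      if a = b ∨ b = c ∨ c = a then 0 else 1 := by
  by_cases hab : a = b
  · subst hab; simp [ptRatio]
  by_cases hbc : b = c
  · subst hbc; simp [ptRatio]
  by_cases hca : c = a
  · subst hca; simp [ptRatio]
  have h1 := sub_ne_zero.mpr (hz.ne hab)
  have h2 := sub_ne_zero.mpr (hz.ne hbc)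
  have h3 := sub_ne_zero.mpr (hz.ne hca)
  have h4 := sub_ne_zero.mpr (hz.ne (Ne.symm hab))
  have h5 := sub_ne_zero.mpr (hz.ne (Ne.symm hbc))
  have h6 := sub_ne_zero.mpr (hz.ne (Ne.symm hca))
  simp only [ptRatio, hab, hbc, hca, Ne.symm hab, Ne.symm hbc, Ne.symm hca, if_false, or_self]
  field_simp
  ring

-- Exchange `a` and `b` and use that the two ratios of a pair add up to 1.
include hz in
lemma sum_mul_ptRatio (ε : α → ℂ) :
    2 * ∑ a, ∑ b, ε a * ε b * ptRatio z a b = (∑ a, ε a) ^ 2 - ∑ a, ε a ^ 2 := by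
  have h1 : ∑ a, ∑ b, ε a * ε b * ptRatio z a b = ∑ a, ∑ b, ε a * ε b * ptRatio z b a := by
    rw [Finset.sum_comm]
    exact Finset.sum_congr rfl fun a _ => Finset.sum_congr rfl fun b _ => by ring
  have h2 : ∑ a, ∑ b, ε a * ε b * (if a = b then 0 else 1) = (∑ a, ε a) ^ 2 - ∑ a, ε a ^ 2 := by
    rw [sq, Finset.sum_mul_sum, ← Finset.sum_sub_distrib]
    refine Finset.sum_congr rfl fun a _ => ?_
    have : ε a ^ 2 = ∑ b, if a = b then ε b ^ 2 else 0 := by simp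
    rw [eq_sub_iff_add_eq, this, ← Finset.sum_add_distrib]
    refine Finset.sum_congr rfl fun b _ => ?_
    split_ifs with h
    · subst h; ring
    · ring
  rw [← h2, two_mul]
  nth_rw 2 [h1]
  rw [← Finset.sum_add_distrib]
  refine Finset.sum_congr rfl fun a _ => ?_
  rw [← Finset.sum_add_distrib]
  refine Finset.sum_congr rfl fun b _ => ?_
  rw [← ptRatio_add_swap hz a b]
  ring

/-- Inclusion and exclusion: the indicator of a triple of distinct indices is `1 - [a=b] - [b=c] -
[c=a] + 2 [a=b=c]`. -/
lemma sum_distinct (ε : α → ℂ) :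
    ∑ a, ∑ b, ∑ c, ε a * ε b * ε c * (if a = b ∨ b = c ∨ c = a then 0 else 1) =
      (∑ a, ε a) ^ 3 - 3 * (∑ a, ε a) * (∑ a, ε a ^ 2) + 2 * ∑ a, ε a ^ 3 := by
  have h : ∀ a b c : α, (if a = b ∨ b = c ∨ c = a then (0 : ℂ) else 1) =
      1 - (if a = b then 1 else 0) - (if b = c then 1 else 0) - (if c = a then 1 else 0) +
        2 * (if a = b then if b = c then 1 else 0 else 0) := by
    intro a b c
    by_cases hab : a = b
    · subst hab
      by_cases hbc : a = c
      · subst hbc; norm_num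
      · simp [hbc, Ne.symm hbc]
    · by_cases hbc : b = c
      · subst hbc; simp [Ne.symm hab, hab]
      · by_cases hca : c = a
        · subst hca; simp [hab, hbc]
        · simp [hab, hbc, hca]
  have e1 : ∑ a, ∑ b, ∑ c, ε a * ε b * ε c = (∑ a, ε a) ^ 3 := by
    rw [pow_succ, sq, Finset.sum_mul_sum, Finset.sum_mul]
    refine Finset.sum_congr rfl fun a _ => ?_
    rw [Finset.sum_mul]
    exact Finset.sum_congr rfl fun b _ => (Finset.mul_sum _ _ _).symm
  have e2 : ∑ a, ∑ b, ∑ c, ε a * ε b * ε c * (if a = b then 1 else 0) =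
      (∑ a, ε a) * ∑ a, ε a ^ 2 := by
    rw [mul_comm, Finset.sum_mul_sum]
    refine Finset.sum_congr rfl fun a _ => ?_
    rw [Finset.sum_eq_single a]
    · exact Finset.sum_congr rfl fun c _ => by rw [if_pos rfl]; ring
    · intro b _ hb; simp [Ne.symm hb]
    · simp
  have e3 : ∑ a, ∑ b, ∑ c, ε a * ε b * ε c * (if b = c then 1 else 0) =
      (∑ a, ε a) * ∑ a, ε a ^ 2 := by
    rw [Finset.sum_mul_sum]
    refine Finset.sum_congr rfl fun a _ => Finset.sum_congr rfl fun b _ => ?_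
    rw [Finset.sum_eq_single b]
    · simp; ring
    · intro c _ hc; simp [Ne.symm hc]
    · simp
  have e4 : ∑ a, ∑ b, ∑ c, ε a * ε b * ε c * (if c = a then 1 else 0) =
      (∑ a, ε a) * ∑ a, ε a ^ 2 := by
    rw [mul_comm, Finset.sum_mul_sum]
    refine Finset.sum_congr rfl fun a _ => Finset.sum_congr rfl fun b _ => ?_
    rw [Finset.sum_eq_single a]
    · simp; ring
    · intro c _ hc; simp [hc]
    · simp
  have e5 : ∑ a, ∑ b, ∑ c, ε a * ε b * ε c * (if a = b then if b = c then 1 else 0 else 0) =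
      ∑ a, ε a ^ 3 := by
    refine Finset.sum_congr rfl fun a _ => ?_
    rw [Finset.sum_eq_single a, Finset.sum_eq_single a]
    · simp; ring
    · intro c _ hc; simp [Ne.symm hc]
    · simp
    · intro b _ hb; simp [Ne.symm hb]
    · simp
  simp only [h, mul_add, mul_sub, mul_one, Finset.sum_add_distrib, Finset.sum_sub_distrib]
  have e6 : ∑ a, ∑ b, ∑ c, ε a * ε b * ε c * (2 * (if a = b then if b = c then 1 else 0 else 0)) =
      2 * ∑ a, ε a ^ 3 := by
    rw [← e5]
    simp only [Finset.mul_sum]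
    exact Finset.sum_congr rfl fun a _ => Finset.sum_congr rfl fun b _ =>
      Finset.sum_congr rfl fun c _ => by ring
  rw [e1, e2, e3, e4, e6]
  ring

-- Expand the square. The terms `b = c` stay; the others, averaged over cyclic permutations, become
-- constants by `ptRatio_cyclic`.
include hz in
lemma sum_mul_sq_ptRatio (ε : α → ℂ) :
    3 * ∑ a, ε a * (∑ b, ε b * ptRatio z a b) ^ 2 =
      3 * ∑ a, ∑ b, ε a * ε b ^ 2 * ptRatio z a b ^ 2 +
      ((∑ a, ε a) ^ 3 - 3 * (∑ a, ε a) * (∑ a, ε a ^ 2) + 2 * ∑ a, ε a ^ 3) := by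
  let T : α → α → α → ℂ := fun a b c =>
    ε a * ε b * ε c * (if b = c then 0 else ptRatio z a b * ptRatio z a c)
  have h1 : ∑ a, ε a * (∑ b, ε b * ptRatio z a b) ^ 2 =
      ∑ a, ∑ b, ε a * ε b ^ 2 * ptRatio z a b ^ 2 + ∑ a, ∑ b, ∑ c, T a b c := by
    rw [← Finset.sum_add_distrib]
    refine Finset.sum_congr rfl fun a _ => ?_
    rw [sq, Finset.sum_mul_sum, Finset.mul_sum, ← Finset.sum_add_distrib]
    refine Finset.sum_congr rfl fun b _ => ?_
    rw [← Finset.sum_ite_eq Finset.univ b (fun c => ε a * ε c ^ 2 * ptRatio z a c ^ 2) |>.trans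
      (if_pos (Finset.mem_univ b)), ← Finset.sum_add_distrib, Finset.mul_sum]
    refine Finset.sum_congr rfl fun c _ => ?_
    simp only [T]
    split_ifs with h
    · subst h; ring
    · ring
  have h2 : ∑ a, ∑ b, ∑ c, T b c a = ∑ a, ∑ b, ∑ c, T a b c := by
    rw [Finset.sum_comm]
    refine Finset.sum_congr rfl fun b _ => ?_
    rw [Finset.sum_comm]
  have h3 : ∑ a, ∑ b, ∑ c, T c a b = ∑ a, ∑ b, ∑ c, T a b c := by
    rw [Finset.sum_congr rfl fun a _ => Finset.sum_comm]
    exact Finset.sum_comm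
  have h4 := sum_distinct ε
  have h5 : ∑ a, ∑ b, ∑ c, T a b c + ∑ a, ∑ b, ∑ c, T b c a + ∑ a, ∑ b, ∑ c, T c a b =
      ∑ a, ∑ b, ∑ c, ε a * ε b * ε c * (if a = b ∨ b = c ∨ c = a then 0 else 1) := by
    simp only [← Finset.sum_add_distrib]
    refine Finset.sum_congr rfl fun a _ => Finset.sum_congr rfl fun b _ =>
      Finset.sum_congr rfl fun c _ => ?_
    rw [← ptRatio_cyclic hz a b c]
    simp only [T]
    ring
  rw [h2, h3, h4] at h5
  rw [h1]
  linear_combination h5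

/-- The identity expressing that the kernel intertwines the Sutherland operators for `n` and
`n + 1` particles, after division by the kernel. -/
lemma kernel_identity {n : ℕ} {t : Fin n → ℂ} {u : Fin (n + 1) → ℂ}
    (hz : Function.Injective (Sum.elim t u)) (g κ : ℂ) (X : Fin n ⊕ Fin (n + 1) → ℂ)
    (hX : ∀ a, X a = ∑ l, ptRatio (Sum.elim t u) a (Sum.inr l) -
      ∑ i, ptRatio (Sum.elim t u) a (Sum.inl i)) :
    ∑ l, (κ + g * X (Sum.inr l)) ^ 2 +
        g ^ 2 * (∑ l, ∑ j, ptRatio (Sum.elim t u) (Sum.inr l) (Sum.inr j) *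
          ptRatio (Sum.elim t u) (Sum.inr j) (Sum.inr l)) - κ ^ 2 =
      ∑ i, (g - κ - g * X (Sum.inl i)) ^ 2 +
        g ^ 2 * (∑ i, ∑ j, ptRatio (Sum.elim t u) (Sum.inl i) (Sum.inl j) *
          ptRatio (Sum.elim t u) (Sum.inl j) (Sum.inl i)) := by
  set q := ptRatio (Sum.elim t u) with hq
  -- The `t` points carry charge `-1` and the `u` points charge `+1`. The power sums of the charges
  -- are then 1, `2n + 1` and 1, and `X_a` is the charge-weighted sum of the ratios at `a`.
  let ε : Fin n ⊕ Fin (n + 1) → ℂ := Sum.elim (fun _ => -1) (fun _ => 1)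
  have hX' : ∀ a, X a = ∑ b, ε b * q a b := by
    intro a
    rw [hX, Fintype.sum_sum_type]
    simp only [ε, Sum.elim_inl, Sum.elim_inr, neg_mul, one_mul, Finset.sum_neg_distrib]
    ring
  have hε2 : ∀ a, ε a ^ 2 = 1 := by rintro (a | a) <;> simp [ε]
  have hε3 : ∀ a, ε a ^ 3 = ε a := fun a => by rw [pow_succ, hε2, one_mul]
  have s1 : ∑ a, ε a = 1 := by
    simp [Fintype.sum_sum_type, ε]
  have s2 : ∑ a, ε a ^ 2 = 2 * n + 1 := by
    simp only [hε2]
    simp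
    ring
  have s3 : ∑ a, ε a ^ 3 = 1 := by simp only [hε3, s1]
  have i1 := sum_mul_ptRatio hz ε
  have i2 := sum_mul_sq_ptRatio hz ε
  rw [s1, s2] at i1
  rw [s1, s2, s3] at i2
  rw [← hq] at i1 i2
  simp only [← hX', hε2, mul_one] at i2
  have e1 : ∑ a, ∑ b, ε a * ε b * q a b = ∑ a, ε a * X a := by
    refine Finset.sum_congr rfl fun a _ => ?_
    rw [hX', Finset.mul_sum]
    exact Finset.sum_congr rfl fun b _ => by ring
  rw [e1] at i1
  have e2 : ∑ a, ∑ b, ε a * q a b ^ 2 = ∑ a, ∑ b, ε a * q a b - ∑ a, ∑ b, ε a * (q a b * q b a) := by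
    simp only [← Finset.sum_sub_distrib]
    refine Finset.sum_congr rfl fun a _ => Finset.sum_congr rfl fun b _ => ?_
    rw [hq, ptRatio_sq hz]
    ring
  have e3 : ∑ a, ∑ b, ε a * q a b = 2 * n - ∑ a, X a := by
    have h1 : ∑ a, X a = ∑ a, ∑ b, ε a * q b a := by
      rw [Finset.sum_comm]
      exact Finset.sum_congr rfl fun a _ => hX' a
    have h2 : ∑ a, ∑ b, ε a * (if a = b then (0 : ℂ) else 1) = 2 * n := by
      have : ∀ a, ∑ b, ε a * (if a = b then (0 : ℂ) else 1) = ε a * (2 * n) := by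
        intro a
        rw [← Finset.mul_sum]
        have h4 : ∀ b, (if a = b then (0 : ℂ) else 1) = 1 - if a = b then 1 else 0 := by
          intro b; split_ifs <;> ring
        simp only [h4, Finset.sum_sub_distrib, Finset.sum_ite_eq, Finset.mem_univ, if_true]
        simp
        left
        ring
      simp only [this]
      rw [← Finset.sum_mul, s1, one_mul]
    rw [h1, ← h2, eq_sub_iff_add_eq, ← Finset.sum_add_distrib]
    refine Finset.sum_congr rfl fun a _ => ?_
    rw [← Finset.sum_add_distrib]
    refine Finset.sum_congr rfl fun b _ => ?_
    rw [← ptRatio_add_swap hz a b]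
    ring
  have e4 : ∑ a, ∑ b, ε a * (q a b * q b a) =
      (∑ l, ∑ j, q (Sum.inr l) (Sum.inr j) * q (Sum.inr j) (Sum.inr l)) -
      ∑ i, ∑ j, q (Sum.inl i) (Sum.inl j) * q (Sum.inl j) (Sum.inl i) := by
    simp only [Fintype.sum_sum_type, ε, Sum.elim_inl, Sum.elim_inr, neg_mul, one_mul,
      Finset.sum_neg_distrib, Finset.sum_add_distrib]
    have : ∑ i, ∑ l, q (Sum.inl i) (Sum.inr l) * q (Sum.inr l) (Sum.inl i) =
        ∑ l, ∑ i, q (Sum.inr l) (Sum.inl i) * q (Sum.inl i) (Sum.inr l) := by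
      rw [Finset.sum_comm]
      exact Finset.sum_congr rfl fun a _ => Finset.sum_congr rfl fun b _ => by ring
    rw [this]
    ring
  rw [e2, e3, e4] at i2
  simp only [Fintype.sum_sum_type, ε, Sum.elim_inl, Sum.elim_inr, neg_mul, one_mul,
      Finset.sum_neg_distrib] at i1 i2
  have f1 : ∑ l, (κ + g * X (Sum.inr l)) ^ 2 = (n + 1) * κ ^ 2 + 2 * κ * g * ∑ l, X (Sum.inr l) +
      g ^ 2 * ∑ l, X (Sum.inr l) ^ 2 := by
    simp only [add_sq, mul_pow, Finset.sum_add_distrib, Finset.mul_sum]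
    simp
    exact Finset.sum_congr rfl fun b _ => by ring
  have f2 : ∑ i, (g - κ - g * X (Sum.inl i)) ^ 2 = n * (g - κ) ^ 2 -
      2 * (g - κ) * g * ∑ i, X (Sum.inl i) + g ^ 2 * ∑ i, X (Sum.inl i) ^ 2 := by
    simp only [sub_sq (g - κ), mul_pow, Finset.sum_add_distrib, Finset.sum_sub_distrib,
      Finset.mul_sum]
    simp
    exact Finset.sum_congr rfl fun b _ => by ring
  rw [f1, f2]
  -- The part quadratic in `X` comes from the cubic sum `i2`; the linear part from `i1`, which says
  -- `∑ ε_a X_a = -n`.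
  linear_combination g ^ 2 / 3 * i2 + κ * g * i1 - g ^ 2 / 2 * i1

end KernelIdentity


/-! ### Integration by parts and differentiation under the integral on a torus. -/

section TorusCalculus

open Metric MeasureTheory

/-- Integrate first in the variable `i`: a function with a single-valued primitive on a closed
circle has integral 0. -/
lemma circlesIntegral_eq_zero_of_hasDerivAt {τ : Type} [Fintype τ] [DecidableEq τ] {c : τ → ℂ}
    {r : τ → ℝ} (hr : ∀ p, 0 ≤ r p) (i : τ) {f f' : (τ → ℂ) → ℂ}
    (hd : ∀ t, (∀ p, t p ∈ sphere (c p) (r p)) →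
      HasDerivAt (fun s => f (Function.update t i s)) (f' t) (t i))
    (hf' : ContinuousOn f' {t | ∀ p, t p ∈ sphere (c p) (r p)}) :
    circlesIntegral c r f' = 0 := by
  let e : Fin 1 ⊕ {p // ¬ p = i} ≃ τ :=
    ((Equiv.ofUnique (Fin 1) {p // p = i}).sumCongr (Equiv.refl _)).trans
      (Equiv.sumCompl fun p => p = i)
  have hel : ∀ k, e (Sum.inl k) = i := fun k =>
    (Equiv.ofUnique (Fin 1) {p // p = i} k).2
  have her : ∀ p : {p // ¬ p = i}, e (Sum.inr p) = p.1 := fun p => rfl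
  have hint : ∀ w : {p // ¬ p = i} → ℂ,
      (∀ p : {p // ¬ p = i}, w p ∈ sphere (c p.1) (r p.1)) →
      circlesIntegral (fun k => c (e (Sum.inl k))) (fun k => r (e (Sum.inl k)))
        (fun z => f' fun p => Sum.elim z w (e.symm p)) = 0 := by
    intro w hw
    rw [circlesIntegral_fin, torusIntegral_dim1]
    simp only [hel]
    have hup : ∀ x s : ℂ, (fun p => Sum.elim (fun _ : Fin 1 => s) w (e.symm p)) =
        Function.update (fun p => Sum.elim (fun _ : Fin 1 => x) w (e.symm p)) i s := by
      intro x s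
      ext p
      obtain ⟨q, rfl⟩ := e.surjective p
      rw [e.symm_apply_apply]
      rcases q with k | k
      · rw [hel]
        simp
      · have : e (Sum.inr k) ≠ i := k.2
        rw [Function.update_of_ne this, e.symm_apply_apply]
        rfl
    refine circleIntegral.integral_eq_zero_of_hasDerivWithinAt (hr i)
      (f := fun s => f fun p => Sum.elim (fun _ : Fin 1 => s) w (e.symm p)) fun x hx =>
        HasDerivAt.hasDerivWithinAt ?_
    have h1 := hd (fun p => Sum.elim (fun _ : Fin 1 => x) w (e.symm p)) ?_
    · simp only [← hup x] at h1
      have h2 : Sum.elim (fun _ : Fin 1 => x) w (e.symm i) = x := by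
        have h3 : e.symm i = Sum.inl 0 := (Equiv.symm_apply_eq e).mpr (hel 0).symm
        rw [h3]
        rfl
      rwa [h2] at h1
    · intro p
      obtain ⟨q, rfl⟩ := e.surjective p
      rw [e.symm_apply_apply]
      rcases q with k | k
      · rw [hel]
        exact hx
      · exact hw k
  rw [circlesIntegral_sum e hr hf']
  have hr' : ∀ p : {p // ¬ p = i}, 0 ≤ r p.1 := fun p => hr p.1
  simp only [her]
  unfold circlesIntegral
  refine (setIntegral_congr_fun measurableSet_Icc fun θ _ => ?_).trans
    (integral_zero _ _)
  have := hint (fun p : {p // ¬ p = i} =>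
    c p.1 + (r p.1 : ℂ) * Complex.exp ((θ p : ℂ) * Complex.I))
    fun p => circleMap_mem_sphere (c p.1) (hr' p) (θ p)
  unfold circlesIntegral at this
  simp only [this, mul_zero]

/-- Dominated differentiation: on a smaller closed disc of parameters times the compact box, the
derivative is bounded by a constant. -/
lemma hasDerivAt_torusIntegral {n : ℕ} {c : Fin n → ℂ} {r : Fin n → ℝ} (hr : ∀ i, 0 ≤ r i)
    {F F' : ℂ → (Fin n → ℂ) → ℂ} {s₀ : ℂ} {δ : ℝ} (hδ : 0 < δ)
    (hF : ∀ s ∈ ball s₀ δ, ContinuousOn (F s) {t | ∀ i, t i ∈ sphere (c i) (r i)})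
    (hd : ∀ s ∈ ball s₀ δ, ∀ t, (∀ i, t i ∈ sphere (c i) (r i)) →
      HasDerivAt (fun s => F s t) (F' s t) s)
    (hF' : ContinuousOn (fun p : ℂ × (Fin n → ℂ) => F' p.1 p.2)
      (ball s₀ δ ×ˢ {t | ∀ i, t i ∈ sphere (c i) (r i)})) :
    HasDerivAt (fun s => ∯ t in T(c, r), F s t) (∯ t in T(c, r), F' s₀ t) s₀ := by
  have hmem : ∀ θ, ∀ i, torusMap c r θ i ∈ sphere (c i) (r i) := fun θ i =>
    circleMap_mem_sphere (c i) (hr i) (θ i)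
  have htm : Continuous (torusMap c r) := by unfold torusMap; fun_prop
  have hcF : ∀ s ∈ ball s₀ δ, Continuous fun θ : Fin n → ℝ =>
      (∏ i, (r i : ℂ) * Complex.exp ((θ i : ℂ) * Complex.I) * Complex.I) * F s (torusMap c r θ) :=
    fun s hs => Continuous.mul (by fun_prop) ((hF s hs).comp_continuous htm hmem)
  have hcF' : ContinuousOn (fun p : ℂ × (Fin n → ℝ) =>
      (∏ i, (r i : ℂ) * Complex.exp ((p.2 i : ℂ) * Complex.I) * Complex.I) *
        F' p.1 (torusMap c r p.2)) (ball s₀ δ ×ˢ Set.univ) := by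
    refine ContinuousOn.mul (by fun_prop) ?_
    exact hF'.comp (Continuous.continuousOn (by fun_prop : Continuous fun p : ℂ × (Fin n → ℝ) =>
      (p.1, torusMap c r p.2))) fun p hp => ⟨hp.1, hmem p.2⟩
  have hsub : closedBall s₀ (δ / 2) ⊆ ball s₀ δ := closedBall_subset_ball (by linarith)
  obtain ⟨C, hC⟩ := ((isCompact_closedBall s₀ (δ / 2)).prod
    (isCompact_Icc (a := (0 : Fin n → ℝ)) (b := fun _ => 2 * Real.pi))).exists_bound_of_continuousOn
    (hcF'.mono (Set.prod_mono hsub (Set.subset_univ _)))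
  have hs0 : s₀ ∈ ball s₀ δ := mem_ball_self hδ
  have hcF0 : Continuous fun θ : Fin n → ℝ =>
      (∏ i, (r i : ℂ) * Complex.exp ((θ i : ℂ) * Complex.I) * Complex.I) *
        F' s₀ (torusMap c r θ) :=
    Continuous.mul (by fun_prop) (hF'.comp_continuous
      (by fun_prop : Continuous fun θ : Fin n → ℝ => (s₀, torusMap c r θ))
      fun θ => ⟨hs0, hmem θ⟩)
  refine (hasDerivAt_integral_of_dominated_loc_of_deriv_le (bound := fun _ => C)
    (F := fun s θ => (∏ i, (r i : ℂ) * Complex.exp ((θ i : ℂ) * Complex.I) * Complex.I) *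
      F s (torusMap c r θ))
    (F' := fun s θ => (∏ i, (r i : ℂ) * Complex.exp ((θ i : ℂ) * Complex.I) * Complex.I) *
      F' s (torusMap c r θ))
    (μ := volume.restrict (Set.Icc (0 : Fin n → ℝ) fun _ => 2 * Real.pi))
    (s := ball s₀ (δ / 2)) (ball_mem_nhds s₀ (by linarith)) ?_ ?_ ?_ ?_ ?_ ?_).2
  · filter_upwards [ball_mem_nhds s₀ hδ] with s hs
    exact (hcF s hs).aestronglyMeasurable
  · exact (hcF s₀ hs0).continuousOn.integrableOn_compact isCompact_Icc
  · exact hcF0.aestronglyMeasurable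
  · refine (ae_restrict_iff' measurableSet_Icc).mpr (Filter.Eventually.of_forall fun θ hθ s hs => ?_)
    exact hC (s, θ) ⟨ball_subset_closedBall hs, hθ⟩
  · exact continuousOn_const.integrableOn_compact isCompact_Icc
  · refine Filter.Eventually.of_forall fun θ s hs => ?_
    exact (hd s (hsub (ball_subset_closedBall hs)) _ (hmem θ)).const_mul _

end TorusCalculus

/-! ### Logarithmic derivatives of the kernel, and wave functions. -/

section Kernel

variable {n : ℕ}

/-- The charges-weighted sum of the ratios at `z_a`. -/
noncomputable def kerX (z : Fin n ⊕ Fin (n + 1) → ℂ) (a : Fin n ⊕ Fin (n + 1)) : ℂ :=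
  ∑ l, ptRatio z a (Sum.inr l) - ∑ i, ptRatio z a (Sum.inl i)

/-- The kernel function intertwining the Sutherland operators for `n` and `n + 1` particles. -/
noncomputable def sutKernel (m : ℕ) (x : Fin (n + 1) → ℂ) (κ : ℂ)
    (z : Fin n ⊕ Fin (n + 1) → ℂ) : ℂ :=
  powProd x (z ∘ Sum.inr) (fun _ => κ) * powProd (fun i => x i.castSucc) (z ∘ Sum.inl)
    (fun _ => m - κ) *
    (vandA (z ∘ Sum.inl) * vandA (z ∘ Sum.inr) / vandAStar (z ∘ Sum.inl) (z ∘ Sum.inr)) ^ (m + 1)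

lemma hasDerivAt_ptRatio {α : Type} [DecidableEq α] {z : α → ℂ} (hz : Function.Injective z)
    (a b : α) (ha : z a ≠ 0) :
    HasDerivAt (fun s => ptRatio (Function.update z a s) a b)
      ((z a)⁻¹ * (ptRatio z a b * ptRatio z b a)) (z a) := by
  unfold ptRatio
  by_cases h : a = b
  · simpa [h] using hasDerivAt_const (z a) (0 : ℂ)
  · have h1 := sub_ne_zero.mpr (hz.ne h)
    have h2 := sub_ne_zero.mpr (hz.ne (Ne.symm h))
    simp only [if_neg h, if_neg (Ne.symm h), Function.update_self,
      Function.update_of_ne (Ne.symm h)]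
    refine ((hasDerivAt_id (z a)).div ((hasDerivAt_id (z a)).sub_const (z b)) h1).congr_deriv ?_
    simp only [id]
    field_simp
    ring

lemma hasDerivAt_kerX {z : Fin n ⊕ Fin (n + 1) → ℂ} (hz : Function.Injective z)
    (a : Fin n ⊕ Fin (n + 1)) (ha : z a ≠ 0) :
    HasDerivAt (fun s => kerX (Function.update z a s) a)
      ((z a)⁻¹ * (∑ l, ptRatio z a (Sum.inr l) * ptRatio z (Sum.inr l) a -
        ∑ i, ptRatio z a (Sum.inl i) * ptRatio z (Sum.inl i) a)) (z a) := by
  unfold kerX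
  rw [mul_sub, Finset.mul_sum, Finset.mul_sum]
  exact (HasDerivAt.fun_sum fun l _ => hasDerivAt_ptRatio hz a (Sum.inr l) ha).sub
    (HasDerivAt.fun_sum fun i _ => hasDerivAt_ptRatio hz a (Sum.inl i) ha)

lemma ptRatio_of_ne_zero {α : Type} [DecidableEq α] {z : α → ℂ} {a b : α} (ha : z a ≠ 0) :
    (z a)⁻¹ * ptRatio z a b = if a = b then 0 else (z a - z b)⁻¹ := by
  unfold ptRatio
  split_ifs
  · simp
  · field_simp

lemma hasLogDerivAt_sutKernel_inr (m : ℕ) {x : Fin (n + 1) → ℂ} (κ : ℂ)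
    {z : Fin n ⊕ Fin (n + 1) → ℂ} (hz : Function.Injective z) (l : Fin (n + 1))
    (h0 : z (Sum.inr l) ≠ 0) (hs : z (Sum.inr l) / Complex.exp (2 * x l) ∈ Complex.slitPlane) :
    HasLogDerivAt (fun s => sutKernel m x κ (Function.update z (Sum.inr l) s))
      ((z (Sum.inr l))⁻¹ * (κ + (m + 1) * kerX z (Sum.inr l))) (z (Sum.inr l)) := by
  have e1 : ∀ s, (Function.update z (Sum.inr l) s) ∘ Sum.inl = z ∘ Sum.inl := by
    intro s; ext i; simp
  have e2 : ∀ s, (Function.update z (Sum.inr l) s) ∘ Sum.inr = Function.update (z ∘ Sum.inr) l s := by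
    intro s; exact Function.update_comp_eq_of_injective z Sum.inr_injective l s
  simp only [sutKernel, e1, e2]
  have hne : ∀ i l, (z ∘ Sum.inl) i ≠ (z ∘ Sum.inr) l := fun i l h => by simpa using hz h
  have h1 := hasLogDerivAt_powProd (y := x) (t := z ∘ Sum.inr) l hs (fun _ => κ)
  have h2 := hasLogDerivAt_vandA (hz.comp Sum.inr_injective) l
  have h3 := hasLogDerivAt_vandAStar_right hne l
  refine ((h1.mul (hasLogDerivAt_const _)).mul ((((hasLogDerivAt_const (vandA (z ∘ Sum.inl))).mul
    h2).div h3 (by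
      have h := vandAStar_ne_zero hne
      rwa [← Function.update_eq_self l (z ∘ Sum.inr)] at h)).pow (m + 1))).congr_log ?_
  have h4 : (z (Sum.inr l))⁻¹ * kerX z (Sum.inr l) =
      (∑ j, if j = l then 0 else (z (Sum.inr l) - z (Sum.inr j))⁻¹) -
        ∑ i, (z (Sum.inr l) - z (Sum.inl i))⁻¹ := by
    simp only [kerX, mul_sub, Finset.mul_sum, ptRatio_of_ne_zero h0, Sum.inr.injEq, reduceCtorEq,
      if_false, eq_comm]
  simp only [Function.comp_apply]
  push_cast
  linear_combination (-((m : ℂ) + 1)) * h4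

/-- `kerX` enters with the opposite sign to the `u` variables because the `t` points carry charge
`-1`. -/
lemma hasLogDerivAt_sutKernel_inl (m : ℕ) {x : Fin (n + 1) → ℂ} (κ : ℂ)
    {z : Fin n ⊕ Fin (n + 1) → ℂ} (hz : Function.Injective z) (i : Fin n)
    (h0 : z (Sum.inl i) ≠ 0)
    (hs : z (Sum.inl i) / Complex.exp (2 * x i.castSucc) ∈ Complex.slitPlane) :
    HasLogDerivAt (fun s => sutKernel m x κ (Function.update z (Sum.inl i) s))
      ((z (Sum.inl i))⁻¹ * (m - κ - (m + 1) * kerX z (Sum.inl i))) (z (Sum.inl i)) := by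
  have e1 : ∀ s, (Function.update z (Sum.inl i) s) ∘ Sum.inr = z ∘ Sum.inr := by
    intro s; ext i; simp
  have e2 : ∀ s, (Function.update z (Sum.inl i) s) ∘ Sum.inl = Function.update (z ∘ Sum.inl) i s := by
    intro s; exact Function.update_comp_eq_of_injective z Sum.inl_injective i s
  simp only [sutKernel, e1, e2]
  have hne : ∀ i l, (z ∘ Sum.inl) i ≠ (z ∘ Sum.inr) l := fun i l h => by simpa using hz h
  have h1 := hasLogDerivAt_powProd (y := fun i => x i.castSucc) (t := z ∘ Sum.inl) i hs
    (fun _ => m - κ)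
  have h2 := hasLogDerivAt_vandA (hz.comp Sum.inl_injective) i
  have h3 := hasLogDerivAt_vandAStar_left hne i
  refine (((hasLogDerivAt_const _).mul h1).mul (((h2.mul (hasLogDerivAt_const (vandA (z ∘
    Sum.inr)))).div h3 (by
      have h := vandAStar_ne_zero hne
      rwa [← Function.update_eq_self i (z ∘ Sum.inl)] at h)).pow (m + 1))).congr_log ?_
  have h4 : (z (Sum.inl i))⁻¹ * kerX z (Sum.inl i) =
      (∑ l, (z (Sum.inl i) - z (Sum.inr l))⁻¹) -
        ∑ j, if j = i then 0 else (z (Sum.inl i) - z (Sum.inl j))⁻¹ := by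
    simp only [kerX, mul_sub, Finset.mul_sum, ptRatio_of_ne_zero h0, Sum.inl.injEq, reduceCtorEq,
      if_false, eq_comm]
  simp only [Function.comp_apply]
  push_cast
  linear_combination ((m : ℂ) + 1) * h4

/-- The product of the powers `t_i ^ (ν_i)` with a polynomial in the symbols. -/
noncomputable def waveFn (x ν : Fin n → ℂ) (W : SymPoly (Fin n) (Fin n)) (t : Fin n → ℂ) : ℂ :=
  powProd x t ν * symEval id t ν W

/-- The operator `t_i ∂/∂t_i` conjugated by the powers `t_i ^ (ν_i)`. -/
noncomputable def powOp (i : Fin n) (W : SymPoly (Fin n) (Fin n)) : SymPoly (Fin n) (Fin n) :=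
  coeffDer id i W + MvPolynomial.X i * W

lemma hasDerivAt_waveFn {x ν t : Fin n → ℂ} (W : SymPoly (Fin n) (Fin n))
    (ht : Function.Injective t) (i : Fin n) (h0 : t i ≠ 0)
    (hs : t i / Complex.exp (2 * x i) ∈ Complex.slitPlane) :
    HasDerivAt (fun s => waveFn x ν W (Function.update t i s)) ((t i)⁻¹ * waveFn x ν (powOp i W) t)
      (t i) := by
  have h1 := hasLogDerivAt_powProd (y := x) i hs ν
  have h2 := hasDerivAt_symEval id t (fun a b h e => h (ht e)) i h0 ν W
  refine (HasDerivAt.mul h1 h2).congr_deriv ?_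
  simp only [Function.update_eq_self, waveFn, powOp, map_add, map_mul]
  simp only [symEval, MvPolynomial.coe_eval₂Hom, MvPolynomial.eval₂_X]
  ring

end Kernel


/-! ### The eigenvalue equation, by induction on the number of particles. -/

section SutherlandEquation

open Metric

variable {n : ℕ}

lemma continuousOn_ptRatio {α : Type} [DecidableEq α] (a b : α) :
    ContinuousOn (fun z : α → ℂ => ptRatio z a b) {z | Function.Injective z} := by
  unfold ptRatio
  split_ifs with h
  · exact continuousOn_const
  · exact ContinuousOn.div (by fun_prop) (by fun_prop) fun z hz => sub_ne_zero.mpr (hz.ne h)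

lemma continuousOn_kerX (a : Fin n ⊕ Fin (n + 1)) :
    ContinuousOn (fun z => kerX z a) {z | Function.Injective z} :=
  (continuousOn_finsetSum _ fun l _ => continuousOn_ptRatio a (Sum.inr l)).sub
    (continuousOn_finsetSum _ fun i _ => continuousOn_ptRatio a (Sum.inl i))

/-- The derivative of `kerX` along its point. -/
noncomputable def kerXDer (z : Fin n ⊕ Fin (n + 1) → ℂ) (a : Fin n ⊕ Fin (n + 1)) : ℂ :=
  ∑ l, ptRatio z a (Sum.inr l) * ptRatio z (Sum.inr l) a -
    ∑ i, ptRatio z a (Sum.inl i) * ptRatio z (Sum.inl i) a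

lemma continuousOn_kerXDer (a : Fin n ⊕ Fin (n + 1)) :
    ContinuousOn (fun z => kerXDer z a) {z | Function.Injective z} :=
  (continuousOn_finsetSum _ fun l _ =>
      (continuousOn_ptRatio a (Sum.inr l)).mul (continuousOn_ptRatio (Sum.inr l) a)).sub
    (continuousOn_finsetSum _ fun i _ =>
      (continuousOn_ptRatio a (Sum.inl i)).mul (continuousOn_ptRatio (Sum.inl i) a))

/-- Configurations with `t_i` on the circle and `u_l` inside the circle around `exp (2 x_l)`. -/
def kerDom (x : Fin (n + 1) → ℂ) (r : ℝ) : Set (Fin n ⊕ Fin (n + 1) → ℂ) :=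
  {z | (∀ i, z (Sum.inl i) ∈ sphere (Complex.exp (2 * x i.castSucc)) r) ∧
    ∀ l, z (Sum.inr l) ∈ ball (Complex.exp (2 * x l)) r}

section Domain

variable {x : Fin (n + 1) → ℂ} {r : ℝ}

lemma mem_closedBall_of_mem_kerDom {z : Fin n ⊕ Fin (n + 1) → ℂ} (hz : z ∈ kerDom x r)
    (a : Fin n ⊕ Fin (n + 1)) : z a ∈ closedBall (Complex.exp (2 * x (stepLab n a))) r := by
  rcases a with i | l
  · exact sphere_subset_closedBall (hz.1 i)
  · exact ball_subset_closedBall (hz.2 l)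

lemma injective_of_mem_kerDom
    (hc : ∀ i j, i ≠ j → 2 * r < ‖Complex.exp (2 * x i) - Complex.exp (2 * x j)‖)
    {z : Fin n ⊕ Fin (n + 1) → ℂ} (hz : z ∈ kerDom x r) : Function.Injective z := by
  have hsep : SepBy (stepLab n) z := sepBy_of_mem_closedBall hc (mem_closedBall_of_mem_kerDom hz)
  have key : ∀ (i : Fin n) (l : Fin (n + 1)), z (Sum.inl i) ≠ z (Sum.inr l) := by
    intro i l h
    by_cases hl : l = i.castSucc
    · subst hl
      have h1 := hz.1 i
      have h2 := hz.2 i.castSucc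
      rw [← h, mem_ball] at h2
      rw [mem_sphere] at h1
      linarith
    · exact hsep (Sum.inl i) (Sum.inr l) (fun h => hl h.symm) h
  rintro (a | a) (b | b) hab
  · by_contra h
    exact hsep (Sum.inl a) (Sum.inl b) (fun e => h (congrArg _ (Fin.castSucc_injective n e))) hab
  · exact absurd hab (key a b)
  · exact absurd hab.symm (key b a)
  · by_contra h
    exact hsep (Sum.inr a) (Sum.inr b) (fun e => h (congrArg _ e)) hab

lemma continuousOn_sutKernel (m : ℕ) (κ : ℂ) (h0 : ∀ i, r < ‖Complex.exp (2 * x i)‖)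
    (hc : ∀ i j, i ≠ j → 2 * r < ‖Complex.exp (2 * x i) - Complex.exp (2 * x j)‖) :
    ContinuousOn (sutKernel m x κ) (kerDom x r) := by
  unfold sutKernel
  have hl : Continuous fun z : Fin n ⊕ Fin (n + 1) → ℂ => z ∘ Sum.inl :=
    continuous_pi fun i => continuous_apply _
  have hr : Continuous fun z : Fin n ⊕ Fin (n + 1) → ℂ => z ∘ Sum.inr :=
    continuous_pi fun i => continuous_apply _
  refine ContinuousOn.mul (ContinuousOn.mul ?_ ?_) (ContinuousOn.pow (ContinuousOn.div ?_ ?_ ?_) _)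
  · exact (continuousOn_powProd x _ h0).comp hr.continuousOn fun z hz l =>
      mem_closedBall_of_mem_kerDom hz (Sum.inr l)
  · exact (continuousOn_powProd (fun i : Fin n => x i.castSucc) _ fun i => h0 _).comp
      hl.continuousOn fun z hz i => mem_closedBall_of_mem_kerDom hz (Sum.inl i)
  · exact ((continuous_vandA.comp hl).mul (continuous_vandA.comp hr)).continuousOn
  · exact (continuous_vandAStar.comp (hl.prodMk hr)).continuousOn
  · exact fun z hz => vandAStar_ne_zero fun i l h => by
      simpa using injective_of_mem_kerDom hc hz h

lemma continuousOn_waveFn (ν : Fin (n + 1) → ℂ) (W : SymPoly (Fin n) (Fin n))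
    (h0 : ∀ i, r < ‖Complex.exp (2 * x i)‖)
    (hc : ∀ i j, i ≠ j → 2 * r < ‖Complex.exp (2 * x i) - Complex.exp (2 * x j)‖) :
    ContinuousOn (waveFn (fun i => x i.castSucc) (fun i => ν i.castSucc) W)
      {t | ∀ i : Fin n, t i ∈ sphere (Complex.exp (2 * x i.castSucc)) r} := by
  unfold waveFn
  refine ContinuousOn.mul ?_ ?_
  · exact (continuousOn_powProd (fun i : Fin n => x i.castSucc) _ fun i => h0 _).mono
      fun t ht i => sphere_subset_closedBall (ht i)
  · refine (symEval_continuousOn id _ W).mono fun t ht => ?_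
    refine sepBy_of_mem_closedBall (c := fun i : Fin n => Complex.exp (2 * x i.castSucc)) (r := r)
      (fun i j h => hc _ _ fun e => h (Fin.castSucc_injective n e))
      fun a => sphere_subset_closedBall (ht a)

/-- The kernel function maps the wave function of `n` particles to that of `n + 1` particles. -/
lemma torusIntegral_sutKernel_mul (m : ℕ) {v ν : Fin (n + 1) → ℂ}
    (hr : 0 < r) (h0 : ∀ i, r < ‖Complex.exp (2 * x i)‖)
    (hc : ∀ i j, i ≠ j → 2 * r < ‖Complex.exp (2 * x i) - Complex.exp (2 * x j)‖)
    (hv : ∀ i, v i ∈ ball (Complex.exp (2 * x i)) r) :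
    (∯ t in T((fun i : Fin n => Complex.exp (2 * x i.castSucc)), fun _ => r),
      sutKernel m x (ν (Fin.last n)) (Sum.elim t v) *
        waveFn (fun i => x i.castSucc) (fun i => ν i.castSucc) (baPoly m n) t) =
      (2 * Real.pi * Complex.I / (m.factorial : ℂ)) ^ n * waveFn x ν (baPoly m (n + 1)) v := by
  -- The power `ν_last` is taken out of all variables, including the last one. What is left has
  -- exponent 0 at the last point and is the product appearing in the row residue.
  have h1 : powProd x v ν = powProd x v (fun _ => ν (Fin.last n)) *
      powProd (fun i => x i.castSucc) (fun i => v i.castSucc)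
        (fun i => ν i.castSucc - ν (Fin.last n)) := by
    have h2 : powProd x v (fun i => ν i - ν (Fin.last n)) = powProd (fun i => x i.castSucc)
        (fun i => v i.castSucc) (fun i => ν i.castSucc - ν (Fin.last n)) := by
      unfold powProd
      rw [Fin.prod_univ_castSucc]
      simp [branchPow]
    rw [← h2, powProd_add_const_mul]
    congr 1
    ext i
    ring
  rw [waveFn, h1, baPoly.eq_2 m n, symEval_mergeStep, mul_assoc (powProd _ _ _),
    mul_left_comm (_ ^ n), ← torusIntegral_kernel_mul m hr h0 hc hv, ← torusIntegral_const_mul]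
  refine torusIntegral_congr (fun _ => hr.le) fun t _ => ?_
  rw [symEval_liftStep, sutKernel, waveFn, Sum.elim_comp_inl, Sum.elim_comp_inr, vandAStar_eq]
  have h2 : powProd (fun i : Fin n => x i.castSucc) t (fun i => ν i.castSucc - ν (Fin.last n) + m) =
      powProd (fun i : Fin n => x i.castSucc) t (fun _ => m - ν (Fin.last n)) *
        powProd (fun i : Fin n => x i.castSucc) t (fun i => ν i.castSucc) := by
    rw [powProd_add_const_mul]
    congr 1
    ext i
    ring
  rw [h2, kerReg, Finset.prod_inv_distrib, Finset.prod_pow, div_pow, div_pow, mul_pow _ (vandAReg t v),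
    div_eq_mul_inv, div_eq_mul_inv, mul_inv]
  ring

lemma update_inr_mem_kerDom {t : Fin n → ℂ} {u : Fin (n + 1) → ℂ}
    (ht : ∀ i, t i ∈ sphere (Complex.exp (2 * x i.castSucc)) r)
    (hu : ∀ l, u l ∈ ball (Complex.exp (2 * x l)) r) (l : Fin (n + 1)) {s : ℂ}
    (hs : s ∈ ball (Complex.exp (2 * x l)) r) :
    Sum.elim t (Function.update u l s) ∈ kerDom x r := by
  refine ⟨ht, fun k => ?_⟩
  rw [Sum.elim_inr]
  by_cases h : k = l
  · subst h
    rwa [Function.update_self]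
  · rw [Function.update_of_ne h]
    exact hu k

/-- Differentiation of an integral representation of a wave function. -/
lemma torusIntegral_waveFn_powOp {ν : Fin (n + 1) → ℂ} {C : ℂ}
    {W : SymPoly (Fin (n + 1)) (Fin (n + 1))}
    {G G' : (Fin n ⊕ Fin (n + 1) → ℂ) → ℂ} {φ : (Fin n → ℂ) → ℂ} (l : Fin (n + 1))
    (hr : 0 < r) (h0 : ∀ i, r < ‖Complex.exp (2 * x i)‖)
    (hc : ∀ i j, i ≠ j → 2 * r < ‖Complex.exp (2 * x i) - Complex.exp (2 * x j)‖)
    (hG : ContinuousOn G (kerDom x r)) (hG' : ContinuousOn G' (kerDom x r))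
    (hφ : ContinuousOn φ {t | ∀ i : Fin n, t i ∈ sphere (Complex.exp (2 * x i.castSucc)) r})
    (hd : ∀ z ∈ kerDom x r, HasDerivAt (fun s => G (Function.update z (Sum.inr l) s))
      ((z (Sum.inr l))⁻¹ * G' z) (z (Sum.inr l)))
    (h : ∀ u : Fin (n + 1) → ℂ, (∀ l, u l ∈ ball (Complex.exp (2 * x l)) r) →
      C * waveFn x ν W u =
        ∯ t in T((fun i : Fin n => Complex.exp (2 * x i.castSucc)), fun _ => r),
          G (Sum.elim t u) * φ t)
    {u : Fin (n + 1) → ℂ} (hu : ∀ l, u l ∈ ball (Complex.exp (2 * x l)) r) :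
    C * waveFn x ν (powOp l W) u =
      ∯ t in T((fun i : Fin n => Complex.exp (2 * x i.castSucc)), fun _ => r),
        G' (Sum.elim t u) * φ t := by
  have hu0 : u l ≠ 0 := ne_zero_of_mem_closedBall (ball_subset_closedBall (hu l)) (h0 l)
  have huinj : Function.Injective u := by
    have := sepBy_of_mem_closedBall (lab := id) hc fun a => ball_subset_closedBall (hu a)
    intro a b hab
    by_contra hne
    exact this a b hne hab
  have hup : ∀ s ∈ ball (Complex.exp (2 * x l)) r, ∀ k,
      Function.update u l s k ∈ ball (Complex.exp (2 * x k)) r := by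
    intro s hs k
    by_cases hk : k = l
    · subst hk
      rwa [Function.update_self]
    · rw [Function.update_of_ne hk]
      exact hu k
  obtain ⟨δ, hδ, hball⟩ := Metric.isOpen_iff.mp isOpen_ball (u l) (hu l)
  have hL : HasDerivAt (fun s => C * waveFn x ν W (Function.update u l s))
      (C * ((u l)⁻¹ * waveFn x ν (powOp l W) u)) (u l) :=
    (hasDerivAt_waveFn W huinj l hu0
      (div_mem_slitPlane (ball_subset_closedBall (hu l)) (h0 l))).const_mul C
  have hcont : ∀ {H : (Fin n ⊕ Fin (n + 1) → ℂ) → ℂ}, ContinuousOn H (kerDom x r) →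
      ContinuousOn (fun p : ℂ × (Fin n → ℂ) => H (Sum.elim p.2 (Function.update u l p.1)))
        (ball (u l) δ ×ˢ {t | ∀ i : Fin n, t i ∈ sphere (Complex.exp (2 * x i.castSucc)) r}) := by
    intro H hH
    refine hH.comp (Continuous.continuousOn ?_) fun p hp =>
      update_inr_mem_kerDom hp.2 hu l (hball hp.1)
    refine continuous_pi ?_
    rintro (i | k)
    · simp only [Sum.elim_inl]
      fun_prop
    · simp only [Sum.elim_inr]
      have h1 : Continuous fun p : ℂ × (Fin n → ℂ) => Function.update u l p.1 :=
        continuous_const.update l continuous_fst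
      exact (continuous_apply k).comp h1
  have hR := hasDerivAt_torusIntegral (c := fun i : Fin n => Complex.exp (2 * x i.castSucc))
    (r := fun _ => r) (fun _ => hr.le) (s₀ := u l) (δ := δ) hδ
    (F := fun s t => G (Sum.elim t (Function.update u l s)) * φ t)
    (F' := fun s t => s⁻¹ * (G' (Sum.elim t (Function.update u l s)) * φ t)) ?_ ?_ ?_
  · have heq : (fun s => C * waveFn x ν W (Function.update u l s)) =ᶠ[nhds (u l)]
        fun s => ∯ t in T((fun i : Fin n => Complex.exp (2 * x i.castSucc)), fun _ => r),
          G (Sum.elim t (Function.update u l s)) * φ t := by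
      filter_upwards [isOpen_ball.mem_nhds (hu l)] with s hs
      exact h _ (hup s hs)
    have h1 := hL.unique (hR.congr_of_eventuallyEq heq)
    rw [torusIntegral_const_mul, Function.update_eq_self, mul_left_comm] at h1
    exact mul_left_cancel₀ (inv_ne_zero hu0) h1
  · intro s hs
    refine ContinuousOn.mul ?_ hφ
    exact (hcont hG).comp (f := fun t : Fin n → ℂ => (s, t))
      (Continuous.continuousOn (Continuous.prodMk_right s)) fun t ht => ⟨hs, ht⟩
  · intro s hs t ht
    have h1 := hd _ (update_inr_mem_kerDom ht hu l (hball hs))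
    simp only [Sum.update_elim_inr, Sum.elim_inr, Function.update_self,
      Function.update_idem] at h1
    exact (h1.mul_const (φ t)).congr_deriv (mul_assoc _ _ _)
  · refine ContinuousOn.mul ?_ ((hcont hG').mul (hφ.comp continuousOn_snd fun p hp => hp.2))
    refine ContinuousOn.inv₀ continuousOn_fst fun p hp => ?_
    exact ne_zero_of_mem_closedBall (ball_subset_closedBall (hball hp.1)) (h0 l)

end Domain

lemma torusIntegral_finset_sum {ι : Type} {c : Fin n → ℂ} {r : Fin n → ℝ} (hr : ∀ i, 0 ≤ r i)
    (s : Finset ι) {f : ι → (Fin n → ℂ) → ℂ}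
    (hf : ∀ k ∈ s, ContinuousOn (f k) {t | ∀ i, t i ∈ sphere (c i) (r i)}) :
    (∯ t in T(c, r), ∑ k ∈ s, f k t) = ∑ k ∈ s, ∯ t in T(c, r), f k t := by
  classical
  induction s using Finset.induction_on with
  | empty => simp [torusIntegral]
  | insert a s ha ih =>
    simp only [Finset.sum_insert ha]
    rw [← ih fun k hk => hf k (Finset.mem_insert_of_mem hk), ← torusIntegral_add
      (torusIntegrable_of_continuousOn hr (hf a (Finset.mem_insert_self a s)))
      (torusIntegrable_of_continuousOn hr
        (continuousOn_finsetSum s fun k hk => hf k (Finset.mem_insert_of_mem hk)))]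

lemma exists_pos_radius (z : Fin n → ℂ) (hz : Function.Injective z) (h0 : ∀ i, z i ≠ 0) :
    ∃ r : ℝ, 0 < r ∧ (∀ i, r < ‖z i‖) ∧ ∀ i j, i ≠ j → 2 * r < ‖z i - z j‖ := by
  have hev : ∀ a : ℝ, 0 < a → ∀ᶠ r in nhdsWithin (0 : ℝ) (Set.Ioi 0), 2 * r < a := by
    intro a ha
    have : ∀ᶠ r in nhds (0 : ℝ), 2 * r < a :=
      (by fun_prop : Continuous fun r : ℝ => 2 * r).tendsto' 0 0 (by simp) |>.eventually
        (gt_mem_nhds ha)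
    exact this.filter_mono nhdsWithin_le_nhds
  have h1 : ∀ᶠ r in nhdsWithin (0 : ℝ) (Set.Ioi 0), ∀ i, 2 * r < ‖z i‖ :=
    Filter.eventually_all.mpr fun i => hev _ (norm_pos_iff.mpr (h0 i))
  have h2 : ∀ᶠ r in nhdsWithin (0 : ℝ) (Set.Ioi 0), ∀ i j, i ≠ j → 2 * r < ‖z i - z j‖ :=
    Filter.eventually_all.mpr fun i => Filter.eventually_all.mpr fun j => by
      by_cases h : i = j
      · simp [h]
      · simpa [h] using hev _ (norm_pos_iff.mpr (sub_ne_zero.mpr (hz.ne h)))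
  obtain ⟨r, ⟨h3, h4⟩, h5⟩ := ((h1.and h2).and self_mem_nhdsWithin).exists
  have h5 : 0 < r := h5
  exact ⟨r, h5, fun i => by linarith [h3 i], h4⟩

section Step

variable {x ν : Fin (n + 1) → ℂ} {r : ℝ} {m : ℕ}

/-- The logarithmic derivative of the kernel in `u_l`, or of `t_i` times the kernel in `t_i`. -/
noncomputable def kerLam (m : ℕ) (κ : ℂ) (z : Fin n ⊕ Fin (n + 1) → ℂ) :
    Fin n ⊕ Fin (n + 1) → ℂ :=
  Sum.elim (fun i => m + 1 - κ - (m + 1) * kerX z (Sum.inl i))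
    (fun l => κ + (m + 1) * kerX z (Sum.inr l))

lemma continuousOn_kerLam (κ : ℂ)
    (hc : ∀ i j, i ≠ j → 2 * r < ‖Complex.exp (2 * x i) - Complex.exp (2 * x j)‖)
    (a : Fin n ⊕ Fin (n + 1)) : ContinuousOn (fun z => kerLam m κ z a) (kerDom x r) := by
  have h : ∀ b : Fin n ⊕ Fin (n + 1), ContinuousOn (fun z => kerX z b) (kerDom x r) :=
    fun b => (continuousOn_kerX b).mono fun z hz => injective_of_mem_kerDom hc hz
  rcases a with i | l
  · exact continuousOn_const.sub (continuousOn_const.mul (h _))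
  · exact continuousOn_const.add (continuousOn_const.mul (h _))

/-- Two differentiations under the integral sign. If `Λ` is the Euler logarithmic derivative of the
kernel `K`, then `K` becomes `K Λ` and then `K (Λ² + (m + 1) X')`, where `X'` is `kerXDer`. -/
lemma torusIntegral_waveFn_powOp_powOp (hr : 0 < r) (h0 : ∀ i, r < ‖Complex.exp (2 * x i)‖)
    (hc : ∀ i j, i ≠ j → 2 * r < ‖Complex.exp (2 * x i) - Complex.exp (2 * x j)‖)
    {u : Fin (n + 1) → ℂ} (hu : ∀ l, u l ∈ ball (Complex.exp (2 * x l)) r) (l : Fin (n + 1)) :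
    (2 * Real.pi * Complex.I / (m.factorial : ℂ)) ^ n *
        waveFn x ν (powOp l (powOp l (baPoly m (n + 1)))) u =
      ∯ t in T((fun i : Fin n => Complex.exp (2 * x i.castSucc)), fun _ => r),
        (sutKernel m x (ν (Fin.last n)) (Sum.elim t u) *
          (kerLam m (ν (Fin.last n)) (Sum.elim t u) (Sum.inr l) ^ 2 +
            (m + 1) * kerXDer (Sum.elim t u) (Sum.inr l))) *
          waveFn (fun i => x i.castSucc) (fun i => ν i.castSucc) (baPoly m n) t := by
  have hK := continuousOn_sutKernel (x := x) (r := r) m (ν (Fin.last n)) h0 hc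
  have hX := continuousOn_kerLam (x := x) (r := r) (m := m) (ν (Fin.last n)) hc (Sum.inr l)
  have hX' : ContinuousOn (fun z => kerXDer z (Sum.inr l)) (kerDom x r) :=
    (continuousOn_kerXDer _).mono fun z hz => injective_of_mem_kerDom hc hz
  have hφ := continuousOn_waveFn ν (baPoly m n) h0 hc
  have hdK : ∀ z ∈ kerDom x r, HasDerivAt
      (fun s => sutKernel m x (ν (Fin.last n)) (Function.update z (Sum.inr l) s))
      ((z (Sum.inr l))⁻¹ * (sutKernel m x (ν (Fin.last n)) z *
        kerLam m (ν (Fin.last n)) z (Sum.inr l))) (z (Sum.inr l)) := by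
    intro z hz
    have hmem := mem_closedBall_of_mem_kerDom hz (Sum.inr l)
    refine (hasLogDerivAt_sutKernel_inr m (ν (Fin.last n)) (injective_of_mem_kerDom hc hz) l
      (ne_zero_of_mem_closedBall hmem (h0 _)) (div_mem_slitPlane hmem (h0 _))).congr_deriv ?_
    simp only [Function.update_eq_self, kerLam, Sum.elim_inr]
    ring
  refine torusIntegral_waveFn_powOp l hr h0 hc (hK.mul hX)
    (hK.mul ((hX.pow 2).add (continuousOn_const.mul hX'))) hφ ?_
    (fun u hu => torusIntegral_waveFn_powOp l hr h0 hc hK (hK.mul hX) hφ hdK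
      (fun u hu => (torusIntegral_sutKernel_mul m hr h0 hc hu).symm) hu) hu
  intro z hz
  have hmem := mem_closedBall_of_mem_kerDom hz (Sum.inr l)
  have h1 := hasDerivAt_kerX (injective_of_mem_kerDom hc hz) (Sum.inr l)
    (ne_zero_of_mem_closedBall hmem (h0 _))
  refine ((hdK z hz).mul ((h1.const_mul ((m : ℂ) + 1)).const_add (ν (Fin.last n)))).congr_deriv ?_
  simp only [Function.update_eq_self, kerLam, Sum.elim_inr, kerXDer, Pi.mul_apply, Pi.add_apply,
    Pi.pow_apply]
  ring

/-- Two integrations by parts in `t_i` move the operator `(t_i ∂/∂t_i)²` from the wave function to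
the kernel. The measure `dt_i` explains why `kerLam` uses `t_i K` instead of `K`. -/
lemma torusIntegral_kerLam_eq_zero (hr : 0 < r) (h0 : ∀ i, r < ‖Complex.exp (2 * x i)‖)
    (hc : ∀ i j, i ≠ j → 2 * r < ‖Complex.exp (2 * x i) - Complex.exp (2 * x j)‖)
    {u : Fin (n + 1) → ℂ} (hu : ∀ l, u l ∈ ball (Complex.exp (2 * x l)) r) (i : Fin n)
    (W : SymPoly (Fin n) (Fin n)) :
    (∯ t in T((fun i : Fin n => Complex.exp (2 * x i.castSucc)), fun _ => r),
      sutKernel m x (ν (Fin.last n)) (Sum.elim t u) *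
        ((kerLam m (ν (Fin.last n)) (Sum.elim t u) (Sum.inl i) ^ 2 -
            (m + 1) * kerXDer (Sum.elim t u) (Sum.inl i)) *
            waveFn (fun i => x i.castSucc) (fun i => ν i.castSucc) W t -
          waveFn (fun i => x i.castSucc) (fun i => ν i.castSucc) (powOp i (powOp i W)) t)) = 0 := by
  have hmemD : ∀ t : Fin n → ℂ, (∀ i, t i ∈ sphere (Complex.exp (2 * x i.castSucc)) r) →
      Sum.elim t u ∈ kerDom x r := fun t ht => ⟨ht, hu⟩
  have hcomp : ∀ {H : (Fin n ⊕ Fin (n + 1) → ℂ) → ℂ}, ContinuousOn H (kerDom x r) →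
      ContinuousOn (fun t => H (Sum.elim t u))
        {t : Fin n → ℂ | ∀ i, t i ∈ sphere (Complex.exp (2 * x i.castSucc)) r} := by
    intro H hH
    refine hH.comp (Continuous.continuousOn (continuous_pi ?_)) hmemD
    rintro (k | k)
    · exact continuous_apply k
    · exact continuous_const
  have hK := hcomp (continuousOn_sutKernel (x := x) (r := r) m (ν (Fin.last n)) h0 hc)
  have hX := hcomp
    (continuousOn_kerLam (x := x) (r := r) (m := m) (ν (Fin.last n)) hc (Sum.inl i))
  have hX' : ContinuousOn (fun z : Fin n ⊕ Fin (n + 1) → ℂ => kerXDer z (Sum.inl i)) (kerDom x r) :=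
    (continuousOn_kerXDer _).mono fun z hz => injective_of_mem_kerDom hc hz
  rw [← circlesIntegral_fin]
  -- The primitive is `t_i K (Λ φ - θ φ)` with `θ = t_i ∂/∂t_i` and `Λ = θ (t_i K) / (t_i K)`. In
  -- its derivative the mixed terms `Λ θ φ` cancel.
  refine circlesIntegral_eq_zero_of_hasDerivAt (fun _ => hr.le) i
    (f := fun t => t i * (sutKernel m x (ν (Fin.last n)) (Sum.elim t u) *
      (kerLam m (ν (Fin.last n)) (Sum.elim t u) (Sum.inl i) *
        waveFn (fun i => x i.castSucc) (fun i => ν i.castSucc) W t -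
          waveFn (fun i => x i.castSucc) (fun i => ν i.castSucc) (powOp i W) t))) ?_ ?_
  · intro t ht
    have hz := hmemD t ht
    have hinj := injective_of_mem_kerDom hc hz
    have hmem := mem_closedBall_of_mem_kerDom hz (Sum.inl i)
    have hti : t i ≠ 0 := ne_zero_of_mem_closedBall hmem (h0 _)
    have hsl := div_mem_slitPlane hmem (h0 _)
    have tinj : Function.Injective t := fun a b hab => Sum.inl_injective (hinj hab)
    have dK : HasDerivAt _ _ _ := hasLogDerivAt_sutKernel_inl m (ν (Fin.last n)) hinj i hti hsl
    have dX := ((hasDerivAt_kerX hinj (Sum.inl i) hti).const_mul ((m : ℂ) + 1)).const_sub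
      ((m : ℂ) + 1 - ν (Fin.last n))
    have d1 := hasDerivAt_waveFn (ν := fun i => ν i.castSucc) W tinj i hti
      (x := fun i => x i.castSucc) hsl
    have d2 := hasDerivAt_waveFn (ν := fun i => ν i.castSucc) (powOp i W) tinj i hti
      (x := fun i => x i.castSucc) hsl
    simp only [Sum.update_elim_inl, Sum.elim_inl] at dK dX
    simp only [Function.update_self]
    refine ((hasDerivAt_id (t i)).mul (dK.mul ((dX.mul d1).sub d2))).congr_deriv ?_
    simp only [Function.update_eq_self, kerLam, Sum.elim_inl, kerXDer, id, Pi.mul_apply,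
      Pi.sub_apply]
    field_simp
    ring
  · refine hK.mul (ContinuousOn.sub (ContinuousOn.mul ((hX.pow 2).sub
      (continuousOn_const.mul (hcomp hX'))) ?_) ?_)
    · exact continuousOn_waveFn ν W h0 hc
    · exact continuousOn_waveFn ν _ h0 hc

/-- `kernel_identity` with `g = m + 1`. The mixed ratios in `kerXDer` agree on the two sides, and
the remaining ones turn `g²` into `g² - g = m (m + 1)`, the coupling constant. -/
lemma sum_kerLam_sq {t : Fin n → ℂ} {u : Fin (n + 1) → ℂ}
    (hz : Function.Injective (Sum.elim t u)) (κ : ℂ) :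
    ∑ l, (kerLam m κ (Sum.elim t u) (Sum.inr l) ^ 2 +
        (m + 1) * kerXDer (Sum.elim t u) (Sum.inr l)) =
      κ ^ 2 - m * (m + 1) * (∑ l, ∑ j, ptRatio u l j * ptRatio u j l) +
        (∑ i, (kerLam m κ (Sum.elim t u) (Sum.inl i) ^ 2 -
          (m + 1) * kerXDer (Sum.elim t u) (Sum.inl i)) +
          m * (m + 1) * ∑ i, ∑ j, ptRatio t i j * ptRatio t j i) := by
  have h := kernel_identity hz ((m : ℂ) + 1) κ (kerX (Sum.elim t u)) fun a => rfl
  have hu : ∀ l j, ptRatio u l j = ptRatio (Sum.elim t u) (Sum.inr l) (Sum.inr j) := by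
    intro l j; simp [ptRatio]
  have ht : ∀ l j, ptRatio t l j = ptRatio (Sum.elim t u) (Sum.inl l) (Sum.inl j) := by
    intro l j; simp [ptRatio]
  simp only [hu, ht, kerLam, Sum.elim_inr, Sum.elim_inl, kerXDer, Finset.sum_add_distrib,
    Finset.sum_sub_distrib, ← Finset.mul_sum]
  have hcomm : ∑ l, ∑ i, ptRatio (Sum.elim t u) (Sum.inr l) (Sum.inl i) *
        ptRatio (Sum.elim t u) (Sum.inl i) (Sum.inr l) =
      ∑ i, ∑ l, ptRatio (Sum.elim t u) (Sum.inl i) (Sum.inr l) *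
        ptRatio (Sum.elim t u) (Sum.inr l) (Sum.inl i) := by
    rw [Finset.sum_comm]
    exact Finset.sum_congr rfl fun i _ => Finset.sum_congr rfl fun l _ => mul_comm _ _
  linear_combination h - ((m : ℂ) + 1) * hcomm

end Step

/-- The Sutherland eigenvalue equation, in terms of the operators `u_l ∂/∂u_l`. -/
theorem sum_symEval_powOp_powOp_baPoly (m n : ℕ) (z ν : Fin n → ℂ) (hz : Function.Injective z)
    (hz0 : ∀ i, z i ≠ 0) :
    ∑ l, symEval id z ν (powOp l (powOp l (baPoly m n))) =
      (∑ l, ν l ^ 2 - m * (m + 1) * ∑ l, ∑ j, ptRatio z l j * ptRatio z j l) *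
        symEval id z ν (baPoly m n) := by
  induction n with
  | zero => simp
  | succ n ih =>
    -- Any choice of logarithms serves: the power product that depends on it is nonzero and is
    -- cancelled at the end.
    let x : Fin (n + 1) → ℂ := fun l => Complex.log (z l) / 2
    have hx : ∀ l, Complex.exp (2 * x l) = z l := fun l => by
      rw [mul_div_cancel₀ _ two_ne_zero, Complex.exp_log (hz0 l)]
    obtain ⟨r, hr, h0, hc⟩ := exists_pos_radius z hz hz0
    simp only [← hx] at h0 hc
    have hu : ∀ l, z l ∈ ball (Complex.exp (2 * x l)) r := fun l => by
      rw [hx]; exact mem_ball_self hr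
    let φ := waveFn (fun i => x i.castSucc) (fun i => ν i.castSucc)
    let K := fun t : Fin n → ℂ => sutKernel m x (ν (Fin.last n)) (Sum.elim t z)
    let E := ∑ l, ν l ^ 2 - m * (m + 1) * ∑ l, ∑ j, ptRatio z l j * ptRatio z j l
    have hmemD : ∀ t : Fin n → ℂ, (∀ i, t i ∈ sphere (Complex.exp (2 * x i.castSucc)) r) →
        Sum.elim t z ∈ kerDom x r := fun t ht => ⟨ht, hu⟩
    have hcomp : ∀ {H : (Fin n ⊕ Fin (n + 1) → ℂ) → ℂ}, ContinuousOn H (kerDom x r) →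
        ContinuousOn (fun t => H (Sum.elim t z))
          {t : Fin n → ℂ | ∀ i, t i ∈ sphere (Complex.exp (2 * x i.castSucc)) r} := by
      intro H hH
      refine hH.comp (Continuous.continuousOn (continuous_pi ?_)) hmemD
      rintro (k | k)
      · exact continuous_apply k
      · exact continuous_const
    have hK := hcomp (continuousOn_sutKernel (x := x) (r := r) m (ν (Fin.last n)) h0 hc)
    have hX := fun a => hcomp
      (continuousOn_kerLam (x := x) (r := r) (m := m) (ν (Fin.last n)) hc a)
    have hX' := fun a => hcomp (((continuousOn_kerXDer a).mono fun z hz =>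
      injective_of_mem_kerDom hc hz : ContinuousOn (fun z => kerXDer z a) (kerDom x r)))
    have hφ := fun W => continuousOn_waveFn ν W h0 hc
    have hA : (2 * Real.pi * Complex.I / (m.factorial : ℂ)) ^ n *
        (∑ l, waveFn x ν (powOp l (powOp l (baPoly m (n + 1)))) z) =
        (2 * Real.pi * Complex.I / (m.factorial : ℂ)) ^ n *
          (E * waveFn x ν (baPoly m (n + 1)) z) := by
      rw [Finset.mul_sum, mul_left_comm, ← torusIntegral_sutKernel_mul m hr h0 hc hu]
      simp only [torusIntegral_waveFn_powOp_powOp hr h0 hc hu]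
      rw [← torusIntegral_finset_sum (fun _ => hr.le), ← torusIntegral_const_mul]
      · have hB : ∑ i : Fin n, (∯ t in T((fun i : Fin n => Complex.exp (2 * x i.castSucc)),
            fun _ => r), K t * ((kerLam m (ν (Fin.last n)) (Sum.elim t z) (Sum.inl i) ^ 2 -
              (m + 1) * kerXDer (Sum.elim t z) (Sum.inl i)) * φ (baPoly m n) t -
                φ (powOp i (powOp i (baPoly m n))) t)) = 0 :=
          Finset.sum_eq_zero fun i _ => torusIntegral_kerLam_eq_zero hr h0 hc hu i _
        have hcont : ∀ i : Fin n, ContinuousOn (fun t =>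
            K t * ((kerLam m (ν (Fin.last n)) (Sum.elim t z) (Sum.inl i) ^ 2 -
              (m + 1) * kerXDer (Sum.elim t z) (Sum.inl i)) * φ (baPoly m n) t -
                φ (powOp i (powOp i (baPoly m n))) t))
            {t | ∀ i : Fin n, t i ∈ sphere (Complex.exp (2 * x i.castSucc)) r} := fun i =>
          hK.mul (((((hX _).pow 2).sub (continuousOn_const.mul (hX' _))).mul (hφ _)).sub (hφ _))
        rw [← torusIntegral_finset_sum (fun _ => hr.le) _ fun i _ => hcont i] at hB
        have hint : ContinuousOn (fun t => E * (K t * φ (baPoly m n) t))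
            {t | ∀ i : Fin n, t i ∈ sphere (Complex.exp (2 * x i.castSucc)) r} :=
          continuousOn_const.mul (hK.mul (hφ _))
        refine Eq.trans ?_ ((congrArg _ hB).trans (add_zero (∯ t in T((fun i : Fin n =>
          Complex.exp (2 * x i.castSucc)), fun _ => r), E * (K t * φ (baPoly m n) t))))
        rw [← torusIntegral_add (torusIntegrable_of_continuousOn (fun _ => hr.le) hint)
          (torusIntegrable_of_continuousOn (fun _ => hr.le)
            (continuousOn_finsetSum _ fun i _ => hcont i))]
        refine torusIntegral_congr (fun _ => hr.le) fun t ht => ?_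
        have hinj := injective_of_mem_kerDom hc (hmemD t ht)
        have tinj : Function.Injective t := fun a b hab => Sum.inl_injective (hinj hab)
        have hIH' : ∑ i, φ (powOp i (powOp i (baPoly m n))) t = (∑ l : Fin n, ν l.castSucc ^ 2 -
            m * (m + 1) * ∑ l, ∑ j, ptRatio t l j * ptRatio t j l) * φ (baPoly m n) t := by
          simp only [φ, waveFn, ← Finset.mul_sum]
          rw [ih t (fun i => ν i.castSucc) tinj fun i =>
            ne_zero_of_mem_closedBall (sphere_subset_closedBall (ht i)) (h0 _)]
          ring
        have hS := sum_kerLam_sq (m := m) hinj (ν (Fin.last n))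
        have hE : E = ∑ l : Fin n, ν l.castSucc ^ 2 + ν (Fin.last n) ^ 2 -
            m * (m + 1) * ∑ l, ∑ j, ptRatio z l j * ptRatio z j l := by
          simp only [E, Fin.sum_univ_castSucc (f := fun l => ν l ^ 2)]
        rw [← Finset.sum_mul, ← Finset.mul_sum, ← Finset.mul_sum, Finset.sum_sub_distrib,
          ← Finset.sum_mul, hS, hIH', hE]
        ring
      · intro l _
        exact (hK.mul (((hX _).pow 2).add (continuousOn_const.mul (hX' _)))).mul (hφ _)
    have hC : (2 * Real.pi * Complex.I / (m.factorial : ℂ)) ^ n ≠ 0 :=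
      pow_ne_zero _ (div_ne_zero Complex.two_pi_I_ne_zero
        (Nat.cast_ne_zero.mpr m.factorial_ne_zero))
    have hP : powProd x z ν ≠ 0 := Finset.prod_ne_zero_iff.mpr fun i _ => Complex.exp_ne_zero _
    have := mul_left_cancel₀ hC hA
    simp only [waveFn, ← Finset.mul_sum] at this
    rw [mul_left_comm] at this
    exact mul_left_cancel₀ hP this

end SutherlandEquation


/-! ### The poles on the walls have order at most `m`. -/

section Poles

open MvPolynomial

variable {n : ℕ}

/-- The polynomial `∏_{i<j} (X_i - X_j)` in the point variables. -/
noncomputable def vandPoly (n : ℕ) : MvPolynomial (Fin n ⊕ Fin n) ℂ :=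
  ∏ i, ∏ j ∈ Finset.Ioi i, (X (Sum.inl i) - X (Sum.inl j))

lemma eval_vandPoly (z ν : Fin n → ℂ) : eval (Sum.elim z ν) (vandPoly n) = vandA z := by
  simp [vandPoly, vandA, map_prod]

lemma X_sub_X_dvd_vandPoly {a b : Fin n} (h : a ≠ b) :
    (X (Sum.inl a) - X (Sum.inl b) : MvPolynomial (Fin n ⊕ Fin n) ℂ) ∣ vandPoly n := by
  have key : ∀ {a b : Fin n}, a < b →
      (X (Sum.inl a) - X (Sum.inl b) : MvPolynomial (Fin n ⊕ Fin n) ℂ) ∣ vandPoly n := by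
    intro a b h
    exact (Finset.dvd_prod_of_mem (fun j => (X (Sum.inl a) - X (Sum.inl j) :
      MvPolynomial (Fin n ⊕ Fin n) ℂ)) (Finset.mem_Ioi.mpr h)).trans
        (Finset.dvd_prod_of_mem (fun i => ∏ j ∈ Finset.Ioi i, (X (Sum.inl i) - X (Sum.inl j) :
          MvPolynomial (Fin n ⊕ Fin n) ℂ)) (Finset.mem_univ a))
  rcases lt_or_gt_of_ne h with h | h
  · exact key h
  · rw [← neg_sub, neg_dvd]
    exact key h

/-- Functions which become polynomials after multiplication by a power of `A(z)`. -/
def HasPolarForm (f : (Fin n → ℂ) → (Fin n → ℂ) → ℂ) : Prop :=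
  ∃ (N : ℕ) (Q : MvPolynomial (Fin n ⊕ Fin n) ℂ), ∀ z ν, Function.Injective z →
    f z ν * vandA z ^ N = eval (Sum.elim z ν) Q

lemma HasPolarForm.add {f g : (Fin n → ℂ) → (Fin n → ℂ) → ℂ} (hf : HasPolarForm f)
    (hg : HasPolarForm g) : HasPolarForm fun z ν => f z ν + g z ν := by
  obtain ⟨N, Q, hQ⟩ := hf
  obtain ⟨M, R, hR⟩ := hg
  refine ⟨N + M, Q * vandPoly n ^ M + R * vandPoly n ^ N, fun z ν hz => ?_⟩
  simp only [map_add, map_mul, map_pow, eval_vandPoly, ← hQ z ν hz, ← hR z ν hz]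
  ring

lemma HasPolarForm.mul {f g : (Fin n → ℂ) → (Fin n → ℂ) → ℂ} (hf : HasPolarForm f)
    (hg : HasPolarForm g) : HasPolarForm fun z ν => f z ν * g z ν := by
  obtain ⟨N, Q, hQ⟩ := hf
  obtain ⟨M, R, hR⟩ := hg
  refine ⟨N + M, Q * R, fun z ν hz => ?_⟩
  simp only [map_mul, ← hQ z ν hz, ← hR z ν hz]
  ring

lemma hasPolarForm_symVal (p : Fin n × Fin n) : HasPolarForm fun z _ => symVal id z p := by
  by_cases h : p.1 = p.2
  · exact ⟨0, 0, fun z ν _ => by simp [symVal, h]⟩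
  · obtain ⟨c, hc⟩ := X_sub_X_dvd_vandPoly h
    refine ⟨1, X (Sum.inl p.1) * c, fun z ν hz => ?_⟩
    have h1 := sub_ne_zero.mpr (hz.ne h)
    rw [← eval_vandPoly z ν, hc]
    simp only [symVal, id, if_neg h, map_mul, map_sub, eval_X, Sum.elim_inl, pow_one]
    field_simp

/-- Every symbol has a simple pole on one wall, so some power of `A(z)` clears all denominators. The
exponent found here is crude and is reduced afterwards. -/
lemma hasPolarForm_symEval (W : SymPoly (Fin n) (Fin n)) :
    HasPolarForm fun z ν => symEval id z ν W := by
  simp only [symEval, coe_eval₂Hom]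
  induction W using MvPolynomial.induction_on with
  | C c =>
    simp only [eval₂_C]
    induction c using MvPolynomial.induction_on with
    | C r => exact ⟨0, C r, fun z ν _ => by simp⟩
    | add p q hp hq => simpa only [map_add] using hp.add hq
    | mul_X p i hp => simpa only [map_mul, eval_X] using hp.mul (hasPolarForm_symVal i)
  | add p q hp hq => simpa only [eval₂_add] using hp.add hq
  | mul_X p i hp =>
    simp only [eval₂_mul, eval₂_X]
    exact hp.mul ⟨0, X (Sum.inr i), fun z ν _ => by simp⟩

lemma hasDerivAt_eval_elim (z ν : Fin n → ℂ) (l : Fin n) (Q : MvPolynomial (Fin n ⊕ Fin n) ℂ) :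
    HasDerivAt (fun s => eval (Sum.elim (Function.update z l s) ν) Q)
      (eval (Sum.elim z ν) (pderiv (Sum.inl l) Q)) (z l) := by
  induction Q using MvPolynomial.induction_on with
  | C r =>
    simp only [eval_C, pderiv_C, map_zero]
    exact hasDerivAt_const (z l) r
  | add p q hp hq =>
    simp only [map_add]
    exact hp.add hq
  | mul_X p i hp =>
    have hX : HasDerivAt (fun s => eval (Sum.elim (Function.update z l s) ν) (X i))
        (eval (Sum.elim z ν) (pderiv (Sum.inl l) (X i))) (z l) := by
      simp only [eval_X]
      rcases i with i | i
      · by_cases h : i = l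
        · subst h
          simpa using hasDerivAt_id' (z i)
        · simpa [h, Function.update_of_ne h, pderiv_X, Pi.single_apply] using
            hasDerivAt_const (z l) (z i)
      · simpa using hasDerivAt_const (z l) (ν i)
    have := hp.mul hX
    simp only [Function.update_eq_self] at this
    simp only [map_mul, Derivation.leibniz, map_add, smul_eq_mul]
    refine this.congr_deriv ?_
    ring

/-- The operator `z_l ∂/∂z_l + ν_l` on polynomials. -/
noncomputable def polyOp (l : Fin n) (Q : MvPolynomial (Fin n ⊕ Fin n) ℂ) :
    MvPolynomial (Fin n ⊕ Fin n) ℂ :=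
  X (Sum.inl l) * pderiv (Sum.inl l) Q + X (Sum.inr l) * Q

lemma injective_update_eventually {z : Fin n → ℂ} (hz : Function.Injective z) (l : Fin n) :
    ∀ᶠ s in nhds (z l), Function.Injective (Function.update z l s) := by
  have h : ∀ᶠ s in nhds (z l), ∀ j, j ≠ l → s ≠ z j :=
    Filter.eventually_all.mpr fun j => by
      by_cases hj : j = l
      · simp [hj]
      · filter_upwards [isOpen_ne.mem_nhds (hz.ne (Ne.symm hj))] with s hs _ using hs
  filter_upwards [h] with s hs
  intro a b hab
  by_cases ha : a = l <;> by_cases hb : b = l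
  · rw [ha, hb]
  · subst ha
    rw [Function.update_self, Function.update_of_ne hb] at hab
    exact absurd hab (hs b hb)
  · subst hb
    rw [Function.update_self, Function.update_of_ne ha] at hab
    exact absurd hab.symm (hs a ha)
  · rw [Function.update_of_ne ha, Function.update_of_ne hb] at hab
    exact hz hab

/-- Differentiate `W A^N = G`. The term in `N` comes from the logarithmic derivative of `A`, and
`ν_l` from the conjugation by powers in `powOp`. -/
lemma symEval_powOp_mul_vandA_pow {z ν : Fin n → ℂ} (hz : Function.Injective z) (l : Fin n)
    (h0 : z l ≠ 0) {N : ℕ} {W : SymPoly (Fin n) (Fin n)} {G : (Fin n → ℂ) → ℂ} {g' : ℂ}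
    (h : ∀ z, Function.Injective z → z l ≠ 0 → symEval id z ν W * vandA z ^ N = G z)
    (hG : HasDerivAt (fun s => G (Function.update z l s)) ((z l)⁻¹ * g') (z l)) :
    symEval id z ν (powOp l W) * vandA z ^ N =
      g' + (ν l - N * ∑ j, ptRatio z l j) * G z := by
  have h1 := hasDerivAt_symEval id z (fun a b h e => h (hz e)) l h0 ν W
  have h2 : HasDerivAt _ _ _ := (hasLogDerivAt_vandA hz l).pow N
  have h3 := (h1.mul h2).congr_of_eventuallyEq (f₁ := fun s => G (Function.update z l s)) (by
    filter_upwards [injective_update_eventually hz l, isOpen_ne.mem_nhds h0] with s hs hs0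
    exact (h _ hs (by rwa [Function.update_self])).symm)
  have h4 := hG.unique h3
  simp only [Function.update_eq_self] at h4
  have h5 : (z l)⁻¹ * ∑ j, ptRatio z l j = ∑ j, if j = l then 0 else (z l - z j)⁻¹ := by
    simp only [Finset.mul_sum, ptRatio_of_ne_zero h0, eq_comm]
  rw [← h5] at h4
  rw [powOp, map_add, map_mul, show symEval id z ν (X l) = ν l by simp [symEval], ← h z hz h0]
  refine mul_left_cancel₀ (inv_ne_zero h0) ?_
  linear_combination -h4

/-- The eigenvalue equation rewritten for the numerator `Q = W A^N`, with the singular behaviour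
collected in the ratios. -/
lemma sum_polar_eq (m n : ℕ) {N : ℕ} {Q : MvPolynomial (Fin n ⊕ Fin n) ℂ} (ν : Fin n → ℂ)
    (hQ : ∀ z ν, Function.Injective z →
      symEval id z ν (baPoly m n) * vandA z ^ N = eval (Sum.elim z ν) Q)
    {z : Fin n → ℂ} (hz : Function.Injective z) (h0 : ∀ i, z i ≠ 0) :
    ∑ l, (eval (Sum.elim z ν) (polyOp l (polyOp l Q)) -
        2 * N * (∑ j, ptRatio z l j) * eval (Sum.elim z ν) (polyOp l Q) -
        N * (∑ j, ptRatio z l j * ptRatio z j l) * eval (Sum.elim z ν) Q +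
        N ^ 2 * (∑ j, ptRatio z l j) ^ 2 * eval (Sum.elim z ν) Q) =
      (∑ l, ν l ^ 2 - m * (m + 1) * ∑ l, ∑ j, ptRatio z l j * ptRatio z j l) *
        eval (Sum.elim z ν) Q := by
  have hop : ∀ (R : MvPolynomial (Fin n ⊕ Fin n) ℂ) (l : Fin n), eval (Sum.elim z ν) (polyOp l R) =
      z l * eval (Sum.elim z ν) (pderiv (Sum.inl l) R) + ν l * eval (Sum.elim z ν) R := by
    intro R l
    simp [polyOp]
  have h2 : ∀ l, symEval id z ν (powOp l (powOp l (baPoly m n))) * vandA z ^ N =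
      eval (Sum.elim z ν) (polyOp l (polyOp l Q)) -
        2 * N * (∑ j, ptRatio z l j) * eval (Sum.elim z ν) (polyOp l Q) -
        N * (∑ j, ptRatio z l j * ptRatio z j l) * eval (Sum.elim z ν) Q +
        N ^ 2 * (∑ j, ptRatio z l j) ^ 2 * eval (Sum.elim z ν) Q := by
    intro l
    have h1 : ∀ z, Function.Injective z → z l ≠ 0 →
        symEval id z ν (powOp l (baPoly m n)) * vandA z ^ N =
        eval (Sum.elim z ν) (polyOp l Q) - N * (∑ j, ptRatio z l j) * eval (Sum.elim z ν) Q := by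
      intro z hz h0
      rw [symEval_powOp_mul_vandA_pow hz l h0 (fun z hz _ => hQ z ν hz)
        ((hasDerivAt_eval_elim z ν l Q).congr_deriv (inv_mul_cancel_left₀ h0 _).symm)]
      simp only [polyOp, map_add, map_mul, eval_X, Sum.elim_inl, Sum.elim_inr]
      ring
    have hα : HasDerivAt (fun s => ∑ j, ptRatio (Function.update z l s) l j)
        ((z l)⁻¹ * ∑ j, ptRatio z l j * ptRatio z j l) (z l) := by
      rw [Finset.mul_sum]
      exact HasDerivAt.fun_sum fun j _ => hasDerivAt_ptRatio hz l j (h0 l)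
    rw [symEval_powOp_mul_vandA_pow hz l (h0 l) h1 (g' :=
      z l * eval (Sum.elim z ν) (pderiv (Sum.inl l) (polyOp l Q)) -
        N * ((∑ j, ptRatio z l j * ptRatio z j l) * eval (Sum.elim z ν) Q +
          (∑ j, ptRatio z l j) * (z l * eval (Sum.elim z ν) (pderiv (Sum.inl l) Q)))), hop (polyOp l Q),
      hop Q]
    · ring
    · refine ((hasDerivAt_eval_elim z ν l (polyOp l Q)).sub ((hα.const_mul (N : ℂ)).mul
        (hasDerivAt_eval_elim z ν l Q))).congr_deriv ?_
      have := h0 l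
      simp only [Function.update_eq_self]
      field_simp
  rw [← Finset.sum_congr rfl fun l _ => h2 l, ← Finset.sum_mul,
    sum_symEval_powOp_powOp_baPoly m n z ν hz h0, mul_assoc, hQ z ν hz]

/-- The limit of `ε z_l / (z_l - z_j)` as `z_a = w + ε` tends to `z_b = w`. -/
noncomputable def wallCoef (a b : Fin n) (w : ℂ) (l j : Fin n) : ℂ :=
  w * ((if l = a then 1 else 0) * (if j = b then 1 else 0) -
    (if l = b then 1 else 0) * (if j = a then 1 else 0))

/-- Only the ratios of the pairs `(a, b)` and `(b, a)` blow up at a point where `z_a = z_b` is the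
sole coincidence; the others are killed by the factor `s - z_a`. -/
lemma tendsto_mul_ptRatio {a b : Fin n} (hab : a ≠ b) {z : Fin n → ℂ} (hz : z a = z b)
    (hne : ∀ i j, i ≠ j → z i = z j → (i = a ∧ j = b) ∨ (i = b ∧ j = a)) (l j : Fin n) :
    Filter.Tendsto (fun s => (s - z a) * ptRatio (Function.update z a s) l j)
      (nhdsWithin (z a) {z a}ᶜ) (nhds (wallCoef a b (z a) l j)) := by
  have hid : Filter.Tendsto (fun s : ℂ => s) (nhdsWithin (z a) {z a}ᶜ) (nhds (z a)) :=
    Filter.tendsto_id.mono_left nhdsWithin_le_nhds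
  by_cases h1 : l = a ∧ j = b
  · obtain ⟨rfl, rfl⟩ := h1
    have : wallCoef l j (z l) l j = z l := by simp [wallCoef, hab]
    rw [this]
    refine hid.congr' ?_
    filter_upwards [self_mem_nhdsWithin] with s hs
    have hs' : s - z l ≠ 0 := sub_ne_zero.mpr hs
    rw [ptRatio, if_neg hab, Function.update_self, Function.update_of_ne hab.symm, ← hz]
    field_simp
  by_cases h2 : l = b ∧ j = a
  · obtain ⟨rfl, rfl⟩ := h2
    have : wallCoef j l (z j) l j = -z j := by simp [wallCoef, hab.symm]
    rw [this]
    refine tendsto_const_nhds.congr' ?_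
    filter_upwards [self_mem_nhdsWithin] with s hs
    have hs' : s - z j ≠ 0 := sub_ne_zero.mpr hs
    have hs'' : z j - s ≠ 0 := sub_ne_zero.mpr (Ne.symm hs)
    rw [ptRatio, if_neg hab.symm, Function.update_self, Function.update_of_ne hab.symm, ← hz]
    field_simp
    ring
  have h3 : wallCoef a b (z a) l j = 0 := by
    simp only [wallCoef]
    split_ifs <;> simp_all
  rw [h3]
  by_cases hlj : l = j
  · simp [ptRatio, hlj]
  have hzlj : z l ≠ z j := fun h => (hne l j hlj h).elim h1 h2
  have hup : ∀ k, Filter.Tendsto (fun s => Function.update z a s k)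
      (nhdsWithin (z a) {z a}ᶜ) (nhds (z k)) := by
    intro k
    by_cases hk : k = a
    · subst hk
      simp only [Function.update_self]
      exact hid
    · simp only [Function.update_of_ne hk]
      exact tendsto_const_nhds
  have h4 := (hid.sub_const (z a)).mul ((hup l).div ((hup l).sub (hup j)) (sub_ne_zero.mpr hzlj))
  rw [sub_self, zero_mul] at h4
  simp only [ptRatio, if_neg hlj]
  exact h4

/-- The indicial equation. Multiply `sum_polar_eq` by `(s - z_a)²` and approach the wall: only the
double poles survive, and they force `N (N + 1) = m (m + 1)` unless `Q` vanishes. -/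
lemma eval_eq_zero_of_wall (m n : ℕ) {N : ℕ} (hN : m < N) {Q : MvPolynomial (Fin n ⊕ Fin n) ℂ}
    (hQ : ∀ z ν, Function.Injective z →
      symEval id z ν (baPoly m n) * vandA z ^ N = eval (Sum.elim z ν) Q)
    {a b : Fin n} (hab : a ≠ b) {z : Fin n → ℂ} (ν : Fin n → ℂ) (hz : z a = z b)
    (h0 : ∀ i, z i ≠ 0)
    (hne : ∀ i j, i ≠ j → z i = z j → (i = a ∧ j = b) ∨ (i = b ∧ j = a)) :
    eval (Sum.elim z ν) Q = 0 := by
  have hid : Filter.Tendsto (fun s : ℂ => s - z a) (nhdsWithin (z a) {z a}ᶜ) (nhds 0) := by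
    rw [← sub_self (z a)]
    exact (Filter.tendsto_id.mono_left nhdsWithin_le_nhds).sub_const _
  have hev : ∀ R : MvPolynomial (Fin n ⊕ Fin n) ℂ, Filter.Tendsto
      (fun s => eval (Sum.elim (Function.update z a s) ν) R) (nhdsWithin (z a) {z a}ᶜ)
      (nhds (eval (Sum.elim z ν) R)) := by
    intro R
    have := (hasDerivAt_eval_elim z ν a R).continuousAt.tendsto
    rw [Function.update_eq_self] at this
    exact this.mono_left nhdsWithin_le_nhds
  have hp := tendsto_mul_ptRatio hab hz hne
  have hα : ∀ l, Filter.Tendsto (fun s => (s - z a) * ∑ j, ptRatio (Function.update z a s) l j)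
      (nhdsWithin (z a) {z a}ᶜ) (nhds (∑ j, wallCoef a b (z a) l j)) := by
    intro l
    simp only [Finset.mul_sum]
    exact tendsto_finsetSum _ fun j _ => hp l j
  have hβ : ∀ l, Filter.Tendsto (fun s => ∑ j, ((s - z a) * ptRatio (Function.update z a s) l j) *
      ((s - z a) * ptRatio (Function.update z a s) j l))
      (nhdsWithin (z a) {z a}ᶜ)
      (nhds (∑ j, wallCoef a b (z a) l j * wallCoef a b (z a) j l)) := fun l =>
    tendsto_finsetSum _ fun j _ => (hp l j).mul (hp j l)
  -- Of the two factors `s - z_a`, each is absorbed by one ratio; the terms with fewer than two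
  -- ratios tend to 0.
  have hL := tendsto_finsetSum (Finset.univ : Finset (Fin n)) fun l _ =>
    (((((hid.pow 2).mul (hev (polyOp l (polyOp l Q)))).sub
      (((hid.const_mul (2 * (N : ℂ))).mul (hα l)).mul (hev (polyOp l Q)))).sub
      (((hβ l).const_mul (N : ℂ)).mul (hev Q))).add
      ((((hα l).pow 2).const_mul ((N : ℂ) ^ 2)).mul (hev Q)))
  have hR := (((hid.pow 2).mul_const (∑ l, ν l ^ 2)).sub
    ((tendsto_finsetSum (Finset.univ : Finset (Fin n)) fun l _ => hβ l).const_mul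
      ((m : ℂ) * (m + 1)))).mul (hev Q)
  have hinj : ∀ᶠ s in nhdsWithin (z a) {z a}ᶜ, Function.Injective (Function.update z a s) ∧
      ∀ i, Function.update z a s i ≠ 0 := by
    have h1 : ∀ᶠ s in nhds (z a), s ≠ 0 := isOpen_ne.mem_nhds (h0 a)
    have h2 : ∀ᶠ s in nhds (z a), ∀ j, j ≠ a → j ≠ b → s ≠ z j :=
      Filter.eventually_all.mpr fun j => by
        by_cases hj : j = a
        · simp [hj]
        by_cases hjb : j = b
        · simp [hjb]
        have : z a ≠ z j := fun h => by
          rcases hne a j (Ne.symm hj) h with h | h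
          · exact hjb h.2
          · exact hab h.1
        filter_upwards [isOpen_ne.mem_nhds this] with s hs _ _ using hs
    filter_upwards [h1.filter_mono nhdsWithin_le_nhds, h2.filter_mono nhdsWithin_le_nhds,
      self_mem_nhdsWithin] with s hs1 hs2 hs3
    have hs4 : ∀ j, j ≠ a → s ≠ z j := by
      intro j hj
      by_cases hjb : j = b
      · rw [hjb, ← hz]
        exact hs3
      · exact hs2 j hj hjb
    refine ⟨?_, fun i => ?_⟩
    · intro i j hij
      by_cases hi : i = a <;> by_cases hj : j = a
      · rw [hi, hj]
      · subst hi
        rw [Function.update_self, Function.update_of_ne hj] at hij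
        exact absurd hij (hs4 j hj)
      · subst hj
        rw [Function.update_self, Function.update_of_ne hi] at hij
        exact absurd hij.symm (hs4 i hi)
      · rw [Function.update_of_ne hi, Function.update_of_ne hj] at hij
        by_contra hne'
        rcases hne i j hne' hij with h | h
        · exact hi h.1
        · exact hj h.2
    · by_cases hi : i = a
      · subst hi
        rwa [Function.update_self]
      · rw [Function.update_of_ne hi]
        exact h0 i
  have hlim := tendsto_nhds_unique_of_eventuallyEq hL hR (by
    filter_upwards [hinj] with s hs
    have h1 := sum_polar_eq m n ν hQ hs.1 hs.2
    have h2 : ∀ l, ∑ j, ((s - z a) * ptRatio (Function.update z a s) l j) *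
        ((s - z a) * ptRatio (Function.update z a s) j l) = (s - z a) ^ 2 *
          ∑ j, ptRatio (Function.update z a s) l j * ptRatio (Function.update z a s) j l := by
      intro l
      rw [Finset.mul_sum]
      exact Finset.sum_congr rfl fun j _ => by ring
    simp only [h2, ← Finset.mul_sum]
    have h3 := congrArg ((s - z a) ^ 2 * ·) h1
    simp only [Finset.mul_sum (a := (s - z a) ^ 2) (s := Finset.univ)] at h3
    refine Eq.trans (Finset.sum_congr rfl fun l _ => ?_) (h3.trans ?_)
    · ring
    · ring)
  have e1 : ∀ l, ∑ j, wallCoef a b (z a) l j =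
      z a * ((if l = a then 1 else 0) - if l = b then 1 else 0) := by
    intro l
    simp only [wallCoef, ← Finset.mul_sum, Finset.sum_sub_distrib, Finset.sum_ite_eq',
      Finset.mem_univ, if_true, mul_one]
  have hsq : ∀ i j : Fin n, (if i = j then (1 : ℂ) else 0) ^ 2 = if i = j then 1 else 0 := by
    intro i j
    split_ifs <;> norm_num
  have hmul : ∀ i : Fin n, (if i = a then (1 : ℂ) else 0) * (if i = b then 1 else 0) = 0 := by
    intro i
    by_cases hi : i = a
    · rw [if_neg (fun h : i = b => hab (hi.symm.trans h)), mul_zero]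
    · rw [if_neg hi, zero_mul]
  have e2 : ∀ l j, wallCoef a b (z a) l j * wallCoef a b (z a) j l =
      -(z a ^ 2) * ((if l = a then 1 else 0) * (if j = b then 1 else 0) +
        (if l = b then 1 else 0) * (if j = a then 1 else 0)) := by
    intro l j
    simp only [wallCoef]
    have h1 := hmul l
    have h2 := hsq l a
    have h3 := hsq l b
    have h4 := hsq j a
    have h5 := hsq j b
    generalize (if l = a then (1 : ℂ) else 0) = A at *
    generalize (if l = b then (1 : ℂ) else 0) = B at *
    generalize (if j = a then (1 : ℂ) else 0) = C at *
    generalize (if j = b then (1 : ℂ) else 0) = D at *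
    linear_combination -(z a ^ 2) * (D ^ 2 * h2 + A * h5 + C ^ 2 * h3 + B * h4 - 2 * C * D * h1)
  have e3 : ∀ l, ∑ j, wallCoef a b (z a) l j * wallCoef a b (z a) j l =
      -(z a ^ 2) * ((if l = a then 1 else 0) + if l = b then 1 else 0) := by
    intro l
    simp only [e2, ← Finset.mul_sum, Finset.sum_add_distrib, Finset.sum_ite_eq',
      Finset.mem_univ, if_true, mul_one]
  have e4 : ∀ l, ((if l = a then (1 : ℂ) else 0) - if l = b then 1 else 0) ^ 2 =
      (if l = a then 1 else 0) + if l = b then 1 else 0 := by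
    intro l
    linear_combination hsq l a + hsq l b - 2 * hmul l
  have e5 : ∑ l : Fin n, ((if l = a then (1 : ℂ) else 0) + if l = b then 1 else 0) = 2 := by
    simp only [Finset.sum_add_distrib, Finset.sum_ite_eq', Finset.mem_univ, if_true]
    norm_num
  simp only [e1, e3, mul_pow, e4] at hlim
  -- The weights sum to 2 because `l` contributes only for `l = a` and `l = b`.
  have hfin : (2 * z a ^ 2 * ((N : ℂ) * (N + 1) - m * (m + 1))) * eval (Sum.elim z ν) Q = 0 := by
    have h5 : ∑ l : Fin n, ((0 : ℂ) ^ 2 * eval (Sum.elim z ν) (polyOp l (polyOp l Q)) -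
        2 * N * 0 * (z a * ((if l = a then 1 else 0) - if l = b then 1 else 0)) *
          eval (Sum.elim z ν) (polyOp l Q) -
        N * (-(z a ^ 2) * ((if l = a then 1 else 0) + if l = b then 1 else 0)) *
          eval (Sum.elim z ν) Q +
        N ^ 2 * (z a ^ 2 * ((if l = a then 1 else 0) + if l = b then 1 else 0)) *
          eval (Sum.elim z ν) Q) = (N * z a ^ 2 + N ^ 2 * z a ^ 2) * eval (Sum.elim z ν) Q *
            ∑ l : Fin n, ((if l = a then (1 : ℂ) else 0) + if l = b then 1 else 0) := by
      rw [Finset.mul_sum]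
      exact Finset.sum_congr rfl fun l _ => by ring
    rw [h5, ← Finset.mul_sum, e5] at hlim
    linear_combination hlim
  refine (mul_eq_zero.mp hfin).resolve_left (mul_ne_zero (mul_ne_zero two_ne_zero
    (pow_ne_zero _ (h0 a))) (sub_ne_zero.mpr ?_))
  exact_mod_cast (Nat.mul_lt_mul'' hN (Nat.succ_lt_succ hN)).ne'

/-- The substitution `z_a := z_b`. -/
noncomputable def wallHom (a b : Fin n) :
    MvPolynomial (Fin n ⊕ Fin n) ℂ →ₐ[ℂ] MvPolynomial (Fin n ⊕ Fin n) ℂ :=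
  aeval (Function.update X (Sum.inl a) (X (Sum.inl b)))

/-- Modulo `X_a - X_b` the substitution is the identity, so its kernel lies in the ideal generated
by this difference. -/
lemma dvd_of_wallHom_eq_zero {a b : Fin n} {Q : MvPolynomial (Fin n ⊕ Fin n) ℂ}
    (h : wallHom a b Q = 0) : (X (Sum.inl a) - X (Sum.inl b)) ∣ Q := by
  rw [← Ideal.mem_span_singleton, ← Ideal.Quotient.eq_zero_iff_mem]
  have hcomp : ((Ideal.Quotient.mkₐ ℂ (Ideal.span {X (Sum.inl a) - X (Sum.inl b)})).comp
      (wallHom a b)) = Ideal.Quotient.mkₐ ℂ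
        (Ideal.span {(X (Sum.inl a) - X (Sum.inl b) : MvPolynomial (Fin n ⊕ Fin n) ℂ)}) := by
    refine MvPolynomial.algHom_ext fun i => ?_
    simp only [AlgHom.comp_apply, wallHom, aeval_X, Ideal.Quotient.mkₐ_eq_mk]
    by_cases hi : i = Sum.inl a
    · subst hi
      rw [Function.update_self, eq_comm, Ideal.Quotient.eq]
      exact Ideal.mem_span_singleton_self _
    · rw [Function.update_of_ne hi]
  have := DFunLike.congr_fun hcomp Q
  rw [AlgHom.comp_apply, h, map_zero] at this
  exact this.symm

lemma wallHom_X_sub_X_ne_zero {a b i j : Fin n} (hab : a < b) (hij : i < j)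
    (h : (i, j) ≠ (a, b)) :
    wallHom a b (X (Sum.inl i) - X (Sum.inl j)) ≠ 0 := by
  have hX : ∀ k : Fin n, wallHom a b (X (Sum.inl k)) = X (Sum.inl (if k = a then b else k)) := by
    intro k
    simp only [wallHom, aeval_X]
    by_cases hk : k = a
    · subst hk; simp
    · simp [hk]
  rw [map_sub, hX, hX, sub_ne_zero]
  intro h2
  have h3 := Sum.inl_injective (X_injective h2)
  by_cases hi : i = a
  · subst hi
    rw [if_pos rfl, if_neg hij.ne'] at h3
    exact h (by rw [h3])
  · by_cases hj : j = a
    · subst hj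
      rw [if_neg hi, if_pos rfl] at h3
      exact absurd (hij.trans hab) (by simp [h3])
    · rw [if_neg hi, if_neg hj] at h3
      exact hij.ne h3

lemma vandPoly_eq_prod_pairs : vandPoly n =
    ∏ p ∈ (Finset.univ : Finset (Fin n × Fin n)).filter (fun p => p.1 < p.2),
      (X (Sum.inl p.1) - X (Sum.inl p.2)) := by
  rw [vandPoly, prod_pairs_eq_ite, Finset.prod_filter, ← Finset.univ_product_univ,
    Finset.prod_product]

/-- One factor at a time: the factors already extracted stay nonzero on the wall of the next pair,
so in a domain the cofactor vanishes there. -/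
lemma prod_pairs_dvd {Q : MvPolynomial (Fin n ⊕ Fin n) ℂ}
    (h : ∀ a b : Fin n, a < b → wallHom a b Q = 0) (s : Finset (Fin n × Fin n))
    (hs : ∀ p ∈ s, p.1 < p.2) :
    (∏ p ∈ s, (X (Sum.inl p.1) - X (Sum.inl p.2) : MvPolynomial (Fin n ⊕ Fin n) ℂ)) ∣ Q := by
  induction s using Finset.induction_on with
  | empty => simp
  | insert p s hp ih =>
    obtain ⟨G, hG⟩ := ih fun q hq => hs q (Finset.mem_insert_of_mem hq)
    have hlt := hs p (Finset.mem_insert_self p s)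
    have h1 := h _ _ hlt
    rw [hG, map_mul, map_prod] at h1
    have h2 := (mul_eq_zero.mp h1).resolve_left (Finset.prod_ne_zero_iff.mpr fun q hq =>
      wallHom_X_sub_X_ne_zero hlt (hs q (Finset.mem_insert_of_mem hq)) fun e => hp (by
        rwa [← show q = p from e]))
    obtain ⟨c, hc⟩ := dvd_of_wallHom_eq_zero h2
    refine ⟨c, ?_⟩
    rw [Finset.prod_insert hp, hG, hc]
    ring

/-- A numerator with excess pole order vanishes at generic points of every wall, hence on the whole
wall, and is divisible by all the differences. -/
lemma vandPoly_dvd (m n : ℕ) {N : ℕ} (hN : m < N) {Q : MvPolynomial (Fin n ⊕ Fin n) ℂ}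
    (hQ : ∀ z ν, Function.Injective z →
      symEval id z ν (baPoly m n) * vandA z ^ N = eval (Sum.elim z ν) Q) :
    vandPoly n ∣ Q := by
  rw [vandPoly_eq_prod_pairs]
  refine prod_pairs_dvd (fun a b hab => ?_) _ fun p hp => (Finset.mem_filter.mp hp).2
  -- `F` vanishes at the nongeneric points of the wall, where another pair coincides or a coordinate
  -- is 0. Thus `F Q` vanishes on the entire wall, and `F` itself does not vanish identically there.
  let F : MvPolynomial (Fin n ⊕ Fin n) ℂ :=
    (∏ p ∈ ((Finset.univ : Finset (Fin n × Fin n)).filter (fun p => p.1 < p.2)).erase (a, b),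
      (X (Sum.inl p.1) - X (Sum.inl p.2))) * ∏ i, X (Sum.inl i)
  have hF : wallHom a b F ≠ 0 := by
    simp only [F, map_mul, map_prod]
    refine mul_ne_zero (Finset.prod_ne_zero_iff.mpr fun q hq => ?_)
      (Finset.prod_ne_zero_iff.mpr fun i _ => ?_)
    · obtain ⟨h1, h2⟩ := Finset.mem_erase.mp hq
      exact wallHom_X_sub_X_ne_zero hab (Finset.mem_filter.mp h2).2 h1
    · simp only [wallHom, aeval_X]
      by_cases hi : i = a
      · subst hi
        simp [X_ne_zero]
      · simp [hi, X_ne_zero]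
  refine (mul_eq_zero.mp (?_ : wallHom a b F * wallHom a b Q = 0)).resolve_left hF
  refine MvPolynomial.funext fun y => ?_
  obtain ⟨z, ν, rfl⟩ : ∃ z ν, y = Sum.elim z ν := ⟨y ∘ Sum.inl, y ∘ Sum.inr, by ext (i | i) <;> rfl⟩
  have hev : ∀ R, eval (Sum.elim z ν) (wallHom a b R) =
      eval (Sum.elim (Function.update z a (z b)) ν) R := by
    intro R
    induction R using MvPolynomial.induction_on with
    | C r => rw [wallHom, ← algebraMap_eq, AlgHom.commutes, algebraMap_eq, eval_C, eval_C]
    | add p q hp hq => simp only [map_add, hp, hq]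
    | mul_X p i hp =>
      simp only [map_mul, hp, eval_X]
      congr 1
      simp only [wallHom, aeval_X]
      rcases i with i | i
      · by_cases hi : i = a
        · subst hi; simp
        · simp [hi]
      · simp
  rw [map_mul, hev, hev, map_zero, mul_eq_zero, or_iff_not_imp_left]
  intro hne
  simp only [F, map_mul, map_prod, map_sub, eval_X, Sum.elim_inl] at hne
  obtain ⟨h1, h2⟩ := mul_ne_zero_iff.mp hne
  rw [Finset.prod_ne_zero_iff] at h1 h2
  refine eval_eq_zero_of_wall m n hN hQ hab.ne ν ?_ (fun i => h2 i (Finset.mem_univ i)) ?_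
  · rw [Function.update_self, Function.update_of_ne hab.ne']
  · have key : ∀ i j, i < j → Function.update z a (z b) i = Function.update z a (z b) j →
        i = a ∧ j = b := by
      intro i j hij he
      by_contra hcon
      refine h1 (i, j) (Finset.mem_erase.mpr ⟨fun e => hcon ?_, ?_⟩) (sub_eq_zero.mpr he)
      · exact ⟨congrArg Prod.fst e, congrArg Prod.snd e⟩
      · exact Finset.mem_filter.mpr ⟨Finset.mem_univ _, hij⟩
    intro i j hij he
    rcases lt_or_gt_of_ne hij with h | h
    · exact Or.inl (key i j h he)
    · exact Or.inr (key j i h he.symm).symm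

/-- The poles of the Baker-Akhiezer function have order at most `m`. -/
theorem exists_baPoly_numerator (m n : ℕ) :
    ∃ Q : MvPolynomial (Fin n ⊕ Fin n) ℂ, ∀ z ν, Function.Injective z →
      symEval id z ν (baPoly m n) * vandA z ^ m = eval (Sum.elim z ν) Q := by
  obtain ⟨N, Q, hQ⟩ := hasPolarForm_symEval (baPoly m n)
  have key : ∀ k, ∀ Q : MvPolynomial (Fin n ⊕ Fin n) ℂ, (∀ z ν, Function.Injective z →
      symEval id z ν (baPoly m n) * vandA z ^ (m + k) = eval (Sum.elim z ν) Q) →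
      ∃ Q : MvPolynomial (Fin n ⊕ Fin n) ℂ, ∀ z ν, Function.Injective z →
        symEval id z ν (baPoly m n) * vandA z ^ m = eval (Sum.elim z ν) Q := by
    intro k
    induction k with
    | zero => exact fun Q hQ => ⟨Q, hQ⟩
    | succ k ih =>
      intro Q hQ
      obtain ⟨R, hR⟩ := vandPoly_dvd m n (by omega) hQ
      refine ih R fun z ν hz => mul_right_cancel₀ (vandA_ne_zero hz) ?_
      rw [mul_assoc, ← pow_succ, add_assoc, hQ z ν hz, hR, map_mul, eval_vandPoly, mul_comm]
  -- The exponent is raised to `m + N`, so that the descent by single steps ends exactly at `m`.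
  refine key N (Q * vandPoly n ^ m) fun z ν hz => ?_
  rw [map_mul, map_pow, eval_vandPoly, ← hQ z ν hz]
  ring

end Poles


/-! ### Back to the variables `x`: existence of the BA function. -/

section TrigPolynomials

open MvPolynomial

variable {n : ℕ}

/-- The points `u_i = exp (2 x_i)`. -/
noncomputable def expPt (x : Fin n → ℂ) (i : Fin n) : ℂ := Complex.exp (2 * x i)

lemma OffWalls.injective {x : Fin n → ℂ} (hx : OffWalls x) : Function.Injective (expPt x) := by
  intro i j h
  by_contra hij
  exact hx i j hij h

lemma expPt_ne_zero (x : Fin n → ℂ) (i : Fin n) : expPt x i ≠ 0 := Complex.exp_ne_zero _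

/-- A monomial in `u` becomes an exponential with even exponents, and the prefactor shifts all of
them by `-k`. -/
lemma exists_trigPoly_atX (k : ℕ) (Q : MvPolynomial (Fin n ⊕ Fin n) ℂ) :
    ∃ P : TrigPoly n, ∀ x, P.atX x = C (Complex.exp (-(k * ∑ i, x i))) *
      aeval (Sum.elim (fun i => C (expPt x i)) X) Q := by
  refine ⟨∑ s ∈ Q.support, Finsupp.single (fun i => 2 * (s (Sum.inl i) : ℤ) - k)
    (C (Q.coeff s) * ∏ i, X i ^ s (Sum.inr i)), fun x => ?_⟩
  rw [TrigPoly.atX, ← Finsupp.sum_finsetSum_index (by simp) (by intros; rw [mul_add]),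
    aeval_def, eval₂_eq', Finset.mul_sum]
  refine Finset.sum_congr rfl fun s _ => ?_
  rw [Finsupp.sum_single_index (by simp), Fintype.prod_sum_type]
  simp only [Sum.elim_inl, Sum.elim_inr, algebraMap_eq, ← map_pow, ← map_prod, expPt,
    ← Complex.exp_nat_mul, ← Complex.exp_sum]
  have h : ∑ i, (((2 * (s (Sum.inl i) : ℤ) - k : ℤ)) : ℂ) * x i =
      -(k * ∑ i, x i) + ∑ i, (s (Sum.inl i) : ℂ) * (2 * x i) := by
    push_cast
    rw [Finset.mul_sum, ← Finset.sum_neg_distrib, ← Finset.sum_add_distrib]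
    exact Finset.sum_congr rfl fun i _ => by ring
  rw [h, Complex.exp_add, C_mul]
  ring

lemma sum_pairs_add (x : Fin n → ℂ) :
    ∑ i, ∑ j ∈ Finset.Ioi i, (x i + x j) = ((n - 1 : ℕ) : ℂ) * ∑ i, x i := by
  have h : ∑ i, ∑ j ∈ Finset.Ioi i, x j = ∑ j, ∑ i ∈ Finset.Iio j, x j :=
    Finset.sum_comm' (by simp)
  simp only [Finset.sum_add_distrib]
  rw [h]
  simp only [Finset.sum_const, Fin.card_Ioi, Fin.card_Iio, nsmul_eq_mul]
  rw [← Finset.sum_add_distrib, Finset.mul_sum]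
  refine Finset.sum_congr rfl fun i _ => ?_
  rw [← add_mul, ← Nat.cast_add]
  congr 2
  omega

lemma sinh_sub_eq (a b : ℂ) : Complex.sinh (a - b) =
    2⁻¹ * Complex.exp (-(a + b)) * (Complex.exp (2 * a) - Complex.exp (2 * b)) := by
  rw [Complex.sinh, mul_sub, mul_assoc, mul_assoc, ← Complex.exp_add, ← Complex.exp_add,
    show -(a + b) + 2 * a = a - b by ring, show -(a + b) + 2 * b = -(a - b) by ring]
  ring

lemma sinhB_eq (x : Fin n → ℂ) : sinhB x = (∏ i : Fin n, ∏ _j ∈ Finset.Ioi i, (2 : ℂ)⁻¹) *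
    Complex.exp (-(((n - 1 : ℕ) : ℂ) * ∑ i, x i)) * vandA (expPt x) := by
  rw [← sum_pairs_add, ← Finset.sum_neg_distrib, Complex.exp_sum]
  simp only [← Finset.sum_neg_distrib, Complex.exp_sum, sinhB, vandA, sinh_sub_eq,
    Finset.prod_mul_distrib, expPt]

lemma sinhB_ne_zero {x : Fin n → ℂ} (hx : OffWalls x) : sinhB x ≠ 0 := by
  rw [sinhB_eq]
  refine mul_ne_zero (mul_ne_zero ?_ (Complex.exp_ne_zero _)) (vandA_ne_zero hx.injective)
  exact Finset.prod_ne_zero_iff.mpr fun i _ => Finset.prod_ne_zero_iff.mpr fun j _ => by norm_num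

/-- The numerator of the Baker-Akhiezer function, as a trigonometric polynomial. -/
lemma exists_trigPoly_baPoly (m n : ℕ) : ∃ P : TrigPoly n, ∀ x, OffWalls x →
    P.atX x = C (sinhB x ^ m) * map (eval (symVal id (expPt x))) (baPoly m n) := by
  obtain ⟨Q, hQ⟩ := exists_baPoly_numerator m n
  obtain ⟨P, hP⟩ := exists_trigPoly_atX (m * (n - 1))
    (C ((∏ i : Fin n, ∏ _j ∈ Finset.Ioi i, (2 : ℂ)⁻¹) ^ m) * Q)
  refine ⟨P, fun x hx => MvPolynomial.funext fun ν => ?_⟩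
  have h1 : ∀ R, eval ν (aeval (Sum.elim (fun i => C (expPt x i)) X) R) =
      eval (Sum.elim (expPt x) ν) R := by
    intro R
    induction R using MvPolynomial.induction_on with
    | C r => rw [algHom_C, algebraMap_eq, eval_C, eval_C]
    | add p q hp hq => simp only [map_add, hp, hq]
    | mul_X p i hp => rcases i with i | i <;> simp only [map_mul, hp, eval_X, aeval_X,
        Sum.elim_inl, Sum.elim_inr, eval_C]
  have h2 : eval ν (map (eval (symVal id (expPt x))) (baPoly m n)) =
      symEval id (expPt x) ν (baPoly m n) := by
    rw [eval_map, symEval, coe_eval₂Hom]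
  rw [hP, map_mul, h1, map_mul, map_mul, eval_C, eval_C, eval_C, h2, ← hQ _ _ hx.injective,
    sinhB_eq, mul_pow, mul_pow, ← Complex.exp_nat_mul]
  push_cast
  rw [mul_neg, mul_assoc (m : ℂ)]
  ring

/-- The direction `(0, 1, …, n-1)` separates all coordinates. A coincidence of `u_i` and `u_j` is
destroyed because a real shift changes the modulus. -/
lemma eventually_offWalls (x : Fin n → ℂ) :
    ∀ᶠ s : ℝ in nhdsWithin 0 {0}ᶜ, OffWalls fun i => x i + (s : ℂ) * (i : ℕ) := by
  unfold OffWalls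
  refine Filter.eventually_all.mpr fun i => Filter.eventually_all.mpr fun j => ?_
  by_cases hij : i = j
  · simp [hij]
  by_cases h : Complex.exp (2 * x i) = Complex.exp (2 * x j)
  · filter_upwards [self_mem_nhdsWithin] with s hs _ he
    rw [mul_add, mul_add, Complex.exp_add, Complex.exp_add, h] at he
    have h1 := mul_left_cancel₀ (Complex.exp_ne_zero _) he
    have h2 : ((Real.exp (2 * (s * (i : ℕ))) : ℝ) : ℂ) = (Real.exp (2 * (s * (j : ℕ))) : ℝ) := by
      push_cast
      exact h1
    have h3 := Real.exp_injective (Complex.ofReal_injective h2)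
    have h4 : ((i : ℕ) : ℝ) = (j : ℕ) := mul_left_cancel₀ hs (mul_left_cancel₀ two_ne_zero h3)
    exact hij (Fin.ext (by exact_mod_cast h4))
  · have hc : ∀ k : Fin n, Filter.Tendsto (fun s : ℝ => Complex.exp (2 * (x k + (s : ℂ) * (k : ℕ))))
        (nhdsWithin 0 {0}ᶜ) (nhds (Complex.exp (2 * x k))) := fun k =>
      ((by fun_prop : Continuous fun s : ℝ =>
        Complex.exp (2 * (x k + (s : ℂ) * (k : ℕ)))).tendsto' 0 _ (by simp)).mono_left
          nhdsWithin_le_nhds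
    filter_upwards [((hc i).sub (hc j)).eventually_ne (sub_ne_zero.mpr h)] with s hs _
    exact sub_ne_zero.mp hs

lemma TrigPoly.continuous_coeff_atX (P : TrigPoly n) (s : Fin n →₀ ℕ) :
    Continuous fun x => (P.atX x).coeff s := by
  simp only [TrigPoly.atX, Finsupp.sum, coeff_sum, coeff_C_mul]
  fun_prop

lemma continuous_sinhB : Continuous (sinhB : (Fin n → ℂ) → ℂ) := by
  unfold sinhB
  fun_prop

/-- Off the walls this is `leadCoeff_baPoly`. Since the leading term is required for every `x`, the
coefficients are extended to the walls by continuity. -/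
lemma hasLeadingTerm_of_atX {m : ℕ} {P : TrigPoly n}
    (hP : ∀ x, OffWalls x →
      P.atX x = C (sinhB x ^ m) * map (eval (symVal id (expPt x))) (baPoly m n)) :
    P.HasLeadingTerm m := by
  obtain ⟨hH, hc⟩ := leadCoeff_baPoly m n
  have key : ∀ x (s : Fin n →₀ ℕ), m * (n * (n - 1) / 2) ≤ s.degree →
      (P.atX x).coeff s = sinhB x ^ m *
        ((∏ i : Fin n, ∏ j ∈ Finset.Ioi i, (X i - X j : MvPolynomial (Fin n) ℂ)) ^ m).coeff s := by
    intro x s hs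
    have hcont : Continuous fun r : ℝ => fun i => x i + (r : ℂ) * ((i : Fin n) : ℕ) := by fun_prop
    have h1 := ((P.continuous_coeff_atX s).comp hcont).tendsto' 0 ((P.atX x).coeff s) (by simp)
    have h2 := (((continuous_sinhB.pow m).mul (continuous_const (y :=
      ((∏ i : Fin n, ∏ j ∈ Finset.Ioi i, (X i - X j : MvPolynomial (Fin n) ℂ)) ^ m).coeff s))).comp
      hcont).tendsto' 0
      (sinhB x ^ m * ((∏ i : Fin n, ∏ j ∈ Finset.Ioi i,
        (X i - X j : MvPolynomial (Fin n) ℂ)) ^ m).coeff s) (by simp)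
    refine tendsto_nhds_unique_of_eventuallyEq (l := nhdsWithin 0 {0}ᶜ)
      (h1.mono_left nhdsWithin_le_nhds) (h2.mono_left nhdsWithin_le_nhds) ?_
    filter_upwards [eventually_offWalls x] with r hr
    simp only [Function.comp_apply]
    rw [hP _ hr, coeff_C_mul, coeff_map, hc s hs, eval_C]
    rfl
  refine fun x => ⟨?_, ?_⟩
  · refine Finset.sup_le fun s hs => ?_
    by_contra hlt
    have h1 := key x s (le_of_not_ge hlt)
    rw [hH.coeff_eq_zero (fun h => hlt h.le), mul_zero] at h1
    exact (mem_support_iff.mp hs) h1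
  · ext s
    rw [coeff_homogeneousComponent, coeff_C_mul]
    split_ifs with h
    · exact key x s h.ge
    · rw [hH.coeff_eq_zero h, mul_zero]

lemma TrigPoly.value_of_atX {m : ℕ} {P : TrigPoly n} {x : Fin n → ℂ}
    (hP : P.atX x = C (sinhB x ^ m) * map (eval (symVal id (expPt x))) (baPoly m n))
    (ν : Fin n → ℂ) : P.value x ν = sinhB x ^ m * symEval id (expPt x) ν (baPoly m n) := by
  rw [TrigPoly.value, hP, map_mul, eval_C, eval_map, symEval, coe_eval₂Hom]

lemma tendsto_sub_chamberAtTop {i j : Fin n} (h : i < j) :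
    Filter.Tendsto (fun x : Fin n → ℝ => x i - x j) (chamberAtTop n) Filter.atTop :=
  Filter.tendsto_comap.mono_left
    ((iInf_le _ i).trans ((iInf_le _ j).trans (iInf_le _ (Finset.mem_Ioi.mpr h))))

lemma eventually_lt_chamberAtTop :
    ∀ᶠ x : Fin n → ℝ in chamberAtTop n, ∀ i j, i < j → x j < x i := by
  refine Filter.eventually_all.mpr fun i => Filter.eventually_all.mpr fun j => ?_
  by_cases h : i < j
  · filter_upwards [(tendsto_sub_chamberAtTop h).eventually_gt_atTop 0] with x hx _
    linarith
  · exact Filter.Eventually.of_forall fun x h' => absurd h' h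

lemma offWalls_of_lt {x : Fin n → ℝ} (hx : ∀ i j, i < j → x j < x i) :
    OffWalls fun i => (x i : ℂ) := by
  intro i j hij h
  have h2 : ((Real.exp (2 * x i) : ℝ) : ℂ) = (Real.exp (2 * x j) : ℝ) := by
    push_cast
    exact h
  have h3 := mul_left_cancel₀ two_ne_zero (Real.exp_injective (Complex.ofReal_injective h2))
  rcases lt_or_gt_of_ne hij with h | h
  · exact (hx _ _ h).ne h3.symm
  · exact (hx _ _ h).ne h3

/-- For `i < j` the quotient `u_j / u_i` tends to 0, so the symbol `1 / (1 - u_j / u_i)` tends to 1;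
in the opposite order the dominant term is in the denominator. -/
lemma tendsto_symVal_chamberAtTop (p : Fin n × Fin n) :
    Filter.Tendsto (fun x : Fin n → ℝ => symVal id (expPt fun i => (x i : ℂ)) p) (chamberAtTop n)
      (nhds (symLim id p)) := by
  have hexp : ∀ {i j : Fin n}, i < j → Filter.Tendsto (fun x : Fin n → ℝ =>
      Complex.exp (2 * (x j : ℂ) - 2 * x i)) (chamberAtTop n) (nhds 0) := by
    intro i j h
    have h1 : Filter.Tendsto (fun x : Fin n → ℝ => Real.exp (-(2 * (x i - x j)))) (chamberAtTop n)
        (nhds 0) := Real.tendsto_exp_neg_atTop_nhds_zero.comp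
          ((tendsto_sub_chamberAtTop h).const_mul_atTop two_pos)
    have h2 := (Complex.continuous_ofReal.tendsto 0).comp h1
    rw [Complex.ofReal_zero] at h2
    refine h2.congr fun x => ?_
    simp only [Function.comp_apply]
    push_cast
    congr 1
    ring
  obtain ⟨i, j⟩ := p
  rcases lt_trichotomy i j with h | h | h
  · have h1 := ((hexp h).const_sub 1).inv₀ (by simp)
    simp only [symLim, id, if_pos h]
    rw [sub_zero, inv_one] at h1
    refine h1.congr fun x => ?_
    simp only [symVal, id, if_neg h.ne, expPt, Complex.exp_sub]
    have := Complex.exp_ne_zero (2 * (x i : ℂ))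
    rw [one_sub_div this, inv_div]
  · simp only [symLim, symVal, id, h, lt_irrefl, if_true, if_false]
    exact tendsto_const_nhds
  · have h1 := (hexp h).div ((hexp h).sub_const 1) (by simp)
    simp only [symLim, id, if_neg h.not_gt]
    rw [zero_div] at h1
    refine h1.congr fun x => ?_
    simp only [symVal, id, if_neg h.ne', expPt, Complex.exp_sub, Pi.div_apply]
    have := Complex.exp_ne_zero (2 * (x j : ℂ))
    rw [div_sub_one this, div_div_div_cancel_right₀ this]

lemma tendsto_symEval_baPoly (m n : ℕ) (ν : Fin n → ℂ) :
    Filter.Tendsto (fun x : Fin n → ℝ =>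
      symEval id (expPt fun i => (x i : ℂ)) ν (baPoly m n)) (chamberAtTop n)
      (nhds (normC m ν)) := by
  rw [← symEvalLim_baPoly m n ν]
  simp only [symEval, symEvalLim, coe_eval₂Hom, eval₂_eq]
  refine tendsto_finsetSum _ fun s _ => Filter.Tendsto.mul_const _ ?_
  exact ((MvPolynomial.continuous_eval _).tendsto _).comp
    (tendsto_pi_nhds.mpr fun p => tendsto_symVal_chamberAtTop p)

/-- The solution `exp (2 (ν, x))` times a polynomial in the symbols. -/
noncomputable def expWave (ν : Fin n → ℂ) (W : SymPoly (Fin n) (Fin n)) (x : Fin n → ℂ) : ℂ :=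
  symEval id (expPt x) ν W * Complex.exp (2 * ∑ i, ν i * x i)

/-- The factor 2 comes from `∂/∂x_l = 2 u_l ∂/∂u_l`; applied twice, it accounts for the 4 in the
eigenvalue. -/
lemma hasDerivAt_expWave {x : Fin n → ℂ} (hx : OffWalls x) (ν : Fin n → ℂ)
    (W : SymPoly (Fin n) (Fin n)) (l : Fin n) :
    HasDerivAt (fun s => expWave ν W (Function.update x l s)) (2 * expWave ν (powOp l W) x)
      (x l) := by
  have h1 := hasDerivAt_symEval id (expPt x) (fun a b h e => h (hx.injective e)) l
    (expPt_ne_zero x l) ν W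
  have h2 : HasDerivAt (fun s => Complex.exp (2 * s)) (expPt x l * 2) (x l) := by
    simpa [expPt] using ((hasDerivAt_id (x l)).const_mul 2).cexp
  have h3 := HasDerivAt.comp (x l) (h₂ := fun s => symEval id (Function.update (expPt x) l s) ν W)
    (h := fun s => Complex.exp (2 * s)) h1 h2
  have hup : ∀ s, expPt (Function.update x l s) = Function.update (expPt x) l (Complex.exp (2 * s)) := by
    intro s
    ext i
    by_cases hi : i = l
    · subst hi; simp [expPt]
    · simp [expPt, hi]
  have h4 : HasDerivAt (fun s => ∑ i, ν i * Function.update x l s i) (ν l) (x l) := by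
    have : HasDerivAt (fun s => ∑ i, ν i * Function.update x l s i)
        (∑ i, if i = l then ν i else 0) (x l) := by
      refine HasDerivAt.fun_sum fun i _ => ?_
      by_cases hi : i = l
      · subst hi
        simpa using (hasDerivAt_id' (x i)).const_mul (ν i)
      · simpa [hi] using hasDerivAt_const (x l) (ν i * x i)
    simpa using this
  unfold expWave
  simp only [hup]
  refine (h3.mul (h4.const_mul 2).cexp).congr_deriv ?_
  have h5 := expPt_ne_zero x l
  simp only [Function.comp_apply, Function.update_eq_self, powOp, map_add, map_mul,
    show symEval id (expPt x) ν (X l) = ν l by simp [symEval]]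
  rw [show Function.update (expPt x) l (Complex.exp (2 * x l)) = expPt x from
    Function.update_eq_self l _]
  field_simp

lemma eventually_offWalls_update {x : Fin n → ℂ} (hx : OffWalls x) (l : Fin n) :
    ∀ᶠ s in nhds (x l), OffWalls (Function.update x l s) := by
  have hc : Continuous fun s : ℂ => Complex.exp (2 * s) := by fun_prop
  filter_upwards [hc.continuousAt.eventually (injective_update_eventually hx.injective l)] with s hs
  intro i j hij h
  have hup : ∀ k, Complex.exp (2 * Function.update x l s k) =
      Function.update (expPt x) l (Complex.exp (2 * s)) k := by
    intro k
    by_cases hk : k = l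
    · subst hk; simp
    · simp [expPt, hk]
  rw [hup, hup] at h
  exact hij (hs h)

lemma iteratedDeriv_two_expWave {x : Fin n → ℂ} (hx : OffWalls x) (ν : Fin n → ℂ)
    (W : SymPoly (Fin n) (Fin n)) (l : Fin n) :
    iteratedDeriv 2 (fun s => expWave ν W (Function.update x l s)) (x l) =
      4 * expWave ν (powOp l (powOp l W)) x := by
  rw [iteratedDeriv_succ, iteratedDeriv_one]
  have h : deriv (fun s => expWave ν W (Function.update x l s)) =ᶠ[nhds (x l)]
      fun s => 2 * expWave ν (powOp l W) (Function.update x l s) := by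
    filter_upwards [eventually_offWalls_update hx l] with s hs
    have := hasDerivAt_expWave hs ν W l
    simp only [Function.update_idem, Function.update_self] at this
    exact this.deriv
  rw [h.deriv_eq, ((hasDerivAt_expWave hx ν (powOp l W) l).const_mul 2).deriv]
  ring

/-- The product of the two ratios is `-u_i u_j / (u_i - u_j)²`, and `u_i - u_j = 2 exp (x_i + x_j)
sinh (x_i - x_j)`. -/
lemma inv_sinh_sq_eq {x : Fin n → ℂ} (hx : OffWalls x) {i j : Fin n} (hij : i ≠ j) :
    (Complex.sinh (x i - x j) ^ 2)⁻¹ =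
      -4 * (ptRatio (expPt x) i j * ptRatio (expPt x) j i) := by
  have h1 := sub_ne_zero.mpr (hx.injective.ne hij)
  have h2 := sub_ne_zero.mpr (hx.injective.ne hij.symm)
  have h3 : Complex.exp (-(x i + x j)) ^ 2 * (expPt x i * expPt x j) = 1 := by
    rw [expPt, expPt, ← Complex.exp_nat_mul, ← Complex.exp_add, ← Complex.exp_add]
    convert Complex.exp_zero using 2
    push_cast
    ring
  have h4 := Complex.exp_ne_zero (-(x i + x j))
  rw [sinh_sub_eq, ptRatio, ptRatio, if_neg hij, if_neg hij.symm]
  change ((2⁻¹ * Complex.exp (-(x i + x j)) * (expPt x i - expPt x j)) ^ 2)⁻¹ = _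
  have h5 : expPt x j - expPt x i = -(expPt x i - expPt x j) := by ring
  rw [h5]
  field_simp
  linear_combination -4 * h3

lemma sum_pairs_symm {f : Fin n → Fin n → ℂ} (hs : ∀ i j, f i j = f j i) (hd : ∀ i, f i i = 0) :
    ∑ i, ∑ j, f i j = 2 * ∑ i, ∑ j ∈ Finset.Ioi i, f i j := by
  have h : ∑ i, ∑ j ∈ Finset.Iio i, f i j = ∑ i, ∑ j ∈ Finset.Ioi i, f i j := by
    rw [Finset.sum_comm' (t' := Finset.univ) (s' := fun j => Finset.Ioi j) (by simp)]
    exact Finset.sum_congr rfl fun i _ => Finset.sum_congr rfl fun j _ => hs _ _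
  rw [two_mul]
  nth_rewrite 1 [← h]
  rw [← Finset.sum_add_distrib]
  refine Finset.sum_congr rfl fun i _ => ?_
  have h1 : (Finset.univ : Finset (Fin n)) = (Finset.Iio i ∪ Finset.Ioi i) ∪ {i} := by
    ext j
    simp only [Finset.mem_univ, Finset.mem_union, Finset.mem_Iio, Finset.mem_Ioi,
      Finset.mem_singleton, true_iff]
    rcases lt_trichotomy j i with h | h | h <;> simp [h]
  rw [h1, Finset.sum_union, Finset.sum_union, Finset.sum_singleton, hd, add_zero]
  · rw [Finset.disjoint_left]
    intro j hj hj'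
    exact absurd ((Finset.mem_Iio.mp hj).trans (Finset.mem_Ioi.mp hj')) (lt_irrefl _)
  · simp

lemma sutherland_expWave (m : ℕ) {x : Fin n → ℂ} (hx : OffWalls x) (ν : Fin n → ℂ) :
    sutherland m (expWave ν (baPoly m n)) x =
      -4 * (∑ i, ν i ^ 2) * expWave ν (baPoly m n) x := by
  have h1 : ∑ i, ∑ j ∈ Finset.Ioi i, 2 * (m : ℂ) * ((m : ℂ) + 1) / Complex.sinh (x i - x j) ^ 2 =
      -4 * (m * (m + 1)) * ∑ i, ∑ j, ptRatio (expPt x) i j * ptRatio (expPt x) j i := by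
    rw [sum_pairs_symm (fun i j => mul_comm _ _) (fun i => by simp [ptRatio]), ← mul_assoc,
      Finset.mul_sum]
    refine Finset.sum_congr rfl fun i _ => ?_
    rw [Finset.mul_sum]
    refine Finset.sum_congr rfl fun j hj => ?_
    rw [div_eq_mul_inv, inv_sinh_sq_eq hx (Finset.mem_Ioi.mp hj).ne]
    ring
  rw [sutherland, h1]
  simp only [iteratedDeriv_two_expWave hx, ← Finset.mul_sum]
  have h2 := sum_symEval_powOp_powOp_baPoly m n (expPt x) ν hx.injective (expPt_ne_zero x)
  simp only [expWave, ← Finset.sum_mul]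
  rw [h2]
  ring

/-- The Baker-Akhiezer function. -/
theorem exists_isTrigBA (m n : ℕ) : ∃ P : TrigPoly n,
    (∀ x ν, OffWalls x → P.value x ν = sinhB x ^ m * symEval id (expPt x) ν (baPoly m n)) ∧
    IsTrigBA n m fun x ν =>
      P.value x ν / (sinhB x ^ m * normC m ν) * Complex.exp (2 * ∑ i, ν i * x i) := by
  obtain ⟨P, hP⟩ := exists_trigPoly_baPoly m n
  have hv : ∀ x ν, OffWalls x →
      P.value x ν = sinhB x ^ m * symEval id (expPt x) ν (baPoly m n) :=
    fun x ν hx => TrigPoly.value_of_atX (hP x hx) ν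
  have hq : ∀ x ν, OffWalls x → P.value x ν / (sinhB x ^ m * normC m ν) =
      (normC m ν)⁻¹ * symEval id (expPt x) ν (baPoly m n) := by
    intro x ν hx
    rw [hv x ν hx, mul_div_mul_left _ _ (pow_ne_zero m (sinhB_ne_zero hx)), div_eq_inv_mul]
  refine ⟨P, hv, ⟨P, hasLeadingTerm_of_atX hP, fun _ _ _ _ => rfl, fun ν hν => ?_⟩,
    fun x ν hx hν => ?_⟩
  · have h1 := (tendsto_symEval_baPoly m n ν).const_mul (normC m ν)⁻¹
    rw [inv_mul_cancel₀ hν] at h1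
    refine h1.congr' ?_
    filter_upwards [eventually_lt_chamberAtTop] with x hx
    exact (hq _ ν (offWalls_of_lt hx)).symm
  · have h1 : ∀ y, OffWalls y → P.value y ν / (sinhB y ^ m * normC m ν) *
        Complex.exp (2 * ∑ i, ν i * y i) = (normC m ν)⁻¹ * expWave ν (baPoly m n) y := by
      intro y hy
      rw [hq y ν hy, expWave, mul_assoc]
    have h2 := sutherland_expWave m hx ν
    unfold sutherland at h2 ⊢
    -- The two expressions agree only off the walls, but this set is open along each coordinate
    -- line, which is enough for derivatives at `x`.
    have h3 : ∀ l, iteratedDeriv 2 (fun s => P.value (Function.update x l s) ν /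
        (sinhB (Function.update x l s) ^ m * normC m ν) *
        Complex.exp (2 * ∑ i, ν i * Function.update x l s i)) (x l) =
        (normC m ν)⁻¹ * iteratedDeriv 2
          (fun s => expWave ν (baPoly m n) (Function.update x l s)) (x l) := by
      intro l
      rw [← iteratedDeriv_const_mul_field]
      refine Filter.EventuallyEq.iteratedDeriv_eq 2 ?_
      filter_upwards [eventually_offWalls_update hx l] with s hs
      exact h1 _ hs
    simp only [h3, ← Finset.mul_sum, h1 x hx]
    linear_combination (normC m ν)⁻¹ * h2

end TrigPolynomials


/-! ### Uniqueness of the BA function. -/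

section Uniqueness

variable {n : ℕ}

/-- Entire functions which vanish on the real Weyl chamber vanish. -/
lemma eq_zero_of_chamber {H : (Fin n → ℂ) → ℂ} (hH : Differentiable ℂ H)
    (h : ∀ x : Fin n → ℝ, (∀ i j, i < j → x j < x i) → H (fun i => (x i : ℂ)) = 0)
    (y : Fin n → ℂ) : H y = 0 := by
  have hid : ∀ f : ℂ → ℂ, Differentiable ℂ f → ∀ a : ℝ,
      (∀ᶠ t : ℝ in nhdsWithin a (Set.Ioi a), f t = 0) → ∀ z, f z = 0 := by
    intro f hf a ha z
    have hfr : ∃ᶠ z in nhdsWithin (a : ℂ) {(a : ℂ)}ᶜ, f z = (0 : ℂ → ℂ) z := by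
      have ht : Filter.Tendsto (fun t : ℝ => (t : ℂ)) (nhdsWithin a (Set.Ioi a))
          (nhdsWithin (a : ℂ) {(a : ℂ)}ᶜ) := by
        refine tendsto_nhdsWithin_iff.mpr ⟨?_, ?_⟩
        · exact (Complex.continuous_ofReal.tendsto a).mono_left nhdsWithin_le_nhds
        · filter_upwards [self_mem_nhdsWithin] with t ht
          exact fun h => (ne_of_gt ht) (Complex.ofReal_injective h)
      exact ht.frequently ha.frequently
    exact congrFun (AnalyticOnNhd.eq_of_frequently_eq
      (fun z _ => hf.analyticAt z) (fun z _ => analyticAt_const) hfr) z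
  -- A vector in the open chamber: adding a large multiple of `ρ` pushes a bounded real point into
  -- the chamber.
  let ρ : Fin n → ℝ := fun i => -(i : ℕ)
  have hρ : ∀ i j : Fin n, i < j → ρ j + 1 ≤ ρ i := by
    intro i j hij
    have : ((i : ℕ) : ℝ) + 1 ≤ (j : ℕ) := by exact_mod_cast Nat.succ_le_of_lt hij
    simp only [ρ]
    linarith
  obtain ⟨M, hM⟩ : ∃ M : ℝ, ∀ i, |(y i).re| + |(y i).im| ≤ M := by
    obtain ⟨M, hM⟩ := Finite.exists_le fun i => |(y i).re| + |(y i).im|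
    exact ⟨M, hM⟩
  -- For large `T` the points `Re y + T ρ + t Im y` with `0 < t < 1` lie in the chamber. The
  -- identity theorem in `t` reaches `t = i`, and a second application, in `T`, comes back to `T =
  -- 0`.
  have key : ∀ T : ℝ, 2 * M < T → H (fun i => y i + (T : ℂ) * ρ i) = 0 := by
    intro T hT
    have h1 := hid (fun z => H fun i => (((y i).re : ℂ) + (T : ℂ) * ρ i) + z * (y i).im)
      (hH.comp (by fun_prop)) 0 ?_ Complex.I
    · rw [← h1]
      congr 1
      ext i
      nth_rewrite 1 [← Complex.re_add_im (y i)]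
      ring
    · filter_upwards [Ioo_mem_nhdsGT (zero_lt_one' ℝ)] with t ht
      have h2 := h (fun i => (y i).re + T * ρ i + t * (y i).im) ?_
      · rw [← h2]
        congr 1
        ext i
        push_cast
        ring
      · intro i j hij
        have hM0 : 0 ≤ M := (by positivity : (0 : ℝ) ≤ |(y i).re| + |(y i).im|).trans (hM i)
        have h3 : T * (ρ j + 1) ≤ T * ρ i := mul_le_mul_of_nonneg_left (hρ i j hij) (by linarith)
        have h4 : ∀ k, |(y k).re + t * (y k).im| ≤ M := by
          intro k
          refine ((abs_add_le _ _).trans ?_).trans (hM k)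
          rw [abs_mul, abs_of_pos ht.1]
          have := mul_le_mul_of_nonneg_right ht.2.le (abs_nonneg (y k).im)
          linarith
        have h5 := (abs_le.mp (h4 i)).1
        have h6 := (abs_le.mp (h4 j)).2
        linarith
  have h1 := hid (fun z => H fun i => y i + z * ρ i) (hH.comp (by fun_prop)) (2 * M) (by
    filter_upwards [self_mem_nhdsWithin] with t ht using key t ht) 0
  simpa using h1

/-- The values at `N` distinct nodes determine the coefficients through the inverse Vandermonde
matrix, a fixed linear map and hence continuous. -/
lemma tendsto_coeff_of_tendsto_eval {α : Type} {l : Filter α} {τ : ℕ → ℂ}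
    (hτ : Function.Injective τ) {N : ℕ} {c : ℕ → α → ℂ}
    (h : ∀ p, Filter.Tendsto (fun x => ∑ k ∈ Finset.range N, τ p ^ k * c k x) l (nhds 0))
    {k : ℕ} (hk : k < N) : Filter.Tendsto (c k) l (nhds 0) := by
  let V := Matrix.vandermonde fun p : Fin N => τ p
  have hV : IsUnit V.det := (Matrix.det_vandermonde_ne_zero_iff.mpr
    (hτ.comp Fin.val_injective)).isUnit
  have h1 : Filter.Tendsto (fun x => Matrix.mulVec V fun k : Fin N => c k x) l (nhds 0) := by
    refine tendsto_pi_nhds.mpr fun p => ?_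
    refine (h p).congr fun x => ?_
    simp only [Matrix.mulVec, dotProduct, V, Matrix.vandermonde_apply]
    exact Finset.sum_range fun k => τ p ^ k * c k x
  have h2 : Filter.Tendsto (fun x => Matrix.mulVec V⁻¹ (Matrix.mulVec V fun k : Fin N => c k x)) l
      (nhds (Matrix.mulVec V⁻¹ 0)) :=
    ((Continuous.matrix_mulVec continuous_const continuous_id).tendsto _).comp h1
  simp only [Matrix.mulVec_mulVec, Matrix.nonsing_inv_mul V hV, Matrix.one_mulVec,
    Matrix.mulVec_zero] at h2
  exact tendsto_pi_nhds.mp h2 ⟨k, hk⟩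

lemma iteratedDeriv_two_mul_exp {g : ℂ → ℂ} {x : ℂ} (hg : AnalyticAt ℂ g x) (α β : ℂ) :
    iteratedDeriv 2 (fun s => g s * Complex.exp (α * s + β)) x =
      (iteratedDeriv 2 g x + 2 * α * deriv g x + α ^ 2 * g x) * Complex.exp (α * x + β) := by
  have hE : ∀ s, HasDerivAt (fun s => Complex.exp (α * s + β)) (Complex.exp (α * s + β) * α) s := by
    intro s
    simpa using (((hasDerivAt_id s).const_mul α).add_const β).cexp
  have h1 : deriv (fun s => g s * Complex.exp (α * s + β)) =ᶠ[nhds x]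
      fun s => (deriv g s + α * g s) * Complex.exp (α * s + β) := by
    filter_upwards [hg.eventually_analyticAt] with s hs
    rw [(hs.differentiableAt.hasDerivAt.fun_mul (hE s)).deriv]
    ring
  rw [iteratedDeriv_succ, iteratedDeriv_one, iteratedDeriv_succ, iteratedDeriv_one, h1.deriv_eq]
  rw [((hg.deriv.differentiableAt.hasDerivAt.fun_add
    (hg.differentiableAt.hasDerivAt.const_mul α)).fun_mul (hE x)).deriv]
  ring

lemma analyticAt_div_sinhB {h : (Fin n → ℂ) → ℂ} (hh : Differentiable ℂ h) (m : ℕ)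
    {x : Fin n → ℂ} (hx : OffWalls x) (i : Fin n) :
    AnalyticAt ℂ (fun s => h (Function.update x i s) / sinhB (Function.update x i s) ^ m) (x i) := by
  rw [Complex.analyticAt_iff_eventually_differentiableAt]
  filter_upwards [eventually_offWalls_update hx i] with s hs
  have hup : DifferentiableAt ℂ (fun s => Function.update x i s) s :=
    (hasDerivAt_update x i s).differentiableAt
  have hB : Differentiable ℂ (sinhB : (Fin n → ℂ) → ℂ) := by
    unfold sinhB
    fun_prop
  exact ((hh _).comp s hup).div (((hB _).comp s hup).pow m) (pow_ne_zero m (sinhB_ne_zero hs))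

/-- The transport equation for the top coefficient of a polynomial family of solutions. -/
lemma transport_of_sutherland {m N : ℕ} {ν : Fin n → ℂ} {τ : ℕ → ℂ} (hτ : Function.Injective τ)
    {h : ℕ → (Fin n → ℂ) → ℂ} (hh : ∀ k, Differentiable ℂ (h k)) {x : Fin n → ℂ} (hx : OffWalls x)
    (heq : ∀ p, sutherland m (fun y => (∑ k ∈ Finset.range (N + 1), τ p ^ k * h k y) / sinhB y ^ m *
        Complex.exp (2 * ∑ i, τ p * ν i * y i)) x =
      -4 * (∑ i, (τ p * ν i) ^ 2) * ((∑ k ∈ Finset.range (N + 1), τ p ^ k * h k x) / sinhB x ^ m *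
        Complex.exp (2 * ∑ i, τ p * ν i * x i))) :
    ∑ i, ν i * deriv (fun s => h N (Function.update x i s) / sinhB (Function.update x i s) ^ m) (x i) =
      0 := by
  let g : ℕ → Fin n → ℂ → ℂ := fun k i s =>
    h k (Function.update x i s) / sinhB (Function.update x i s) ^ m
  have hg : ∀ k i, AnalyticAt ℂ (g k i) (x i) := fun k i => analyticAt_div_sinhB (hh k) m hx i
  let V := ∑ i, ∑ j ∈ Finset.Ioi i, 2 * (m : ℂ) * ((m : ℂ) + 1) / Complex.sinh (x i - x j) ^ 2
  have hG : ∀ p i, iteratedDeriv 2 (fun s => (∑ k ∈ Finset.range (N + 1),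
        τ p ^ k * h k (Function.update x i s)) / sinhB (Function.update x i s) ^ m *
        Complex.exp (2 * ∑ j, τ p * ν j * Function.update x i s j)) (x i) =
      (∑ k ∈ Finset.range (N + 1), τ p ^ k * (iteratedDeriv 2 (g k i) (x i) +
        4 * τ p * ν i * deriv (g k i) (x i) + 4 * (τ p * ν i) ^ 2 * (h k x / sinhB x ^ m))) *
        Complex.exp (2 * ∑ j, τ p * ν j * x j) := by
    intro p i
    have h1 : ∀ s, (∑ k ∈ Finset.range (N + 1),
        τ p ^ k * h k (Function.update x i s)) / sinhB (Function.update x i s) ^ m *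
        Complex.exp (2 * ∑ j, τ p * ν j * Function.update x i s j) =
        (∑ k ∈ Finset.range (N + 1), τ p ^ k * g k i s) * Complex.exp (2 * τ p * ν i * s +
          2 * ∑ j ∈ Finset.univ.erase i, τ p * ν j * x j) := by
      intro s
      rw [Finset.sum_div]
      congr 1
      · exact Finset.sum_congr rfl fun k _ => mul_div_assoc _ _ _
      · rw [← Finset.add_sum_erase _ _ (Finset.mem_univ i), Function.update_self, mul_add]
        congr 2
        · ring
        · congr 1
          refine Finset.sum_congr rfl fun j hj => ?_
          rw [Function.update_of_ne (Finset.ne_of_mem_erase hj)]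
    have h2 : ∀ k ∈ Finset.range (N + 1), AnalyticAt ℂ (fun s => τ p ^ k * g k i s) (x i) :=
      fun k _ => analyticAt_const.mul (hg k i)
    have h3 : AnalyticAt ℂ (fun s => ∑ k ∈ Finset.range (N + 1), τ p ^ k * g k i s) (x i) :=
      Finset.analyticAt_fun_sum _ h2
    simp only [h1]
    rw [iteratedDeriv_two_mul_exp h3, iteratedDeriv_fun_sum fun k hk => (h2 k hk).contDiffAt,
      deriv_fun_sum fun k hk => (h2 k hk).differentiableAt]
    congr 1
    · rw [Finset.mul_sum, Finset.mul_sum, ← Finset.sum_add_distrib, ← Finset.sum_add_distrib]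
      refine Finset.sum_congr rfl fun k _ => ?_
      rw [iteratedDeriv_const_mul_field, deriv_const_mul_field]
      simp only [g, Function.update_eq_self]
      ring
    · rw [← Finset.add_sum_erase _ _ (Finset.mem_univ i), mul_add]
      congr 2
      ring
  -- The eigenvalue equation along the ray, as a polynomial in `τ`. The terms of second order in `τ`
  -- have cancelled against `-4 (τν, τν)`, so each degree rises by at most 1.
  let R : Polynomial ℂ := ∑ k ∈ Finset.range (N + 1),
    (Polynomial.C (V * (h k x / sinhB x ^ m) - ∑ i, iteratedDeriv 2 (g k i) (x i)) *
        Polynomial.X ^ k -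
      Polynomial.C (4 * ∑ i, ν i * deriv (g k i) (x i)) * Polynomial.X ^ (k + 1))
  have hroot : ∀ p, R.IsRoot (τ p) := by
    intro p
    have h1 := heq p
    simp only [sutherland, hG p] at h1
    have hE := Complex.exp_ne_zero (2 * ∑ j, τ p * ν j * x j)
    rw [← Finset.sum_mul, ← neg_mul, ← mul_assoc, ← mul_assoc, ← add_mul] at h1
    have h2 := mul_right_cancel₀ hE h1
    rw [Polynomial.IsRoot.def]
    simp only [R, Polynomial.eval_finsetSum, Polynomial.eval_sub, Polynomial.eval_mul,
      Polynomial.eval_C, Polynomial.eval_pow, Polynomial.eval_X]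
    rw [Finset.sum_div, Finset.sum_comm, ← Finset.sum_neg_distrib, Finset.mul_sum, Finset.mul_sum,
      ← Finset.sum_add_distrib, ← sub_eq_zero, ← Finset.sum_sub_distrib] at h2
    rw [← h2]
    refine Finset.sum_congr rfl fun k _ => ?_
    rw [← Finset.mul_sum, Finset.sum_add_distrib, Finset.sum_add_distrib, ← Finset.sum_mul,
      ← Finset.mul_sum]
    have h3 : ∑ i, 4 * τ p * ν i * deriv (g k i) (x i) =
        4 * τ p * ∑ i, ν i * deriv (g k i) (x i) := by
      rw [Finset.mul_sum]
      exact Finset.sum_congr rfl fun i _ => by ring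
    rw [h3]
    ring
  have hR : R = 0 := Polynomial.eq_zero_of_infinite_isRoot R
    ((Set.infinite_range_of_injective hτ).mono (by rintro _ ⟨p, rfl⟩; exact hroot p))
  -- Only the first-order term of the top coefficient reaches degree `N + 1`.
  have hc := congrArg (fun q => Polynomial.coeff q (N + 1)) hR
  simp only [R, Polynomial.finsetSum_coeff, Polynomial.coeff_sub, Polynomial.coeff_C_mul,
    Polynomial.coeff_X_pow, Polynomial.coeff_zero] at hc
  rw [Finset.sum_eq_single N] at hc
  · simpa using hc
  · intro k hk hkN
    have h1 := Finset.mem_range.mp hk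
    rw [if_neg (by omega), if_neg (by omega)]
    simp
  · simp

lemma differentiableAt_div_sinhB {h : (Fin n → ℂ) → ℂ} (hh : Differentiable ℂ h) (m : ℕ)
    {x : Fin n → ℂ} (hx : OffWalls x) : DifferentiableAt ℂ (fun y => h y / sinhB y ^ m) x := by
  have hB : Differentiable ℂ (sinhB : (Fin n → ℂ) → ℂ) := by
    unfold sinhB
    fun_prop
  have hBm := (hB x).fun_pow m
  have h0 : sinhB x ^ m ≠ 0 := pow_ne_zero m (sinhB_ne_zero hx)
  simp only [div_eq_mul_inv]
  exact (hh x).fun_mul (DifferentiableAt.inv hBm h0)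

lemma hasDerivAt_line {F : (Fin n → ℂ) → ℂ} {x ν : Fin n → ℝ} {t : ℝ}
    (hF : DifferentiableAt ℂ F fun i => (x i : ℂ) + t * ν i) :
    HasDerivAt (fun t : ℝ => F fun i => (x i : ℂ) + t * ν i)
      (∑ i, (ν i : ℂ) * deriv (fun s => F (Function.update (fun i => (x i : ℂ) + t * ν i) i s))
        ((x i : ℂ) + t * ν i)) t := by
  have hline : HasDerivAt (fun t : ℝ => fun i => (x i : ℂ) + t * ν i) (fun i => (ν i : ℂ)) t := by
    refine hasDerivAt_pi.mpr fun i => ?_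
    simpa using ((Complex.ofRealCLM.hasDerivAt (x := t)).mul_const (ν i : ℂ)).const_add (x i : ℂ)
  refine ((hF.hasFDerivAt.restrictScalars ℝ).comp_hasDerivAt t hline).congr_deriv ?_
  rw [ContinuousLinearMap.coe_restrictScalars',
    ← ContinuousLinearMap.coe_coe, LinearMap.pi_apply_eq_sum_univ]
  refine Finset.sum_congr rfl fun i _ => ?_
  have h1 := hasDerivAt_update (fun i => (x i : ℂ) + t * ν i) i ((x i : ℂ) + t * ν i)
  have h2 : HasFDerivAt F (fderiv ℂ F fun i => (x i : ℂ) + t * ν i)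
      (Function.update (fun i => (x i : ℂ) + t * ν i) i ((x i : ℂ) + t * ν i)) := by
    rw [Function.update_eq_self i fun i => (x i : ℂ) + t * ν i]
    exact hF.hasFDerivAt
  have h3 := (h2.comp_hasDerivAt _ h1).deriv
  simp only [Function.comp_def] at h3
  have h4 : (fun j => if i = j then (1 : ℂ) else 0) = Pi.single i 1 := by
    ext j
    simp [Pi.single_apply, eq_comm]
  rw [h3, smul_eq_mul, h4]
  rfl

lemma tendsto_line_chamberAtTop (x : Fin n → ℝ) {ν : Fin n → ℝ} (hν : ∀ i j, i < j → ν j < ν i) :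
    Filter.Tendsto (fun t : ℝ => fun i => x i + t * ν i) Filter.atTop (chamberAtTop n) := by
  unfold chamberAtTop
  simp only [Filter.tendsto_iInf, Filter.tendsto_comap_iff]
  intro i j hij
  have h1 : 0 < ν i - ν j := sub_pos.mpr (hν i j (Finset.mem_Ioi.mp hij))
  refine (Filter.tendsto_atTop_add_const_left _ (x i - x j)
    (Filter.tendsto_id.atTop_mul_const h1)).congr fun t => ?_
  simp only [id, Function.comp_apply]
  ring

/-- Descent on the degree in `τ`. By the transport equation the top coefficient over `B^m` is
constant along the lines `x + t ν`, which run to infinity in the chamber, where its limit is 0. -/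
lemma eq_zero_of_sutherland {m : ℕ} {ν : Fin n → ℝ} (hν : ∀ i j, i < j → ν j < ν i) {τ : ℕ → ℂ}
    (hτ : Function.Injective τ) (N : ℕ) {h : ℕ → (Fin n → ℂ) → ℂ} (hh : ∀ k, Differentiable ℂ (h k))
    (heq : ∀ p x, OffWalls x →
      sutherland m (fun y => (∑ k ∈ Finset.range N, τ p ^ k * h k y) / sinhB y ^ m *
        Complex.exp (2 * ∑ i, τ p * ν i * y i)) x =
      -4 * (∑ i, (τ p * ν i) ^ 2) * ((∑ k ∈ Finset.range N, τ p ^ k * h k x) / sinhB x ^ m *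
        Complex.exp (2 * ∑ i, τ p * ν i * x i)))
    (hlim : ∀ p, Filter.Tendsto (fun x : Fin n → ℝ =>
      (∑ k ∈ Finset.range N, τ p ^ k * h k fun i => (x i : ℂ)) / (sinhB fun i => (x i : ℂ)) ^ m)
      (chamberAtTop n) (nhds 0)) :
    ∀ k < N, ∀ x, h k x = 0 := by
  induction N with
  | zero => exact fun k hk => absurd hk (Nat.not_lt_zero k)
  | succ N ih =>
    have hN : ∀ x, h N x = 0 := by
      -- It suffices to treat real `x` in the chamber: for `t ≥ 0` the line `x + t ν` stays there
      -- and avoids the walls.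
      refine eq_zero_of_chamber (hh N) fun x hx => ?_
      let F : (Fin n → ℂ) → ℂ := fun y => h N y / sinhB y ^ m
      have hlt : ∀ t : ℝ, 0 ≤ t → ∀ i j, i < j → x j + t * ν j < x i + t * ν i := by
        intro t ht i j hij
        have := mul_le_mul_of_nonneg_left (hν i j hij).le ht
        linarith [hx i j hij]
      have hoff : ∀ t : ℝ, 0 ≤ t → OffWalls fun i => (x i : ℂ) + t * ν i := by
        intro t ht
        simpa using offWalls_of_lt (hlt t ht)
      have hder : ∀ t : ℝ, 0 ≤ t → HasDerivAt (fun t : ℝ => F fun i => (x i : ℂ) + t * ν i) 0 t := by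
        intro t ht
        refine (hasDerivAt_line (differentiableAt_div_sinhB (hh N) m (hoff t ht))).congr_deriv ?_
        exact transport_of_sutherland hτ hh (hoff t ht) fun p => heq p _ (hoff t ht)
      have hconst : ∀ t : ℝ, 0 ≤ t → (F fun i => (x i : ℂ) + t * ν i) = F fun i => (x i : ℂ) := by
        intro t ht
        have := constant_of_has_deriv_right_zero
          (f := fun t : ℝ => F fun i => (x i : ℂ) + t * ν i) (a := 0) (b := t)
          (fun s hs => (hder s hs.1).continuousAt.continuousWithinAt)
          (fun s hs => (hder s hs.1).hasDerivWithinAt) t ⟨ht, le_rfl⟩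
        simpa using this
      have hF0 : Filter.Tendsto (fun x : Fin n → ℝ => F fun i => (x i : ℂ)) (chamberAtTop n)
          (nhds 0) := by
        refine tendsto_coeff_of_tendsto_eval hτ (N := N + 1)
          (c := fun k (x : Fin n → ℝ) => h k (fun i => (x i : ℂ)) / (sinhB fun i => (x i : ℂ)) ^ m)
          (fun p => (hlim p).congr fun x => ?_) (Nat.lt_succ_self N)
        rw [Finset.sum_div]
        exact Finset.sum_congr rfl fun k _ => mul_div_assoc _ _ _
      have h1 := hF0.comp (tendsto_line_chamberAtTop x hν)
      have h2 : Filter.Tendsto (fun _ : ℝ => F fun i => (x i : ℂ)) Filter.atTop (nhds 0) := by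
        refine h1.congr' ?_
        filter_upwards [Filter.eventually_ge_atTop 0] with t ht
        rw [← hconst t ht]
        simp
      have h3 : (F fun i => (x i : ℂ)) = 0 := tendsto_nhds_unique tendsto_const_nhds h2
      exact (div_eq_zero_iff.mp h3).resolve_right (pow_ne_zero m (sinhB_ne_zero (offWalls_of_lt hx)))
    simp only [Finset.sum_range_succ, hN, mul_zero, add_zero] at heq hlim
    intro k hk
    rcases Nat.lt_succ_iff_lt_or_eq.mp hk with hk | rfl
    · exact ih heq hlim k hk
    · exact hN

lemma TrigPoly.value_eq_sum (P : TrigPoly n) (x ν : Fin n → ℂ) : P.value x ν =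
    ∑ a ∈ P.support, Complex.exp (∑ i, (a i : ℂ) * x i) * MvPolynomial.eval ν (P a) := by
  simp [TrigPoly.value, TrigPoly.atX, Finsupp.sum, map_sum]

lemma TrigPoly.value_sub (P P' : TrigPoly n) (x ν : Fin n → ℂ) :
    (P - P').value x ν = P.value x ν - P'.value x ν := by
  simp only [TrigPoly.value, TrigPoly.atX]
  rw [Finsupp.sum_sub_index (fun a p q => mul_sub _ p q), map_sub]

lemma TrigPoly.differentiable_value_left (P : TrigPoly n) (ν : Fin n → ℂ) :
    Differentiable ℂ fun x => P.value x ν := by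
  simp only [TrigPoly.value_eq_sum]
  fun_prop

lemma TrigPoly.differentiable_value_right (P : TrigPoly n) (x : Fin n → ℂ) :
    Differentiable ℂ fun ν => P.value x ν := by
  simp only [TrigPoly.value_eq_sum, MvPolynomial.eval_eq]
  fun_prop

/-- Restriction to a ray turns the polynomial dependence on `ν` into a polynomial in the single
parameter `τ`, with coefficients entire in `x`. -/
lemma TrigPoly.exists_value_smul (P : TrigPoly n) (ν : Fin n → ℂ) :
    ∃ (N : ℕ) (h : ℕ → (Fin n → ℂ) → ℂ), (∀ k, Differentiable ℂ (h k)) ∧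
      ∀ τ x, P.value x (fun i => τ * ν i) = ∑ k ∈ Finset.range N, τ ^ k * h k x := by
  let q : (Fin n → ℤ) → Polynomial ℂ := fun a =>
    MvPolynomial.aeval (fun i => Polynomial.C (ν i) * Polynomial.X) (P a)
  have hq : ∀ a τ, (q a).eval τ = MvPolynomial.eval (fun i => τ * ν i) (P a) := by
    intro a τ
    simp only [q]
    induction P a using MvPolynomial.induction_on with
    | C r => simp
    | add p q hp hq => simp only [map_add, Polynomial.eval_add, hp, hq]
    | mul_X p i hp =>
      simp only [map_mul, Polynomial.eval_mul, hp, MvPolynomial.aeval_X, Polynomial.eval_C,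
        Polynomial.eval_X, MvPolynomial.eval_X, mul_comm τ]
  refine ⟨P.support.sup (fun a => (q a).natDegree) + 1, fun k x =>
    ∑ a ∈ P.support, Complex.exp (∑ i, (a i : ℂ) * x i) * (q a).coeff k, fun k => by fun_prop,
    fun τ x => ?_⟩
  rw [TrigPoly.value_eq_sum]
  simp only [Finset.mul_sum]
  rw [Finset.sum_comm]
  refine Finset.sum_congr rfl fun a ha => ?_
  rw [← hq, Polynomial.eval_eq_sum_range' (Nat.lt_succ_of_le
    (Finset.le_sup (f := fun a => (q a).natDegree) ha)), Finset.mul_sum]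
  exact Finset.sum_congr rfl fun k _ => by ring

lemma analyticAt_value_mul_exp (P : TrigPoly n) (m : ℕ) (ν : Fin n → ℂ) {x : Fin n → ℂ}
    (hx : OffWalls x) (l : Fin n) :
    AnalyticAt ℂ (fun s => P.value (Function.update x l s) ν / sinhB (Function.update x l s) ^ m *
      Complex.exp (2 * ∑ i, ν i * Function.update x l s i)) (x l) := by
  refine (analyticAt_div_sinhB (P.differentiable_value_left ν) m hx l).mul ?_
  have h1 : Differentiable ℂ fun y : Fin n → ℂ => Complex.exp (2 * ∑ i, ν i * y i) := by fun_prop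
  have h2 : Differentiable ℂ fun s => Function.update x l s := fun s =>
    (hasDerivAt_update x l s).differentiableAt
  exact (h1.comp h2).analyticAt _

/-- Clears the factor `C_m(ν)`, which is constant in `x`, so that the equation becomes polynomial in
`ν` up to the exponential. -/
lemma sutherland_of_isTrigBA {m : ℕ} {Φ : (Fin n → ℂ) → (Fin n → ℂ) → ℂ} {P : TrigPoly n}
    {ν : Fin n → ℂ} (hν : normC m ν ≠ 0)
    (hΦ : ∀ x, OffWalls x →
      Φ x ν = P.value x ν / (sinhB x ^ m * normC m ν) * Complex.exp (2 * ∑ i, ν i * x i))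
    {x : Fin n → ℂ} (hx : OffWalls x)
    (h : sutherland m (fun y => Φ y ν) x = -4 * (∑ i, ν i ^ 2) * Φ x ν) :
    sutherland m (fun y => P.value y ν / sinhB y ^ m * Complex.exp (2 * ∑ i, ν i * y i)) x =
      -4 * (∑ i, ν i ^ 2) * (P.value x ν / sinhB x ^ m * Complex.exp (2 * ∑ i, ν i * x i)) := by
  have h1 : ∀ y, OffWalls y → P.value y ν / sinhB y ^ m * Complex.exp (2 * ∑ i, ν i * y i) =
      normC m ν * Φ y ν := by
    intro y hy
    rw [hΦ y hy]
    field_simp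
  unfold sutherland at h ⊢
  have h3 : ∀ l, iteratedDeriv 2 (fun s => P.value (Function.update x l s) ν /
      sinhB (Function.update x l s) ^ m *
      Complex.exp (2 * ∑ i, ν i * Function.update x l s i)) (x l) =
      normC m ν * iteratedDeriv 2 (fun s => Φ (Function.update x l s) ν) (x l) := by
    intro l
    rw [← iteratedDeriv_const_mul_field]
    refine Filter.EventuallyEq.iteratedDeriv_eq 2 ?_
    filter_upwards [eventually_offWalls_update hx l] with s hs
    exact h1 _ hs
  simp only [h3, ← Finset.mul_sum, h1 x hx]
  linear_combination normC m ν * h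

/-- Uniqueness of the Baker-Akhiezer function. -/
theorem IsTrigBA.unique {m : ℕ} {Φ Φ' : (Fin n → ℂ) → (Fin n → ℂ) → ℂ} (h : IsTrigBA n m Φ)
    (h' : IsTrigBA n m Φ') {x ν : Fin n → ℂ} (hx : OffWalls x) (hν : normC m ν ≠ 0) :
    Φ x ν = Φ' x ν := by
  obtain ⟨⟨P, -, hΦ, hlim⟩, heq⟩ := h
  obtain ⟨⟨P', -, hΦ', hlim'⟩, heq'⟩ := h'
  suffices hD : ∀ ν x, (P - P').value x ν = 0 by
    have h1 := hD ν x
    rw [TrigPoly.value_sub, sub_eq_zero] at h1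
    rw [hΦ x ν hx hν, hΦ' x ν hx hν, h1]
  have key : ∀ ν : Fin n → ℝ, (∀ i j, i < j → ν j < ν i) → ∀ x,
      (P - P').value x (fun i => (ν i : ℂ)) = 0 := by
    intro ν hν x
    obtain ⟨N, c, hc, hval⟩ := (P - P').exists_value_smul fun i => (ν i : ℂ)
    -- The nodes are nonpositive so that `C_m` does not vanish on them: for `i < j` every factor `-p
    -- (ν_i - ν_j) - k` is negative.
    let τ : ℕ → ℂ := fun p => -(p : ℂ)
    have hτ : Function.Injective τ := fun p q hpq => by
      exact_mod_cast neg_injective hpq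
    have hC : ∀ p, normC m (fun i => τ p * ν i) ≠ 0 := by
      intro p
      refine Finset.prod_ne_zero_iff.mpr fun k hk => Finset.prod_ne_zero_iff.mpr fun i _ =>
        Finset.prod_ne_zero_iff.mpr fun j hj => ?_
      have h1 : (0 : ℝ) ≤ p * (ν i - ν j) :=
        mul_nonneg p.cast_nonneg (sub_nonneg.mpr (hν i j (Finset.mem_Ioi.mp hj)).le)
      have h2 : (1 : ℝ) ≤ k := by exact_mod_cast (Finset.mem_Icc.mp hk).1
      have h3 : τ p * ν i - τ p * ν j - (k : ℂ) = ((-(p * (ν i - ν j)) - k : ℝ) : ℂ) := by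
        simp only [τ]
        push_cast
        ring
      rw [h3]
      exact Complex.ofReal_ne_zero.mpr (by linarith)
    have hzero := eq_zero_of_sutherland (m := m) hν hτ N hc ?_ ?_
    · have h1 := hval 1 x
      simp only [one_mul] at h1
      rw [h1]
      exact Finset.sum_eq_zero fun k hk => by rw [hzero k (Finset.mem_range.mp hk), mul_zero]
    · intro p x hx
      simp only [← hval]
      have h1 := sutherland_of_isTrigBA (hC p) (fun x hx => hΦ x _ hx (hC p)) hx
        (heq x _ hx (hC p))
      have h2 := sutherland_of_isTrigBA (hC p) (fun x hx => hΦ' x _ hx (hC p)) hx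
        (heq' x _ hx (hC p))
      unfold sutherland at h1 h2 ⊢
      simp only [TrigPoly.value_sub, sub_div, sub_mul]
      have h3 : ∀ l, _ := fun l => iteratedDeriv_fun_sub (n := 2)
        (analyticAt_value_mul_exp P m (fun i => τ p * ν i) hx l).contDiffAt
        (analyticAt_value_mul_exp P' m (fun i => τ p * ν i) hx l).contDiffAt
      simp only [h3, Finset.sum_sub_distrib]
      linear_combination h1 - h2
    · intro p
      have h1 := ((hlim _ (hC p)).sub (hlim' _ (hC p))).const_mul (normC m fun i => τ p * ν i)
      rw [sub_self, mul_zero] at h1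
      refine h1.congr fun x => ?_
      rw [← hval, TrigPoly.value_sub, ← sub_div, mul_comm, div_mul_eq_mul_div, mul_comm (_ ^ m),
        mul_comm _ (normC _ _), mul_div_mul_left _ _ (hC p)]
  intro ν x
  -- The difference is entire in `ν` and vanishes on the real chamber, hence for all complex `ν`.
  exact eq_zero_of_chamber ((P - P').differentiable_value_right x) (fun ν hν => key ν hν x) ν

end Uniqueness


/-! ### Matching the constants in the residue formula. -/

section ResidueFormula

lemma prod_pairs_const {M : Type*} [CommMonoid M] (n : ℕ) (c : M) :
    ∏ i : Fin n, ∏ _j ∈ Finset.Ioi i, c = c ^ (n * (n - 1) / 2) := by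
  simp only [Finset.prod_const, Fin.card_Ioi, Finset.prod_pow_eq_pow_sum]
  rw [Fin.sum_univ_eq_sum_range (fun i => n - 1 - i), Finset.sum_range_reflect (fun i => i),
    Finset.sum_range_id]

/-- The numerators `(ν_i - ν_j - 1) ⋯ (ν_i - ν_j - m)` multiply to `C_m(ν)`. The factorials cancel
those produced by the residues of order `m + 1`. -/
lemma prod_gbinom_eq {n : ℕ} (m : ℕ) (ν : Fin n → ℂ) :
    ∏ i, ∏ j ∈ Finset.Ioi i, gbinom (ν i - ν j - 1) m =
      normC m ν / (m.factorial : ℂ) ^ (n * (n - 1) / 2) := by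
  have h : ∀ i j, gbinom (ν i - ν j - 1) m =
      (∏ k ∈ Finset.Icc 1 m, (ν i - ν j - (k : ℂ))) / (m.factorial : ℂ) := by
    intro i j
    rw [gbinom, Finset.range_eq_Ico, ← Finset.Ico_add_one_right_eq_Icc,
      ← zero_add 1, ← Finset.prod_Ico_add' (fun k : ℕ => ν i - ν j - (k : ℂ)) 0 m 1]
    congr 1
    refine Finset.prod_congr rfl fun k _ => ?_
    push_cast
    ring
  simp only [h, Finset.prod_div_distrib, prod_pairs_const]
  congr 1
  rw [normC, Finset.prod_comm]
  exact Finset.prod_congr rfl fun i _ => Finset.prod_comm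

lemma powProd_exp {n : ℕ} (x e : Fin n → ℂ) :
    powProd x (fun i => Complex.exp (2 * x i)) e = Complex.exp (∑ i, e i * (2 * x i)) := by
  simp [powProd, branchPow, Complex.exp_sum]

/-- The radii `ε (n - j)` are strictly decreasing and reach 0 in the last row, so the free last row
of the general formula sits exactly at the centres. -/
lemma trigResidueIntegral_eq {n : ℕ} (m : ℕ) {x ν : Fin (n + 1) → ℂ} {ε : ℝ} (hε : 0 < ε)
    (h0 : ∀ i, (((n + 1 : ℕ) : ℝ) - 1) * ε < ‖Complex.exp (2 * x i)‖)
    (hc : ∀ i j, i ≠ j → 2 * ((((n + 1 : ℕ) : ℝ) - 1) * ε) <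
      ‖Complex.exp (2 * x i) - Complex.exp (2 * x j)‖) :
    trigResidueIntegral m x ν ε = (2 * Real.pi * Complex.I / (m.factorial : ℂ)) ^ ((n + 1) * n / 2) *
      (powProd x (fun i => Complex.exp (2 * x i)) (fun i => ν i - ν (Fin.last n)) *
        (vandA (fun i => Complex.exp (2 * x i)) ^ (m + 1))⁻¹ *
        symEval id (fun i => Complex.exp (2 * x i)) ν (baPoly m (n + 1))) := by
  have hR0 : ε * (((n + 1 : ℕ) : ℝ) - ((0 : ℕ) + 1)) = (((n + 1 : ℕ) : ℝ) - 1) * ε := by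
    push_cast
    ring
  have hRn : ε * (((n + 1 : ℕ) : ℝ) - ((n : ℕ) + 1)) = 0 := by
    push_cast
    ring
  rw [trigResidueIntegral, omegaStar_eq_triIntegrand]
  refine circlesIntegral_triIntegrand m n x ν _ (fun j => ε * (((n + 1 : ℕ) : ℝ) - ((j : ℝ) + 1)))
    (fun j _ => ?_) hRn.ge (fun i => ?_) (fun i j hij => ?_) fun i => ?_
  · refine mul_lt_mul_of_pos_left ?_ hε
    push_cast
    linarith
  · exact hR0.trans_lt (h0 i)
  · exact (congrArg (2 * ·) hR0).trans_lt (hc i j hij)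
  · exact Metric.mem_closedBall_self hRn.ge

end ResidueFormula

theorem mainTheorem6 (n m : ℕ) (hn : 0 < n) :
    (∃ Φ : (Fin n → ℂ) → (Fin n → ℂ) → ℂ, IsTrigBA n m Φ) ∧
    ∀ Φ : (Fin n → ℂ) → (Fin n → ℂ) → ℂ, IsTrigBA n m Φ →
      ∀ (x ν : Fin n → ℂ) (ε : ℝ),
        OffWalls x → normC m ν ≠ 0 → 0 < ε →
        (∀ i, ((n : ℝ) - 1) * ε < ‖Complex.exp (2 * x i)‖) →
        (∀ i j, i ≠ j →
          2 * (((n : ℝ) - 1) * ε) < ‖Complex.exp (2 * x i) - Complex.exp (2 * x j)‖) →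
        Φ x ν =
          trigConst m ν * (∏ i, Complex.exp (ν ⟨n - 1, by omega⟩ * (2 * x i))) *
            vandA (fun i => Complex.exp (2 * x i)) ^ (1 + m) *
            trigResidueIntegral m x ν ε := by
  obtain ⟨P, hP, hBA⟩ := exists_isTrigBA m n
  refine ⟨⟨_, hBA⟩, fun Φ hΦ x ν ε hx hν hε h0 hc => ?_⟩
  obtain ⟨k, rfl⟩ : ∃ k, n = k + 1 := ⟨n - 1, by omega⟩
  have hu : (expPt x) = fun i => Complex.exp (2 * x i) := rfl
  have hA : vandA (fun i => Complex.exp (2 * x i)) ≠ 0 := vandA_ne_zero hx.injective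
  have hB := sinhB_ne_zero hx
  have hm : (m.factorial : ℂ) ≠ 0 := Nat.cast_ne_zero.mpr m.factorial_ne_zero
  have hpi : 2 * (Real.pi : ℂ) * Complex.I ≠ 0 := Complex.two_pi_I_ne_zero
  -- By uniqueness it suffices to treat the constructed function, whose numerator is `B^m` times
  -- `baPoly`.
  rw [hΦ.unique hBA hx hν]
  rw [hP x ν hx, hu, trigResidueIntegral_eq m hε h0 hc, trigConst, prod_gbinom_eq, powProd_exp,
    ← Complex.exp_sum]
  -- The integral carries the exponents `ν_i - ν_n`; the prefactor `∏ u_i^(ν_n)` restores the full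
  -- exponential.
  have he : Complex.exp (2 * ∑ i, ν i * x i) = Complex.exp (∑ i, ν (Fin.last k) * (2 * x i)) *
      Complex.exp (∑ i, (ν i - ν (Fin.last k)) * (2 * x i)) := by
    rw [← Complex.exp_add, ← Finset.sum_add_distrib, Finset.mul_sum]
    congr 1
    exact Finset.sum_congr rfl fun i _ => by ring
  have hlast : (⟨k + 1 - 1, by omega⟩ : Fin (k + 1)) = Fin.last k := rfl
  rw [he, hlast, Nat.add_sub_cancel, add_comm 1 m, div_pow]
  field_simp
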